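/- Let $p\ge 2$ and let $\Phi$ be a germ of biholomorphism of $\mathbb C^p$ fixing $0$, tangent to the identity of order $k+1\ge 2$, that is, $\Phi(z)=z+P_{k+1}(z)+O(\|z\|^{k+2})$ with $P_{k+1}\not\equiv 0$ homogeneous of degree $k+1$. Let $[V]$ be a non-degenerate characteristic direction: $V\neq 0$, $P_{k+1}(V)=cV$ for some $c\in\mathbb C$, and $P_{k+1}(V)\ne 0$. Choose a coordinate $z_j$ with $V_j\ne 0$, write $z=(x,y)\in\mathbb C\times\mathbb C^{p-1}$ with $x=z_j$, $P_{k+1}=(p_{k+1},q_{k+1})$ and $[V]=[1:u_0]$, put $r(u)=q_{k+1}(1,u)-p_{k+1}(1,u)\,u$, and let $$A=A(V)=\frac{1}{k\,p_{k+1}(1,u_0)}\,r'(u_0)$$ be the $(p-1)\times(p-1)$ matrix associated to $[V]$. Suppose that $A$ has exactly $d$ eigenvalues, counted with algebraic multiplicity, with strictly positive real part, and let $E\subset\mathbb C^{p-1}=\{0\}\times\mathbb C^{p-1}$ be the sum of the corresponding generalized eigenspaces. Then there is a parabolic manifold $M\subset\mathbb C^p$ of dimension $d+1$ for $\Phi$,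 tangent to $[V]$ at $0$. This means: $M=\psi(S)$, where $S\subset\mathbb C^{d+1}$ is a domain with $0\in\partial S$ and $\psi:S\to\mathbb C^p$ is an injective holomorphic immersion with $\psi(X)\to 0$ and $[\psi(X)]\to[V]$ as $X\to 0$ in $S$; moreover $\Phi(M)\subset M$, and $\Phi^n(z)\to 0$ as $n\to\infty$ for each $z\in M$. In addition, $M$ can be chosen with the following properties. 1. $0\in\partial M$, and $M$ is tangent to $\mathbb CV\oplus E$ at $0$: this space has dimension $d+1$, and the tangent spaces $T_zM$ converge to it as $z\to 0$ in $M$. 2. Each point of $M$ is attracted to the origin along $[V]$: for every $z\in M$, $\Phi^n(z)\to 0$ and $[\Phi^n(z)]\to[V]$ in $\mathbb{CP}^{p-1}$. 3. There are holomorphic coordinates $(x,u,v)$, mapping an open subset $\Omega$ of $\mathbb C^p$ biholomorphically onto a sector $$\{(x,u,v)\in\mathbb C\times\mathbb C^d\times\mathbb C^{p-d-1}: |\mathrm{Im}\,x^k|<\gamma\,\mathrm{Re}\,x^k,\ |x^k|<s,\ |\arg x|<\pi/k,\ \|(u,v)\|<\rho\}$$ with $\gamma,s,\rho>0$, such that the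 point with coordinates $(x,u,v)$ tends to $0$ along $[V]$ as $(x,u,v)\to 0$, and $M=\{z\in\Omega: v(z)=0\}$. -/

import Mathlib

open Set Filter Topology

noncomputable section

/-- `ℂⁿ` with its Euclidean norm. -/
abbrev Cn (n : ℕ) : Type := EuclideanSpace ℂ (Fin n)

/-- The homogeneous part `P_j` of degree `j` in the expansion `Φ(z) = ∑ P_j(z)` at the origin of a
map that is holomorphic near the origin. -/
def homPart {p : ℕ} (Φ : Cn p → Cn p) (j : ℕ) (z : Cn p) : Cn p :=
  ((j.factorial : ℂ))⁻¹ • iteratedFDeriv ℂ j Φ 0 (fun _ => z)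

/-- `Φ` represents a germ at `0` of a holomorphic map of `ℂ^p` that fixes the origin, is tangent to
the identity (hence is a germ of biholomorphism), and has order `k + 1`: the least `ν ≥ 2` with
`P_ν ≢ 0` is `k + 1`. In particular `k ≥ 1`. -/
structure IsTangentToIdentityOfOrder {p : ℕ} (Φ : Cn p → Cn p) (k : ℕ) : Prop where
  analyticAt : AnalyticAt ℂ Φ 0
  map_zero : Φ 0 = 0
  homPart_one : ∀ z, homPart Φ 1 z = z
  order : IsLeast {ν : ℕ | 2 ≤ ν ∧ ∃ z, homPart Φ ν z ≠ 0} (k + 1)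

/-- `[V]` is a non-degenerate characteristic direction of the homogeneous map `P`. -/
structure IsNondegenerateCharacteristic {p : ℕ} (P : Cn p → Cn p) (V : Cn p) : Prop where
  ne_zero : V ≠ 0
  eigen : ∃ c : ℂ, P V = c • V
  nondegenerate : P V ≠ 0

/-- The index set of the coordinates other than the `j`-th one. -/
abbrev Others {p : ℕ} (j : Fin p) : Type := {i : Fin p // i ≠ j}

/-- The point `(1, u)` of `ℂ^p`, the `1` being the `j`-th coordinate. -/
def affinePoint {p : ℕ} (j : Fin p) (u : Others j → ℂ) : Cn p :=
  WithLp.toLp 2 (fun i => if h : i = j then 1 else u ⟨i, h⟩)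

/-- The affine coordinate `u₀` of `[V] = [1 : u₀]` in the chart `z_j ≠ 0` of the projective
space. -/
def affineCoord {p : ℕ} (j : Fin p) (V : Cn p) : Others j → ℂ :=
  fun i => V i.1 / V j

/-- The map `r(u) = q(1,u) - p(1,u) u`, where `P = (p, q)`, `p` being the `j`-th component of `P`
and `q` the vector of its other components. -/
def charMap {p : ℕ} (P : Cn p → Cn p) (j : Fin p) (u : Others j → ℂ) : Others j → ℂ :=
  fun i => P (affinePoint j u) i.1 - P (affinePoint j u) j * u i

/-- The matrix `A(V) = r'(u₀) / (k p(1,u₀))` associated to the non-degenerate characteristic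
direction `[V] = [1 : u₀]` of a germ of order `k + 1` with leading term `P`, computed in the chart
`z_j ≠ 0`. -/
def directorMatrix {p : ℕ} (P : Cn p → Cn p) (k : ℕ) (j : Fin p) (V : Cn p) :
    Matrix (Others j) (Others j) ℂ :=
  ((k : ℂ) * P (affinePoint j (affineCoord j V)) j)⁻¹ •
    LinearMap.toMatrix'
      (fderiv ℂ (charMap P j) (affineCoord j V) : (Others j → ℂ) →ₗ[ℂ] (Others j → ℂ))

/-- The number of eigenvalues of `A` with strictly positive real part, counted with (algebraic)
multiplicity. -/
def attractingCount {ι : Type} [Fintype ι] [DecidableEq ι] (A : Matrix ι ι ℂ) : ℕ :=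
  (A.charpoly.roots.filter (fun μ : ℂ => 0 < μ.re)).card

/-- The sum of the generalized eigenspaces of `A` that belong to the eigenvalues with strictly
positive real part. -/
def attractingEigenspace {ι : Type} [Fintype ι] [DecidableEq ι] (A : Matrix ι ι ℂ) :
    Submodule ℂ (ι → ℂ) :=
  ⨆ μ ∈ {μ : ℂ | 0 < μ.re}, Module.End.maxGenEigenspace (Matrix.toLin' A) μ

/-- The inclusion `u ↦ (0, u)` of `ℂ^{p-1}` into `ℂ^p`, the `0` being the `j`-th coordinate. -/
def includeOthers {p : ℕ} (j : Fin p) : (Others j → ℂ) →ₗ[ℂ] Cn p where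
  toFun u := WithLp.toLp 2 (fun i => if h : i = j then 0 else u ⟨i, h⟩)
  map_add' u v := by
    ext i
    by_cases h : i = j <;> simp [h]
  map_smul' c u := by
    ext i
    by_cases h : i = j <;> simp [h]

/-- The subspace `ℂ V ⊕ E` of `ℂ^p`, where `E` is a space of vectors in `ℂ^{p-1}`. -/
def linePlus {p : ℕ} (j : Fin p) (V : Cn p) (E : Submodule ℂ (Others j → ℂ)) :
    Submodule ℂ (Cn p) :=
  Submodule.span ℂ {V} ⊔ E.map (includeOthers j)

/-- Convergence `[f] → [V]` in the projective space along the filter `l`: eventually `f ≠ 0`, and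
suitable multiples of `f` converge to `V` (to be used with `V ≠ 0`). -/
def TendstoDirection {α : Type} {p : ℕ} (f : α → Cn p) (l : Filter α) (V : Cn p) : Prop :=
  (∀ᶠ a in l, f a ≠ 0) ∧ ∃ c : α → ℂ, Tendsto (fun a => c a • f a) l (𝓝 V)

/-- `M = ψ(S)` is a parabolic manifold of dimension `n` for `Φ` at the origin, tangent to `[V]`,
where `ψ` is an injective holomorphic immersion of the domain `S` of `ℂⁿ`. -/
structure IsParabolicManifold {p : ℕ} (Φ : Cn p → Cn p) (V : Cn p) (n : ℕ) (M : Set (Cn p))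
    (S : Set (Cn n)) (ψ : Cn n → Cn p) : Prop where
  isOpen : IsOpen S
  isConnected : IsConnected S
  zero_mem_frontier : (0 : Cn n) ∈ frontier S
  holomorphic : DifferentiableOn ℂ ψ S
  injOn : InjOn ψ S
  immersion : ∀ X ∈ S, Function.Injective (fderiv ℂ ψ X)
  image_eq : ψ '' S = M
  tendsto_zero : Tendsto ψ (𝓝[S] 0) (𝓝 0)
  tendsto_direction : TendstoDirection ψ (𝓝[S] 0) V
  invariant : MapsTo Φ M M
  orbit : ∀ z ∈ M, Tendsto (fun m : ℕ => Φ^[m] z) atTop (𝓝 0)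

/-- The immersed manifold `M = ψ(S)`, of dimension `n`, is tangent to the subspace `W` at the
origin: `W` has dimension `n`, and the tangent spaces `T_z M` converge to `W` (in the Grassmannian
of `n`-dimensional subspaces) as `z → 0` in `M`. For subspaces of the same dimension this
convergence means that the distance of each fixed vector of `W` from `T_z M` tends to `0`. -/
def IsTangentToSubspace {p n : ℕ} (S : Set (Cn n)) (ψ : Cn n → Cn p)
    (W : Submodule ℂ (Cn p)) : Prop :=
  Module.finrank ℂ W = n ∧
    ∀ w ∈ W, Tendsto (fun X => Metric.infDist w (range (fderiv ℂ ψ X)))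
      (comap ψ (𝓝 0) ⊓ 𝓟 S) (𝓝 0)

/-- The sector of the `x`-plane given by `|Im x^k| < γ Re x^k`, `|x^k| < s`: of the `k` components
of this set, the one that contains the small positive reals. -/
def planeSector (k : ℕ) (γ s : ℝ) : Set ℂ :=
  {x | |(x ^ k).im| < γ * (x ^ k).re ∧ ‖x ^ k‖ < s ∧ |x.arg| < Real.pi / k}

/-- The sector `{(x,u,v) : x in the plane sector, ‖(u,v)‖ < ρ}` of `ℂ × ℂ^d × ℂ^l`. -/
def sector (k d l : ℕ) (γ s ρ : ℝ) : Set (ℂ × Cn d × Cn l) :=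
  {X | X.1 ∈ planeSector k γ s ∧ Real.sqrt (‖X.2.1‖ ^ 2 + ‖X.2.2‖ ^ 2) < ρ}

/-- `e = (x,u,v)` is a system of holomorphic coordinates at the origin of `ℂ^p`, along the direction
`[V]`, with values in a sector: a biholomorphism of an open set of `ℂ^p` onto a sector, such that
the point with coordinates `(x,u,v)` tends to `0` along `[V]` as `(x,u,v) → 0`. -/
structure IsSectorialCoordinates {p d l : ℕ} (k : ℕ) (V : Cn p)
    (e : OpenPartialHomeomorph (Cn p) (ℂ × Cn d × Cn l)) : Prop where
  target_eq : ∃ γ s ρ : ℝ, 0 < γ ∧ 0 < s ∧ 0 < ρ ∧ e.target = sector k d l γ s ρ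
  holomorphic : DifferentiableOn ℂ e e.source
  holomorphic_symm : DifferentiableOn ℂ e.symm e.target
  tendsto_zero : Tendsto e.symm (𝓝[e.target] 0) (𝓝 0)
  tendsto_direction : TendstoDirection e.symm (𝓝[e.target] 0) V

end

/-! Blow up the direction `[V]`. In the chart `z = x (1, u₀ + t)` the germ multiplies `x` by `1 + p
x^k + ...`, where `p = p_{k+1}(1, u₀)`, and moves `t` by `x^k r'(u₀) t`, with an error of order
`|x|^k (|x| + |t|²)` (`isBigO_blowUpRatio`, `isBigO_blowUpSlope`). Put `x = c w^(-1/k)` with `c^k k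
p = -1`, and `t = w^(-a) L⁻¹ s` with a small exponent `a > 0` and a linear change of basis `L`. On a
wedge around the positive real axis at infinity the germ becomes `w ↦ w + 1 + O(|w|^(-a))`, `s ↦ s -
w⁻¹ (A - a) s + O(|w|^(-1-a))`, with `A` written in the basis `L` (`exists_isHyperbolicOnWedge`).

The power `w^(-a)` does two things. It makes the quadratic terms decay, and it replaces `A` by `A -
a`. For small `a` the eigenvalues with positive real part keep it, while those with real part at
most `0` get a strictly negative one. No neutral direction is left: `s = (u, v)`, where `u` is
contracted and `v` expanded, in bases that make the two blocks accretive
(`exists_hyperbolic_splitting`).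

What remains is a stable manifold theorem on the wedge, proved by the Lyapunov–Perron method. An
orbit is compared with the model orbit `ω = w + n` by writing its base point as `ω + ω^(1-a/2) ζ`.
In the variables `(ζ, u)` and `v` the linear parts are non-expanding forward and backward
respectively, and the nonlinear terms are `O(|ω|^(-1-a/2))`, hence summable along the model orbit
(`norm_remainder_le`). Solving forward for `(ζ, u)` from `(0, u)`, and backward for `v` with `v → 0`
at the end, gives a unique bounded orbit depending holomorphically on `(w, u)`
(`exists_isStableOrbit`, `IsStableOrbit.unique`). Its initial `v` is a function `φ(w, u)` of size
`O(|w|^(-a/4))`. Uniqueness makes the graph of `φ` invariant (`exists_stable_graph`).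

The manifold `M` is this graph in the original coordinates; subtracting `φ` from `v` straightens it
and gives the sectorial chart (`graphHomeomorph`). Along `M` the slope `t` tends to `0`, so orbits
arrive along `[V]`. Cauchy estimates show that `w ∂t/∂w` and `∂φ/∂u` also tend to `0`, and this
gives the tangency to `ℂV ⊕ E`. -/

/-! ### Linear algebra: accretive bases and the splitting by the sign of the real part. -/

/-- An endomorphism whose eigenvalues have positive real part is accretive in suitable
coordinates. -/
theorem exists_accretive_coordinates (n : ℕ) : ∀ (W : Type) [AddCommGroup W] [Module ℂ W]
    [FiniteDimensional ℂ W], Module.finrank ℂ W = n → ∀ (T : Module.End ℂ W),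
    (∀ μ, T.HasEigenvalue μ → 0 < μ.re) →
    ∃ (b : W ≃ₗ[ℂ] Cn n) (c : ℝ), 0 < c ∧
      ∀ x, c * ‖b x‖ ^ 2 ≤ (inner ℂ (b x) (b (T x))).re := by
  induction n with
  | zero =>
    intro W _ _ _ hn T _
    refine ⟨LinearEquiv.ofFinrankEq _ _ (by rw [hn]; simp), 1, one_pos, fun x => ?_⟩
    rw [Subsingleton.elim (LinearEquiv.ofFinrankEq W (Cn 0) _ x) 0]
    simp
  | succ n ih =>
    intro W _ _ _ hn T hT
    have : Nontrivial W := Module.nontrivial_of_finrank_pos (R := ℂ) (by omega)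
    obtain ⟨μ, hμ⟩ := Module.End.exists_eigenvalue T
    have hμr := hT μ hμ
    set N : Module.End ℂ W := T - μ • (1 : Module.End ℂ W) with hN
    have hker : LinearMap.ker N ≠ ⊥ := by
      rw [hN, ← Module.End.eigenspace_def]; exact hμ
    -- Since `T - μ` is not onto, some nonzero functional `f` kills its range. This `f` is a left
    -- eigenvector, so its kernel is an invariant hyperplane on which the induction hypothesis
    -- applies.
    have hrange : LinearMap.range N < ⊤ := by
      rw [lt_top_iff_ne_top]
      intro h
      exact hker (LinearMap.ker_eq_bot_iff_range_eq_top.2 h)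
    obtain ⟨f, hf0, hf⟩ := Submodule.exists_le_ker_of_lt_top _ hrange
    have hfT : ∀ x, f (T x) = μ * f x := by
      intro x
      have : f (N x) = 0 := hf ⟨x, rfl⟩
      simpa [hN, sub_eq_zero] using this
    set H := LinearMap.ker f
    have hH : ∀ x ∈ H, T x ∈ H := by
      intro x hx
      have hx' : f x = 0 := hx
      change f (T x) = 0
      rw [hfT, hx', mul_zero]
    have hdim : Module.finrank ℂ H = n := by
      have := Module.Dual.finrank_ker_add_one_of_ne_zero hf0
      simp only [H]; omega
    obtain ⟨e, he⟩ : ∃ e, f e = 1 := by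
      obtain ⟨y, hy⟩ := DFunLike.ne_iff.1 hf0
      have hy' : f y ≠ 0 := hy
      exact ⟨(f y)⁻¹ • y, by simp [hy']⟩
    obtain ⟨b, c, hc, hb⟩ := ih H hdim (T.restrict hH) (by
      intro ν hν
      obtain ⟨v, hv⟩ := hν.exists_hasEigenvector
      refine hT ν (Module.End.hasEigenvalue_of_hasEigenvector (x := (v : W)) ⟨?_, ?_⟩)
      · rw [Module.End.mem_eigenspace_iff]
        have := congrArg Subtype.val hv.apply_eq_smul
        simpa using this
      · simpa using hv.2)
    let π : W →ₗ[ℂ] H := (LinearMap.id - f.smulRight e).codRestrict H (fun x => by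
      simp [H, he])
    have hπ : ∀ x, (π x : W) = x - f x • e := fun x => rfl
    set h0 : H := π (T e - μ • e)
    have hh0 : (h0 : W) = T e - μ • e := by
      rw [hπ, map_sub, map_smul, hfT, he]
      simp
    have hπT : ∀ x, π (T x) = T.restrict hH (π x) + f x • h0 := by
      intro x
      apply Subtype.ext
      simp only [hh0, Submodule.coe_add, Submodule.coe_smul, hπ, LinearMap.coe_restrict_apply, map_sub,
        map_smul, hfT]
      module
    set η := ‖b h0‖
    set m := μ.re
    -- In the basis `(f, π)` the map `T` is block triangular, with off-diagonal entry `h0`.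
    -- Stretching the coordinate `f` by `K` makes `K² m = η²/c + m`, just enough to absorb the cross
    -- term `y z η` by completing a square.
    set K : ℝ := Real.sqrt (η ^ 2 / (c * m) + 1)
    have hK2 : K ^ 2 = η ^ 2 / (c * m) + 1 := Real.sq_sqrt (by positivity)
    have hK : 0 < K := Real.sqrt_pos.2 (by positivity)
    let g : W →ₗ[ℂ] Cn (n + 1) :=
      (WithLp.linearEquiv 2 ℂ (Fin (n + 1) → ℂ)).symm.toLinearMap ∘ₗ
        LinearMap.pi (Fin.cons ((K : ℂ) • f)
          (fun i => (EuclideanSpace.proj (𝕜 := ℂ) i).toLinearMap ∘ₗ b.toLinearMap ∘ₗ π))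
    have g0 : ∀ x, g x 0 = K * f x := fun x => by simp [g]
    have gs : ∀ x i, g x (Fin.succ i) = b (π x) i := fun x i => by simp [g]
    have hg : Function.Injective g := by
      rw [← LinearMap.ker_eq_bot, LinearMap.ker_eq_bot']
      intro x hx
      have h1 : f x = 0 := by
        have := g0 x
        rw [hx] at this
        simpa [hK.ne'] using this.symm
      have h2 : b (π x) = 0 := by
        ext i
        have := gs x i
        rw [hx] at this
        simpa using this.symm
      have h3 : π x = 0 := by simpa using h2
      have := hπ x
      rw [h3, h1] at this
      simpa using this.symm
    refine ⟨LinearEquiv.ofInjectiveOfFinrankEq g hg (by simp [hn]), min (c / 2) (m / 2), by positivity, fun x => ?_⟩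
    change _ * ‖g x‖ ^ 2 ≤ (inner ℂ (g x) (g (T x))).re
    have hnorm : ‖g x‖ ^ 2 = K ^ 2 * ‖f x‖ ^ 2 + ‖b (π x)‖ ^ 2 := by
      rw [EuclideanSpace.norm_sq_eq, EuclideanSpace.norm_sq_eq, Fin.sum_univ_succ, g0]
      simp only [gs, norm_mul, Complex.norm_real, Real.norm_eq_abs, abs_of_pos hK, mul_pow]
    have hinner : inner ℂ (g x) (g (T x)) = (K : ℂ) ^ 2 * μ * (starRingEnd ℂ (f x) * f x)
        + inner ℂ (b (π x)) (b (π (T x))) := by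
      rw [PiLp.inner_apply, PiLp.inner_apply, Fin.sum_univ_succ, g0, g0]
      simp only [gs, RCLike.inner_apply, map_mul, hfT, Complex.conj_ofReal]
      ring
    rw [hinner, hπT, map_add, inner_add_right, map_smul, inner_smul_right]
    have h1 : ((K : ℂ) ^ 2 * μ * (starRingEnd ℂ (f x) * f x)).re = K ^ 2 * m * ‖f x‖ ^ 2 := by
      rw [Complex.conj_mul', ← Complex.ofReal_pow, ← Complex.ofReal_pow, Complex.re_mul_ofReal, Complex.re_ofReal_mul]
    have h2 : -(‖f x‖ * ‖b (π x)‖ * η) ≤ (f x * inner ℂ (b (π x)) (b h0)).re := by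
      refine neg_le_of_abs_le ((Complex.abs_re_le_norm _).trans ?_)
      rw [norm_mul, mul_assoc]
      gcongr
      exact norm_inner_le_norm _ _
    have h3 := hb (π x)
    rw [hnorm, Complex.add_re, Complex.add_re, h1]
    set y := ‖f x‖
    set z := ‖b (π x)‖
    have h4 : min (c / 2) (m / 2) * (K ^ 2 * y ^ 2 + z ^ 2) ≤ m / 2 * (K ^ 2 * y ^ 2) + c / 2 * z ^ 2 := by
      rw [mul_add]
      gcongr
      · exact min_le_right _ _
      · exact min_le_left _ _
    have h5 : m / 2 * (K ^ 2 * y ^ 2) + c / 2 * z ^ 2 ≤ K ^ 2 * m * y ^ 2 + c * z ^ 2 - y * z * η := by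
      have : K ^ 2 * m = η ^ 2 / c + m := by rw [hK2]; field_simp
      have e1 : η ^ 2 / c * y ^ 2 / 2 + c / 2 * z ^ 2 - y * z * η = (η * y - c * z) ^ 2 / (2 * c) := by
        field_simp; ring
      have e2 : 0 ≤ (η * y - c * z) ^ 2 / (2 * c) := by positivity
      have e3 : 0 ≤ m * y ^ 2 := by positivity
      nlinarith
    linarith

/-- The sum of the generalized eigenspaces for the eigenvalues in a set `s`. -/
noncomputable def spectralSubspace {W : Type} [AddCommGroup W] [Module ℂ W] (T : Module.End ℂ W)
    (s : Set ℂ) : Submodule ℂ W :=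
  ⨆ μ ∈ s, T.maxGenEigenspace μ

section spectral
variable {W : Type} [AddCommGroup W] [Module ℂ W] (T : Module.End ℂ W)

theorem spectralSubspace_mapsTo (s : Set ℂ) :
    ∀ x ∈ spectralSubspace T s, T x ∈ spectralSubspace T s := by
  have : spectralSubspace T s ≤ (spectralSubspace T s).comap T := by
    refine iSup₂_le fun μ hμ x hx => ?_
    exact (le_biSup (f := fun μ => T.maxGenEigenspace μ) hμ)
      (Module.End.mapsTo_maxGenEigenspace_of_comm (Commute.refl T) μ hx)
  exact this

theorem isCompl_spectralSubspace [FiniteDimensional ℂ W] (s : Set ℂ) :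
    IsCompl (spectralSubspace T s) (spectralSubspace T sᶜ) := by
  constructor
  · exact (Module.End.independent_maxGenEigenspace T).disjoint_biSup_biSup disjoint_compl_right
  · rw [codisjoint_iff, spectralSubspace, spectralSubspace, ← iSup_union, union_compl_self, iSup_univ]
    exact Module.End.iSup_maxGenEigenspace_eq_top T

/-- An eigenvector for some `μ ∉ s` would also lie in the complementary spectral subspace, which
meets this one only in `0`. -/
theorem mem_of_hasEigenvalue_restrict [FiniteDimensional ℂ W] (s : Set ℂ) (μ : ℂ)
    (h : Module.End.HasEigenvalue (T.restrict (spectralSubspace_mapsTo T s)) μ) : μ ∈ s := by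
  by_contra hμ
  obtain ⟨v, hv⟩ := h.exists_hasEigenvector
  have h1 : (v : W) ∈ T.maxGenEigenspace μ := by
    apply Module.End.eigenspace_le_maxGenEigenspace
    rw [Module.End.mem_eigenspace_iff]
    simpa using congrArg Subtype.val hv.apply_eq_smul
  have h2 : (v : W) ∈ spectralSubspace T sᶜ :=
    (le_biSup (f := fun μ => T.maxGenEigenspace μ) (show μ ∈ sᶜ from hμ)) h1
  have := (isCompl_spectralSubspace T s).disjoint.le_bot ⟨v.2, h2⟩
  exact hv.2 (by simpa using this)

/-- The characteristic polynomial factors along the splitting. All roots of the first factor lie in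
`s` and none of the second; over `ℂ` the first factor has as many roots as its degree, which is the
dimension. -/
theorem finrank_spectralSubspace [FiniteDimensional ℂ W] (s : Set ℂ) [DecidablePred (· ∈ s)] :
    Module.finrank ℂ (spectralSubspace T s) = (T.charpoly.roots.filter (· ∈ s)).card := by
  set E := spectralSubspace T s
  set E' := spectralSubspace T sᶜ
  set T1 : Module.End ℂ E := T.restrict (spectralSubspace_mapsTo T s)
  set T2 : Module.End ℂ E' := T.restrict (spectralSubspace_mapsTo T sᶜ)
  have hc := isCompl_spectralSubspace T s
  let e := Submodule.prodEquivOfIsCompl E E' hc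
  have hconj : e.conj (T1.prodMap T2) = T := by
    ext x
    obtain ⟨y, rfl⟩ := e.surjective x
    simp [LinearEquiv.conj_apply, e, T1, T2]
  have h1 : T.charpoly = T1.charpoly * T2.charpoly := by
    rw [← hconj, LinearEquiv.charpoly_conj, LinearMap.charpoly_prodMap]
  have hne : T1.charpoly * T2.charpoly ≠ 0 :=
    mul_ne_zero (LinearMap.charpoly_monic _).ne_zero (LinearMap.charpoly_monic _).ne_zero
  rw [h1, Polynomial.roots_mul hne, Multiset.filter_add]
  have h2 : T1.charpoly.roots.filter (· ∈ s) = T1.charpoly.roots := by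
    rw [Multiset.filter_eq_self]
    intro μ hμ
    apply mem_of_hasEigenvalue_restrict T s μ
    rw [Module.End.hasEigenvalue_iff_isRoot_charpoly]
    exact (Polynomial.mem_roots'.1 hμ).2
  have h3 : T2.charpoly.roots.filter (· ∈ s) = 0 := by
    rw [Multiset.filter_eq_nil]
    intro μ hμ
    apply mem_of_hasEigenvalue_restrict T sᶜ μ
    rw [Module.End.hasEigenvalue_iff_isRoot_charpoly]
    exact (Polynomial.mem_roots'.1 hμ).2
  rw [h2, h3, add_zero, ← (IsAlgClosed.splits T1.charpoly).natDegree_eq_card_roots,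
    LinearMap.charpoly_natDegree]

/-- A hyperbolic splitting of `T` along the real part of its eigenvalues: on the attracting block
`T` is uniformly accretive, on the other block `ε - T` is, for a prescribed `ε > 0`. -/
theorem exists_hyperbolic_splitting [FiniteDimensional ℂ W] (d l : ℕ)
    (hd : (T.charpoly.roots.filter (· ∈ {μ : ℂ | 0 < μ.re})).card = d)
    (hl : d + l = Module.finrank ℂ W) :
    ∃ c₀ : ℝ, 0 < c₀ ∧ ∀ ε : ℝ, 0 < ε → ∃ (L : W ≃ₗ[ℂ] Cn d × Cn l) (A₁ : Module.End ℂ (Cn d))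
      (A₂ : Module.End ℂ (Cn l)),
      (∀ x, L (T x) = (A₁ (L x).1, A₂ (L x).2)) ∧
      (∀ x, x ∈ spectralSubspace T {μ : ℂ | 0 < μ.re} ↔ (L x).2 = 0) ∧
      (∀ u, c₀ * ‖u‖ ^ 2 ≤ (inner ℂ u (A₁ u)).re) ∧
      ∃ c₁ : ℝ, 0 < c₁ ∧ ∀ v, c₁ * ‖v‖ ^ 2 ≤ (inner ℂ v ((ε : ℂ) • v - A₂ v)).re := by
  set s : Set ℂ := {μ : ℂ | 0 < μ.re}
  set E := spectralSubspace T s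
  set E' := spectralSubspace T sᶜ
  set T1 : Module.End ℂ E := T.restrict (spectralSubspace_mapsTo T s)
  set T2 : Module.End ℂ E' := T.restrict (spectralSubspace_mapsTo T sᶜ)
  have hc := isCompl_spectralSubspace T s
  let e := Submodule.prodEquivOfIsCompl E E' hc
  have hE : Module.finrank ℂ E = d := by rw [← hd, ← finrank_spectralSubspace]
  have hE' : Module.finrank ℂ E' = l := by
    have := Submodule.finrank_add_eq_of_isCompl hc
    simp only [E, E'] at *
    omega
  obtain ⟨b₁, c₀, hc₀, hb₁⟩ := exists_accretive_coordinates d E hE T1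
    (fun μ hμ => mem_of_hasEigenvalue_restrict T s μ hμ)
  -- The constant `c₀` has to precede `ε`: the exponent `a`, used as `ε`, is later chosen at most
  -- `c₀ / 2`.
  refine ⟨c₀, hc₀, fun ε hε => ?_⟩
  -- On the complementary block the eigenvalues have real part at most `0`, so those of `ε - T2`
  -- have real part at least `ε`.
  obtain ⟨b₂, c₁, hc₁, hb₂⟩ := exists_accretive_coordinates l E' hE' ((ε : ℂ) • 1 - T2) (by
    intro μ hμ
    obtain ⟨v, hv⟩ := hμ.exists_hasEigenvector
    have h1 : T2.HasEigenvalue (ε - μ) := by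
      refine Module.End.hasEigenvalue_of_hasEigenvector (x := v) ⟨?_, hv.2⟩
      rw [Module.End.mem_eigenspace_iff, sub_smul, ← hv.apply_eq_smul]
      simp
    have h2 : ε - μ ∈ sᶜ := mem_of_hasEigenvalue_restrict T sᶜ _ h1
    simp only [s, mem_compl_iff, mem_ofPred_eq, Complex.sub_re, Complex.ofReal_re, not_lt] at h2
    linarith)
  have heT : ∀ y : E × E', e.symm (T (e y)) = (T1 y.1, T2 y.2) := by
    intro y
    rw [LinearEquiv.symm_apply_eq]
    simp [e, T1, T2]
  refine ⟨e.symm.trans (b₁.prodCongr b₂), b₁.conj T1, b₂.conj T2, fun x => ?_, fun x => ?_,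
    fun u => ?_, c₁, hc₁, fun v => ?_⟩
  · obtain ⟨y, rfl⟩ := e.surjective x
    simp [heT, LinearEquiv.conj_apply]
  · obtain ⟨y, rfl⟩ := e.surjective x
    simp only [LinearEquiv.trans_apply, LinearEquiv.symm_apply_apply, LinearEquiv.prodCongr_apply,
      EmbeddingLike.map_eq_zero_iff]
    rw [← Submodule.prodEquivOfIsCompl_symm_apply_snd_eq_zero (h := hc)]
    simp [e]
  · simpa [LinearEquiv.conj_apply] using hb₁ (b₁.symm u)
  · simpa [LinearEquiv.conj_apply, -Complex.coe_smul] using hb₂ (b₂.symm v)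
end spectral

/-! ### Cauchy estimates and uniform limits of holomorphic maps between normed spaces. -/

section holomorphic
variable {E F : Type*} [NormedAddCommGroup E] [NormedSpace ℂ E] [NormedAddCommGroup F]
  [NormedSpace ℂ F]

/-- Cauchy's estimate for the derivative at the centre of a ball. -/
theorem norm_fderiv_le_of_norm_le_ball {f : E → F} {x : E} {r B : ℝ} (hr : 0 < r)
    (hf : DifferentiableOn ℂ f (Metric.ball x r)) (hB : ∀ y ∈ Metric.ball x r, ‖f y‖ ≤ B) :
    ‖fderiv ℂ f x‖ ≤ 2 * B / r := by
  refine Complex.norm_fderiv_le_div_of_mapsTo_ball hf (fun y hy => ?_) hr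
  rw [mem_closedBall_iff_norm]
  have h1 := hB y hy
  have h2 := hB x (Metric.mem_ball_self hr)
  linarith [norm_sub_le (f y) (f x)]

/-- A bounded holomorphic function is Lipschitz on a smaller ball. -/
theorem norm_sub_le_of_norm_le_ball {f : E → F} {r B : ℝ} (hr : 0 < r)
    (hf : DifferentiableOn ℂ f (Metric.ball 0 (2 * r)))
    (hB : ∀ y ∈ Metric.ball (0 : E) (2 * r), ‖f y‖ ≤ B) {x y : E} (hx : ‖x‖ ≤ r) (hy : ‖y‖ ≤ r) :
    ‖f x - f y‖ ≤ 2 * B / r * ‖x - y‖ := by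
  have hsub : ∀ z ∈ Metric.closedBall (0 : E) r, Metric.ball z r ⊆ Metric.ball 0 (2 * r) := by
    intro z hz u hu
    rw [mem_closedBall_zero_iff] at hz
    rw [mem_ball_iff_norm] at hu
    rw [mem_ball_zero_iff]
    have := norm_add_le (u - z) z
    rw [sub_add_cancel] at this
    linarith
  refine Convex.norm_image_sub_le_of_norm_fderiv_le (𝕜 := ℂ) (s := Metric.closedBall 0 r)
    (fun z hz => ?_) (fun z hz => ?_) (convex_closedBall 0 r) (by simpa using hy) (by simpa using hx)
  · exact hf.differentiableAt (Metric.isOpen_ball.mem_nhds (hsub z hz (Metric.mem_ball_self hr)))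
  · exact norm_fderiv_le_of_norm_le_ball hr (hf.mono (hsub z hz)) (fun u hu => hB u (hsub z hz hu))

/-- A uniform limit of holomorphic maps is holomorphic. -/
theorem differentiableOn_of_tendstoUniformlyOn [CompleteSpace F] {Ω : Set E}
    (hΩ : IsOpen Ω) {f : ℕ → E → F} {g : E → F}
    (hf : ∀ n, DifferentiableOn ℂ (f n) Ω) (hfg : TendstoUniformlyOn f g atTop Ω) :
    DifferentiableOn ℂ g Ω := by
  intro x hx
  obtain ⟨R, hR, hRΩ⟩ := Metric.isOpen_iff.1 hΩ x hx
  set r := R / 2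
  have hr : 0 < r := half_pos hR
  have hsub : ∀ z ∈ Metric.ball x r, Metric.ball z r ⊆ Ω := fun z hz =>
    (Metric.ball_subset_ball' (by rw [Metric.mem_ball] at hz; simp only [r] at *; linarith)).trans hRΩ
  have hself : Metric.ball x r ⊆ Ω := hsub x (Metric.mem_ball_self hr)
  have hd : ∀ n, ∀ z ∈ Metric.ball x r, DifferentiableAt ℂ (f n) z := fun n z hz =>
    (hf n).differentiableAt (hΩ.mem_nhds (hself hz))
  -- Every point of the smaller ball is the centre of a ball of the same radius `r` inside `Ω`, so
  -- Cauchy's estimate turns uniform closeness of the maps into uniform closeness of their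
  -- derivatives.
  have hcauchy : UniformCauchySeqOn (fun n => fderiv ℂ (f n)) atTop (Metric.ball x r) := by
    rw [Metric.uniformCauchySeqOn_iff]
    intro ε hε
    obtain ⟨N, hN⟩ := Metric.uniformCauchySeqOn_iff.1 hfg.uniformCauchySeqOn (ε * r / 4) (by positivity)
    refine ⟨N, fun m hm n hn z hz => ?_⟩
    rw [dist_eq_norm, ← fderiv_sub (hd m z hz) (hd n z hz)]
    have h := norm_fderiv_le_of_norm_le_ball (f := f m - f n) (B := ε * r / 4) hr
      (((hf m).sub (hf n)).mono (hsub z hz))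
      (fun y hy => by
        have := hN m hm n hn y (hsub z hz hy)
        rw [dist_eq_norm] at this
        exact this.le)
    refine h.trans_lt ?_
    rw [div_lt_iff₀ hr]
    linarith [mul_pos hε hr]
  have hlim : ∀ z, ∃ L, z ∈ Metric.ball x r → Tendsto (fun n => fderiv ℂ (f n) z) atTop (𝓝 L) := by
    intro z
    by_cases hz : z ∈ Metric.ball x r
    · obtain ⟨L, hL⟩ := cauchySeq_tendsto_of_complete (hcauchy.cauchySeq hz)
      exact ⟨L, fun _ => hL⟩
    · exact ⟨0, fun h => absurd h hz⟩
  choose g' hg' using hlim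
  have := hasFDerivAt_of_tendstoUniformlyOn Metric.isOpen_ball
    (hcauchy.tendstoUniformlyOn_of_tendsto hg') (fun n z hz => (hd n z hz).hasFDerivAt)
    (fun z hz => hfg.tendsto_at (hself hz)) (Metric.mem_ball_self hr)
  exact this.differentiableAt.differentiableWithinAt
end holomorphic

/-! ### The Lyapunov–Perron equations: estimates and uniqueness. -/

section perron
variable {Y V : Type*} [NormedAddCommGroup Y] [NormedSpace ℂ Y] [NormedAddCommGroup V]
  [NormedSpace ℂ V]

/-- The solution of `y (n+1) = B n (y n) + h n` with given initial value. -/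
def forwardSolution (B : ℕ → Y →L[ℂ] Y) (y₀ : Y) (h : ℕ → Y) : ℕ → Y
  | 0 => y₀
  | n + 1 => B n (forwardSolution B y₀ h n) + h n

theorem forwardSolution_sub (B : ℕ → Y →L[ℂ] Y) (y₀ : Y) (h h' : ℕ → Y) (n : ℕ) :
    forwardSolution B y₀ h n - forwardSolution B y₀ h' n
      = forwardSolution B 0 (fun n => h n - h' n) n := by
  induction n with
  | zero => simp [forwardSolution]
  | succ n ih => simp only [forwardSolution, ← ih, map_sub]; abel

/-- The linear steps do not expand, so the forcing terms can only add up. -/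
theorem norm_le_add_sum_of_forward {B : ℕ → Y →L[ℂ] Y} (hB : ∀ n y, ‖B n y‖ ≤ ‖y‖) {y h : ℕ → Y}
    (hy : ∀ n, y (n + 1) = B n (y n) + h n) {μ : ℕ → ℝ} (h0 : ∀ n, 0 ≤ μ n) (hμ : Summable μ)
    (hh : ∀ n, ‖h n‖ ≤ μ n) (n : ℕ) : ‖y n‖ ≤ ‖y 0‖ + ∑' i, μ i := by
  have : ‖y n‖ ≤ ‖y 0‖ + ∑ i ∈ Finset.range n, μ i := by
    induction n with
    | zero => simp
    | succ n ih =>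
      rw [hy, Finset.sum_range_succ]
      linarith [norm_add_le (B n (y n)) (h n), hB n (y n), hh n]
  linarith [hμ.sum_le_tsum (Finset.range n) (fun i _ => h0 i)]

/-- The composition `C n ∘ C (n+1) ∘ ⋯ ∘ C (n+i)`. -/
def compRange (C : ℕ → V →L[ℂ] V) : ℕ → ℕ → V →L[ℂ] V
  | n, 0 => C n
  | n, i + 1 => C n ∘L compRange C (n + 1) i

theorem norm_compRange_le {C : ℕ → V →L[ℂ] V} (hC : ∀ n v, ‖C n v‖ ≤ ‖v‖) (i n : ℕ) (v : V) :
    ‖compRange C n i v‖ ≤ ‖v‖ := by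
  induction i generalizing n with
  | zero => exact hC n v
  | succ i ih => exact (hC n _).trans (ih (n + 1))

/-- The solution of `v n = C n (v (n+1) - k n)` that tends to zero. -/
noncomputable def backwardSolution (C : ℕ → V →L[ℂ] V) (k : ℕ → V) (n : ℕ) : V :=
  -∑' i, compRange C n i (k (i + n))

section
variable {C : ℕ → V →L[ℂ] V} (hC : ∀ n v, ‖C n v‖ ≤ ‖v‖) {k : ℕ → V} {μ : ℕ → ℝ}
  (hμ : Summable μ) (hk : ∀ n, ‖k n‖ ≤ μ n)
include hC hμ hk

theorem summable_compRange [CompleteSpace V] (n : ℕ) : Summable (fun i => compRange C n i (k (i + n))) :=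
  Summable.of_norm_bounded ((summable_nat_add_iff n).2 hμ)
    (fun i => (norm_compRange_le hC i n _).trans (hk _))

/-- Split off the term `i = 0` of the series and pull the common factor `C n` out of the others. -/
theorem backwardSolution_eq [CompleteSpace V] (n : ℕ) :
    backwardSolution C k n = C n (backwardSolution C k (n + 1) - k n) := by
  have h := summable_compRange hC hμ hk
  simp only [backwardSolution]
  rw [(h n).tsum_eq_zero_add, map_sub, map_neg, (C n).map_tsum (h (n + 1))]
  have : ∀ i, compRange C n (i + 1) (k (i + 1 + n)) = C n (compRange C (n + 1) i (k (i + (n + 1)))) := by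
    intro i
    rw [show i + 1 + n = i + (n + 1) by ring]
    rfl
  rw [tsum_congr this, zero_add, compRange]
  abel

theorem norm_backwardSolution_le (n : ℕ) : ‖backwardSolution C k n‖ ≤ ∑' i, μ (i + n) := by
  rw [backwardSolution, norm_neg]
  exact tsum_of_norm_bounded ((summable_nat_add_iff n).2 hμ).hasSum
    (fun i => (norm_compRange_le hC i n _).trans (hk _))

theorem norm_backwardSolution_le_tsum (n : ℕ) : ‖backwardSolution C k n‖ ≤ ∑' i, μ i := by
  refine (norm_backwardSolution_le hC hμ hk n).trans ?_
  have h0 : ∀ i, 0 ≤ μ i := fun i => (norm_nonneg _).trans (hk i)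
  have := hμ.sum_add_tsum_nat_add n
  have h1 : 0 ≤ ∑ i ∈ Finset.range n, μ i := Finset.sum_nonneg (fun i _ => h0 i)
  linarith

theorem backwardSolution_sub [CompleteSpace V] {k' : ℕ → V} (hk' : ∀ n, ‖k' n‖ ≤ μ n) (n : ℕ) :
    backwardSolution C k n - backwardSolution C k' n
      = backwardSolution C (fun n => k n - k' n) n := by
  have h := (summable_compRange hC hμ hk n).tsum_sub (summable_compRange hC hμ hk' n)
  simp only [backwardSolution, map_sub, h]
  abel

end

/-- Express `v n` through `v (m + n)` by `m` uses of the recursion, and let `m` grow. Decay at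
infinity plays the part of the initial value that a backward recursion lacks. -/
theorem norm_le_tsum_of_backward {C : ℕ → V →L[ℂ] V}
    (hC : ∀ n v, ‖C n v‖ ≤ ‖v‖) {v k : ℕ → V}
    (hv : ∀ n, v n = C n (v (n + 1) - k n)) (hv0 : Tendsto v atTop (𝓝 0)) {μ : ℕ → ℝ}
    (hμ : Summable μ) (hk : ∀ n, ‖k n‖ ≤ μ n) (n : ℕ) : ‖v n‖ ≤ ∑' i, μ i := by
  have h0 : ∀ i, 0 ≤ μ i := fun i => (norm_nonneg _).trans (hk i)
  have h : ∀ m, ‖v n‖ ≤ ‖v (m + n)‖ + ∑' i, μ i := by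
    intro m
    have : ‖v n‖ ≤ ‖v (m + n)‖ + ∑ i ∈ Finset.range m, μ (i + n) := by
      induction m with
      | zero => simp
      | succ m ih =>
        have h1 : ‖v (m + n)‖ ≤ ‖v (m + 1 + n)‖ + μ (m + n) := by
          rw [hv (m + n), show m + 1 + n = m + n + 1 by ring]
          exact (hC _ _).trans ((norm_sub_le _ _).trans (by linarith [hk (m + n)]))
        rw [Finset.sum_range_succ]
        linarith
    have h2 := ((summable_nat_add_iff n).2 hμ).sum_le_tsum (Finset.range m) (fun i _ => h0 _)
    have h3 := hμ.sum_add_tsum_nat_add n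
    have h4 : 0 ≤ ∑ i ∈ Finset.range n, μ i := Finset.sum_nonneg (fun i _ => h0 i)
    linarith
  have hlim : Tendsto (fun m => ‖v (m + n)‖ + ∑' i, μ i) atTop (𝓝 (‖(0 : V)‖ + ∑' i, μ i)) :=
    ((hv0.comp (tendsto_add_atTop_nat n)).norm).add_const _
  simpa using ge_of_tendsto' hlim h

/-- An orbit, in the ball of radius `r`, of the system
`y (n+1) = B n (y n) + H n (y n, v n)`, `v n = C n (v (n+1) - K n (y n, v n))`, whose unstable part
tends to zero. -/
structure IsStableOrbit (B : ℕ → Y →L[ℂ] Y) (C : ℕ → V →L[ℂ] V) (H : ℕ → Y × V → Y)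
    (K : ℕ → Y × V → V) (r : ℝ) (y : ℕ → Y) (v : ℕ → V) : Prop where
  norm_le : ∀ n, ‖(y n, v n)‖ ≤ r
  forward : ∀ n, y (n + 1) = B n (y n) + H n (y n, v n)
  backward : ∀ n, v n = C n (v (n + 1) - K n (y n, v n))
  tendsto : Tendsto v atTop (𝓝 0)

/-- A bound `D` on the difference of the two orbits, valid for all times, improves itself to `D /
2`: the forcing terms differ by at most `μ n * D`, with sum at most `D / 2`. The forward estimate
uses the common initial value, the backward one that both unstable parts tend to zero. -/
theorem IsStableOrbit.unique {B : ℕ → Y →L[ℂ] Y} {C : ℕ → V →L[ℂ] V} {H : ℕ → Y × V → Y}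
    {K : ℕ → Y × V → V} {r : ℝ} {y y' : ℕ → Y} {v v' : ℕ → V}
    (h : IsStableOrbit B C H K r y v) (h' : IsStableOrbit B C H K r y' v')
    (hB : ∀ n y, ‖B n y‖ ≤ ‖y‖) (hC : ∀ n v, ‖C n v‖ ≤ ‖v‖) {μ : ℕ → ℝ} (h0 : ∀ n, 0 ≤ μ n)
    (hμ : Summable μ) (hsum : ∑' i, μ i ≤ 1 / 2)
    (hH : ∀ n ξ ξ', ‖ξ‖ ≤ r → ‖ξ'‖ ≤ r → ‖H n ξ - H n ξ'‖ ≤ μ n * ‖ξ - ξ'‖)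
    (hK : ∀ n ξ ξ', ‖ξ‖ ≤ r → ‖ξ'‖ ≤ r → ‖K n ξ - K n ξ'‖ ≤ μ n * ‖ξ - ξ'‖)
    (hy0 : y 0 = y' 0) (n : ℕ) : y n = y' n ∧ v n = v' n := by
  have hr : 0 ≤ r := (norm_nonneg _).trans (h.norm_le 0)
  have key : ∀ j : ℕ, ∀ n, ‖(y n, v n) - (y' n, v' n)‖ ≤ 2 * r * (1 / 2) ^ j := by
    intro j
    induction j with
    | zero =>
      intro n
      refine (norm_sub_le _ _).trans ?_
      linarith [h.norm_le n, h'.norm_le n]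
    | succ j ih =>
      set D := 2 * r * (1 / 2 : ℝ) ^ j
      have hD : 0 ≤ D := by positivity
      have hbound : ∑' i, μ i * D ≤ D / 2 := by
        rw [tsum_mul_right]; nlinarith
      intro n
      have h1 : ‖y n - y' n‖ ≤ D / 2 := by
        have := norm_le_add_sum_of_forward hB (y := fun n => y n - y' n)
          (h := fun n => H n (y n, v n) - H n (y' n, v' n))
          (fun n => by simp only [h.forward n, h'.forward n, map_sub]; abel)
          (fun n => mul_nonneg (h0 n) hD) (hμ.mul_right D)
          (fun n => (hH n _ _ (h.norm_le n) (h'.norm_le n)).trans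
            (mul_le_mul_of_nonneg_left (ih n) (h0 n))) n
        simp only [hy0, sub_self, norm_zero, zero_add] at this
        linarith
      have h2 : ‖v n - v' n‖ ≤ D / 2 := by
        have := norm_le_tsum_of_backward hC (v := fun n => v n - v' n)
          (k := fun n => K n (y n, v n) - K n (y' n, v' n))
          (fun n => by
            have := congrArg₂ (· - ·) (h.backward n) (h'.backward n)
            simp only [← map_sub] at this
            refine this.trans ?_
            congr 1; abel)
          (by simpa using h.tendsto.sub h'.tendsto) (hμ.mul_right D)
          (fun n => (hK n _ _ (h.norm_le n) (h'.norm_le n)).trans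
            (mul_le_mul_of_nonneg_left (ih n) (h0 n))) n
        linarith
      rw [Prod.mk_sub_mk, Prod.norm_mk, pow_succ]
      refine max_le (h1.trans_eq ?_) (h2.trans_eq ?_) <;> simp only [D] <;> ring
  have hlim : Tendsto (fun j : ℕ => 2 * r * (1 / 2 : ℝ) ^ j) atTop (𝓝 (2 * r * 0)) :=
    (tendsto_pow_atTop_nhds_zero_of_lt_one (by norm_num) (by norm_num)).const_mul _
  have hz : ‖(y n, v n) - (y' n, v' n)‖ ≤ 2 * r * 0 := ge_of_tendsto' hlim (fun j => key j n)
  rw [mul_zero, norm_le_zero_iff, sub_eq_zero, Prod.mk.injEq] at hz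
  exact hz

end perron

/-! ### Existence of stable orbits and holomorphic dependence on parameters. -/

section perronExistence
variable {G Y V : Type*} [NormedAddCommGroup G] [NormedSpace ℂ G] [NormedAddCommGroup Y]
  [NormedSpace ℂ Y] [NormedAddCommGroup V] [NormedSpace ℂ V]

/-- The hypothesis on `B` asks only that holomorphic families of vectors be sent to holomorphic
families; this can be checked by components, without the operator norm. -/
theorem differentiableOn_forwardSolution {Ω : Set G} {B : ℕ → G → Y →L[ℂ] Y} {y₀ : G → Y}
    {h : ℕ → G → Y} (hB : ∀ n (y : G → Y), DifferentiableOn ℂ y Ω → DifferentiableOn ℂ (fun q => B n q (y q)) Ω)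
    (hy : DifferentiableOn ℂ y₀ Ω)
    (hh : ∀ n, DifferentiableOn ℂ (h n) Ω) (n : ℕ) :
    DifferentiableOn ℂ (fun q => forwardSolution (fun i => B i q) (y₀ q) (fun i => h i q) n) Ω := by
  induction n with
  | zero => exact hy
  | succ n ih => exact (hB n _ ih).add (hh n)

theorem differentiableOn_compRange {Ω : Set G} {C : ℕ → G → V →L[ℂ] V}
    (hC : ∀ n (v : G → V), DifferentiableOn ℂ v Ω → DifferentiableOn ℂ (fun q => C n q (v q)) Ω) {k : G → V} (hk : DifferentiableOn ℂ k Ω) (i n : ℕ) :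
    DifferentiableOn ℂ (fun q => compRange (fun i => C i q) n i (k q)) Ω := by
  induction i generalizing n with
  | zero => exact hC n _ hk
  | succ i ih => exact hC n _ (ih (n + 1))

/-- The summable majorant makes the series converge uniformly on `Ω`, and a uniform limit of
holomorphic maps is holomorphic. -/
theorem differentiableOn_backwardSolution [CompleteSpace V] {Ω : Set G} (hΩ : IsOpen Ω)
    {C : ℕ → G → V →L[ℂ] V} {k : ℕ → G → V} (hC : ∀ n (v : G → V), DifferentiableOn ℂ v Ω → DifferentiableOn ℂ (fun q => C n q (v q)) Ω)
    (hk : ∀ n, DifferentiableOn ℂ (k n) Ω) (hC1 : ∀ n, ∀ q ∈ Ω, ∀ v, ‖C n q v‖ ≤ ‖v‖) {μ : ℕ → ℝ}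
    (hμ : Summable μ) (hkμ : ∀ n, ∀ q ∈ Ω, ‖k n q‖ ≤ μ n) (n : ℕ) :
    DifferentiableOn ℂ (fun q => backwardSolution (fun i => C i q) (fun i => k i q) n) Ω := by
  have := tendstoUniformlyOn_tsum_nat (f := fun i q => compRange (fun i => C i q) n i (k (i + n) q))
    (s := Ω) ((summable_nat_add_iff n).2 hμ)
    (fun i q hq => (norm_compRange_le (fun n => hC1 n q hq) i n _).trans (hkμ _ q hq))
  exact (differentiableOn_of_tendstoUniformlyOn hΩ (fun N => DifferentiableOn.fun_sum
    (fun i _ => differentiableOn_compRange hC (hk _) i n)) this).neg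

theorem tendsto_of_lipschitz_on_ball {E F : Type*} [NormedAddCommGroup E] [NormedAddCommGroup F]
    {f : E → F} {r c : ℝ} (hf : ∀ ξ ξ', ‖ξ‖ ≤ r → ‖ξ'‖ ≤ r → ‖f ξ - f ξ'‖ ≤ c * ‖ξ - ξ'‖)
    {u : ℕ → E} {a : E} (hu : ∀ j, ‖u j‖ ≤ r) (ha : ‖a‖ ≤ r) (h : Tendsto u atTop (𝓝 a)) :
    Tendsto (fun j => f (u j)) atTop (𝓝 (f a)) := by
  rw [tendsto_iff_norm_sub_tendsto_zero] at h ⊢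
  exact squeeze_zero (fun j => norm_nonneg _) (fun j => hf _ _ (hu j) ha) (by simpa using h.const_mul c)

/-- The Lyapunov–Perron theorem: stable orbits exist for all small initial values of the stable
variable, and depend holomorphically on parameters. -/
theorem exists_isStableOrbit [CompleteSpace Y] [CompleteSpace V] {Ω : Set G} (hΩ : IsOpen Ω)
    {B : ℕ → G → Y →L[ℂ] Y} {C : ℕ → G → V →L[ℂ] V} {H : ℕ → G → Y × V → Y}
    {K : ℕ → G → Y × V → V} {r : ℝ} (hr : 0 ≤ r) {y₀ : G → Y}
    (hBd : ∀ n (y : G → Y), DifferentiableOn ℂ y Ω → DifferentiableOn ℂ (fun q => B n q (y q)) Ω)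
    (hCd : ∀ n (v : G → V), DifferentiableOn ℂ v Ω → DifferentiableOn ℂ (fun q => C n q (v q)) Ω)
    (hyd : DifferentiableOn ℂ y₀ Ω)
    (hHd : ∀ n (ξ : G → Y × V), DifferentiableOn ℂ ξ Ω → (∀ q ∈ Ω, ‖ξ q‖ ≤ r) →
      DifferentiableOn ℂ (fun q => H n q (ξ q)) Ω)
    (hKd : ∀ n (ξ : G → Y × V), DifferentiableOn ℂ ξ Ω → (∀ q ∈ Ω, ‖ξ q‖ ≤ r) →
      DifferentiableOn ℂ (fun q => K n q (ξ q)) Ω)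
    (hB : ∀ n, ∀ q ∈ Ω, ∀ y, ‖B n q y‖ ≤ ‖y‖) (hC : ∀ n, ∀ q ∈ Ω, ∀ v, ‖C n q v‖ ≤ ‖v‖)
    {μ : ℕ → ℝ} (h0 : ∀ n, 0 ≤ μ n) (hμ : Summable μ) (hsum : ∑' i, μ i ≤ 1 / 2)
    (hsum' : ∑' i, μ i ≤ r / 2) (hy : ∀ q ∈ Ω, ‖y₀ q‖ ≤ r / 2)
    (hH : ∀ n, ∀ q ∈ Ω, ∀ ξ, ‖ξ‖ ≤ r → ‖H n q ξ‖ ≤ μ n)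
    (hK : ∀ n, ∀ q ∈ Ω, ∀ ξ, ‖ξ‖ ≤ r → ‖K n q ξ‖ ≤ μ n)
    (hH1 : ∀ n, ∀ q ∈ Ω, ∀ ξ ξ', ‖ξ‖ ≤ r → ‖ξ'‖ ≤ r → ‖H n q ξ - H n q ξ'‖ ≤ μ n * ‖ξ - ξ'‖)
    (hK1 : ∀ n, ∀ q ∈ Ω, ∀ ξ ξ', ‖ξ‖ ≤ r → ‖ξ'‖ ≤ r → ‖K n q ξ - K n q ξ'‖ ≤ μ n * ‖ξ - ξ'‖) :
    ∃ (y : ℕ → G → Y) (v : ℕ → G → V), (∀ n, DifferentiableOn ℂ (v n) Ω) ∧ ∀ q ∈ Ω,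
      y 0 q = y₀ q ∧ IsStableOrbit (fun n => B n q) (fun n => C n q) (fun n => H n q)
        (fun n => K n q) r (fun n => y n q) (fun n => v n q) := by
  -- Picard iteration on whole orbits: insert the current orbit into the nonlinear terms, then solve
  -- the stable part forward and the unstable part backward. It starts from the zero orbit.
  let step : (ℕ → G → Y × V) → ℕ → G → Y × V := fun ξ n q =>
    (forwardSolution (fun i => B i q) (y₀ q) (fun i => H i q (ξ i q)) n,
      backwardSolution (fun i => C i q) (fun i => K i q (ξ i q)) n)
  let ξ : ℕ → ℕ → G → Y × V := fun j => step^[j] (fun _ _ => 0)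
  have hξ : ∀ j, ξ (j + 1) = step (ξ j) := fun j => Function.iterate_succ_apply' step j _
  -- The ball of radius `r` is preserved because the initial value and the sum of the nonlinear
  -- terms contribute at most `r / 2` each.
  have hinv : ∀ j, ∀ n, DifferentiableOn ℂ (ξ j n) Ω ∧ ∀ q ∈ Ω, ‖ξ j n q‖ ≤ r := by
    intro j
    induction j with
    | zero => exact fun n => ⟨differentiableOn_const _, fun q _ => by simpa [ξ] using hr⟩
    | succ j ih =>
      intro n
      rw [hξ]
      refine ⟨DifferentiableOn.prodMk
        (differentiableOn_forwardSolution hBd hyd (fun i => hHd i _ (ih i).1 (ih i).2) n)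
        (differentiableOn_backwardSolution hΩ hCd (fun i => hKd i _ (ih i).1 (ih i).2) hC hμ
          (fun i q hq => hK i q hq _ ((ih i).2 q hq)) n), fun q hq => ?_⟩
      refine max_le ?_ ?_
      · have := norm_le_add_sum_of_forward (fun n => hB n q hq)
          (y := forwardSolution (fun i => B i q) (y₀ q) (fun i => H i q (ξ j i q))) (fun _ => rfl)
          h0 hμ (fun i => hH i q hq _ ((ih i).2 q hq)) n
        refine this.trans ?_
        have := hy q hq
        simp only [forwardSolution]
        linarith
      · have := norm_backwardSolution_le_tsum (fun n => hC n q hq) hμ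
          (fun i => hK i q hq _ ((ih i).2 q hq)) n
        refine this.trans ?_
        linarith
  have hstep : ∀ j, ∀ n, ∀ q ∈ Ω, dist (ξ j n q) (ξ (j + 1) n q) ≤ r * (1 / 2) ^ j := by
    intro j
    induction j with
    | zero =>
      intro n q hq
      simpa [ξ, dist_eq_norm] using (hinv 1 n).2 q hq
    | succ j ih =>
      intro n q hq
      set D := r * (1 / 2 : ℝ) ^ j
      have hD : 0 ≤ D := by positivity
      have hbound : ∑' i, μ i * D ≤ D / 2 := by
        rw [tsum_mul_right]; nlinarith
      have ih' : ∀ i, ‖ξ j i q - ξ (j + 1) i q‖ ≤ D := fun i => by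
        rw [← dist_eq_norm]; exact ih i q hq
      have hD2 : r * (1 / 2 : ℝ) ^ (j + 1) = D / 2 := by simp only [D]; ring
      rw [dist_eq_norm, hD2, hξ (j + 1)]
      nth_rewrite 1 [hξ j]
      refine max_le ?_ ?_
      · simp only [step, Prod.fst_sub, forwardSolution_sub]
        have := norm_le_add_sum_of_forward (fun n => hB n q hq)
          (y := forwardSolution (fun i => B i q) 0
            (fun i => H i q (ξ j i q) - H i q (ξ (j + 1) i q))) (fun _ => rfl)
          (fun n => mul_nonneg (h0 n) hD) (hμ.mul_right D)
          (fun i => (hH1 i q hq _ _ ((hinv j i).2 q hq) ((hinv (j + 1) i).2 q hq)).trans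
            (mul_le_mul_of_nonneg_left (ih' i) (h0 i))) n
        refine this.trans ?_
        simp only [forwardSolution, norm_zero, zero_add]
        exact hbound
      · simp only [step, Prod.snd_sub]
        rw [backwardSolution_sub (fun n => hC n q hq) hμ
          (fun i => hK i q hq _ ((hinv j i).2 q hq))
          (fun i => hK i q hq _ ((hinv (j + 1) i).2 q hq))]
        refine (norm_backwardSolution_le_tsum (fun n => hC n q hq) (hμ.mul_right D)
          (fun i => (hK1 i q hq _ _ ((hinv j i).2 q hq) ((hinv (j + 1) i).2 q hq)).trans
            (mul_le_mul_of_nonneg_left (ih' i) (h0 i))) n).trans hbound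
  -- The value `0` off `Ω` only serves to make the limit a total function.
  have hlim : ∀ n q, ∃ L, q ∈ Ω → Tendsto (fun j => ξ j n q) atTop (𝓝 L) := by
    intro n q
    by_cases hq : q ∈ Ω
    · obtain ⟨L, hL⟩ := cauchySeq_tendsto_of_complete
        (cauchySeq_of_le_geometric (1 / 2) r (by norm_num) (fun j => hstep j n q hq))
      exact ⟨L, fun _ => hL⟩
    · exact ⟨0, fun h => absurd h hq⟩
  choose L hL using hlim
  have hunif : ∀ n, TendstoUniformlyOn (fun j => ξ j n) (L n) atTop Ω := by
    intro n
    rw [Metric.tendstoUniformlyOn_iff]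
    intro ε hε
    have hlim : Tendsto (fun j : ℕ => r * (1 / 2 : ℝ) ^ j / (1 - 1 / 2)) atTop (𝓝 (r * 0 / (1 - 1 / 2))) :=
      ((tendsto_pow_atTop_nhds_zero_of_lt_one (by norm_num) (by norm_num)).const_mul _).div_const _
    rw [mul_zero, zero_div] at hlim
    filter_upwards [hlim.eventually (gt_mem_nhds hε)] with j hj q hq
    rw [dist_comm]
    exact (dist_le_of_le_geometric_of_tendsto (1 / 2) r (by norm_num) (fun j => hstep j n q hq)
      (hL n q hq) j).trans_lt hj
  have hLr : ∀ n, ∀ q ∈ Ω, ‖L n q‖ ≤ r := fun n q hq =>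
    le_of_tendsto' (hL n q hq).norm (fun j => (hinv j n).2 q hq)
  refine ⟨fun n q => (L n q).1, fun n q => (L n q).2, fun n => ?_, fun q hq => ⟨?_, ?_⟩⟩
  · exact (differentiableOn_of_tendstoUniformlyOn hΩ (fun j => (hinv j n).1) (hunif n)).snd
  · have h1 := ((continuous_fst.tendsto _).comp (hL 0 q hq)).comp (tendsto_add_atTop_nat 1)
    refine tendsto_nhds_unique h1 (tendsto_const_nhds.congr fun j => ?_)
    simp only [Function.comp, hξ]
    rfl
  · have hL1 : ∀ n, Tendsto (fun j => ξ (j + 1) n q) atTop (𝓝 (L n q)) := fun n =>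
      (hL n q hq).comp (tendsto_add_atTop_nat 1)
    refine ⟨fun n => hLr n q hq, fun n => ?_, fun n => ?_, ?_⟩
    · refine tendsto_nhds_unique ((continuous_fst.tendsto _).comp (hL1 (n + 1))) ?_
      refine Tendsto.congr (fun j => ?_)
        ((((B n q).continuous.tendsto _).comp ((continuous_fst.tendsto _).comp (hL1 n))).add
          (tendsto_of_lipschitz_on_ball (hH1 n q hq) (fun j => (hinv j n).2 q hq) (hLr n q hq)
            (hL n q hq)))
      simp only [Function.comp, hξ]
      rfl
    · refine tendsto_nhds_unique ((continuous_snd.tendsto _).comp (hL1 n)) ?_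
      refine Tendsto.congr (fun j => ?_)
        (((C n q).continuous.tendsto _).comp
          (((continuous_snd.tendsto _).comp (hL1 (n + 1))).sub (tendsto_of_lipschitz_on_ball (hK1 n q hq)
            (fun j => (hinv j n).2 q hq) (hLr n q hq) (hL n q hq))))
      simp only [Function.comp, hξ]
      exact (backwardSolution_eq (fun n => hC n q hq) hμ
        (fun i => hK i q hq _ ((hinv j i).2 q hq)) n).symm
    -- The unstable part at time `n` is bounded by the tail of the majorant from `n` on, uniformly
    -- over the iterates.
    · refine squeeze_zero_norm (fun n => ?_) (tendsto_sum_nat_add μ)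
      refine le_of_tendsto' ((continuous_snd.tendsto _).comp (hL1 n)).norm (fun j => ?_)
      simp only [Function.comp, hξ]
      exact (norm_backwardSolution_le (fun n => hC n q hq) hμ
        (fun i => hK i q hq _ ((hinv j i).2 q hq)) n)

end perronExistence

/-! ### Geometry of wedges at infinity. -/

/-- The part of the sector `|Im w| < γ Re w` outside the disc of radius `R`. -/
def wedge (γ R : ℝ) : Set ℂ := {w | |w.im| < γ * w.re ∧ R < ‖w‖}

theorem isOpen_wedge (γ R : ℝ) : IsOpen (wedge γ R) :=
  (isOpen_lt (continuous_abs.comp Complex.continuous_im)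
    (continuous_const.mul Complex.continuous_re)).inter (isOpen_lt continuous_const continuous_norm)

theorem wedge_mono {γ γ' R R' : ℝ} (hγ0 : 0 < γ) (hγ : γ ≤ γ') (hR : R' ≤ R) :
    wedge γ R ⊆ wedge γ' R' := by
  rintro w ⟨h1, h2⟩
  have hre : 0 < w.re := by
    have := (abs_nonneg w.im).trans_lt h1
    exact pos_of_mul_pos_right this hγ0.le
  exact ⟨h1.trans_le (mul_le_mul_of_nonneg_right hγ hre.le), hR.trans_lt h2⟩

section wedge
variable {γ R : ℝ} {w : ℂ} (hw : w ∈ wedge γ R) (hγ0 : 0 < γ)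
include hw hγ0

theorem re_pos_of_mem_wedge : 0 < w.re :=
  pos_of_mul_pos_right ((abs_nonneg w.im).trans_lt hw.1) hγ0.le

theorem ne_zero_of_mem_wedge : w ≠ 0 := by
  rintro rfl
  simpa using re_pos_of_mem_wedge hw hγ0

theorem mem_slitPlane_of_mem_wedge : w ∈ Complex.slitPlane :=
  Or.inl (re_pos_of_mem_wedge hw hγ0)

variable (hγ : γ ≤ 1)
include hγ

theorem norm_le_two_mul_re_of_mem_wedge : ‖w‖ ≤ 2 * w.re := by
  have h0 := re_pos_of_mem_wedge hw hγ0
  have h := Complex.norm_le_abs_re_add_abs_im w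
  rw [abs_of_pos h0] at h
  have := hw.1
  nlinarith

/-- In a wedge of aperture at most one, `|w| ≤ 2 Re w`; hence `|w + 1|² ≥ |w|² + |w| + 1`, which
exceeds `(|w| + 1/2)²`. The perturbation takes back at most `1/4`. -/
theorem norm_add_lt_norm_add_one_add {f : ℂ} (hf : ‖f‖ ≤ 1 / 4) : ‖w‖ + 1 / 4 < ‖w + 1 + f‖ := by
  have h0 := re_pos_of_mem_wedge hw hγ0
  have h1 := norm_le_two_mul_re_of_mem_wedge hw hγ0 hγ
  have h2 : ‖w‖ + 1 / 2 < ‖w + 1‖ := by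
    refine lt_of_pow_lt_pow_left₀ 2 (norm_nonneg _) ?_
    have e1 : ‖w + 1‖ ^ 2 = ‖w‖ ^ 2 + 2 * w.re + 1 := by
      rw [Complex.sq_norm, Complex.sq_norm, Complex.normSq_apply, Complex.normSq_apply]
      simp; ring
    nlinarith
  have h3 := norm_sub_le (w + 1 + f) f
  rw [add_sub_cancel_right] at h3
  linarith

/-- The unit translation creates room `γ` in the inequality `|Im| < γ Re`; the perturbation uses at
most `γ/4 + γ²/4` of it. -/
theorem add_one_add_mem_wedge {f : ℂ} (hf : ‖f‖ ≤ γ / 4) : w + 1 + f ∈ wedge γ R := by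
  have h4 := norm_add_lt_norm_add_one_add hw hγ0 hγ (f := f) (by linarith)
  refine ⟨?_, by linarith [hw.2]⟩
  have h1 := (Complex.abs_re_le_norm f).trans hf
  have h2 := (Complex.abs_im_le_norm f).trans hf
  have h3 := hw.1
  have h5 := abs_add_le w.im f.im
  have h6 := (abs_le.1 h1).1
  simp only [Complex.add_im, Complex.one_im, add_zero, Complex.add_re, Complex.one_re]
  nlinarith

theorem add_natCast_mem_wedge (n : ℕ) : w + n ∈ wedge γ R := by
  induction n with
  | zero => simpa using hw
  | succ n ih =>
    have := add_one_add_mem_wedge ih hγ0 hγ (f := 0) (by rw [norm_zero]; positivity)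
    simpa [add_assoc] using this

/-- This linear lower bound in `n`, uniform in `w`, lets negative powers of `‖w + n‖` be summed and
drives orbits to infinity. -/
theorem norm_add_le_two_mul_norm_add_natCast (n : ℕ) : ‖w‖ + n ≤ 2 * ‖w + n‖ := by
  have h1 := norm_le_two_mul_re_of_mem_wedge hw hγ0 hγ
  have h2 := (le_abs_self _).trans (Complex.abs_re_le_norm (w + n))
  simp only [Complex.add_re, Complex.natCast_re] at h2
  have : (0 : ℝ) ≤ n := Nat.cast_nonneg n
  linarith

/-- A displacement proportional to `|w|` is paid for by doubling the aperture and halving the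
radius. This serves both for points near the model orbit and for Cauchy discs of radius proportional
to `|w|`. -/
theorem mem_wedge_of_norm_sub_le {z : ℂ} (hz : ‖z - w‖ ≤ γ / 8 * ‖w‖) :
    z ∈ wedge (2 * γ) (R / 2) := by
  have h0 := re_pos_of_mem_wedge hw hγ0
  have h1 := norm_le_two_mul_re_of_mem_wedge hw hγ0 hγ
  have h2 := (Complex.abs_re_le_norm (z - w)).trans hz
  have h3 := (Complex.abs_im_le_norm (z - w)).trans hz
  have h4 := hw.1
  have h5 := hw.2
  simp only [Complex.sub_re, Complex.sub_im] at h2 h3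
  have h6 := (abs_le.1 h2).1
  have h7 := abs_sub_abs_le_abs_sub z.im w.im
  have h8 := norm_sub_norm_le w z
  rw [norm_sub_rev] at h8
  constructor
  · have : γ / 8 * ‖w‖ ≤ γ / 4 * w.re := by nlinarith
    have h9 : 3 / 4 * w.re ≤ z.re := by nlinarith
    nlinarith
  · have := norm_nonneg w
    nlinarith

end wedge

/-! ### The linear steps `1 - ω⁻¹ T` and `1 + ω⁻¹ T` for accretive `T`. -/

section accretive
variable {U : Type*} [NormedAddCommGroup U] [InnerProductSpace ℂ U] {T : U →L[ℂ] U} {c γ R : ℝ}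
  {ω : ℂ}

/-- With `z = ⟨u, T u⟩`, the real part of `z / ω` is `(Re ω Re z + Im ω Im z) / |ω|²`. Accretivity
controls `Re z` alone, so the wedge must be narrow compared with `c / ‖T‖` for the second product to
use up only half of the first. -/
theorem le_re_inner_inv_smul (hc : 0 < c) (hT : ∀ u, c * ‖u‖ ^ 2 ≤ (inner ℂ u (T u)).re)
    (hω : ω ∈ wedge γ R) (hγ0 : 0 < γ) (hγ : γ ≤ 1) (hγT : γ * ‖T‖ ≤ c / 2) (u : U) :
    c / (4 * ‖ω‖) * ‖u‖ ^ 2 ≤ (inner ℂ u (ω⁻¹ • T u)).re := by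
  have h0 := re_pos_of_mem_wedge hω hγ0
  have h1 := norm_le_two_mul_re_of_mem_wedge hω hγ0 hγ
  have hpos : 0 < ‖ω‖ := norm_pos_iff.2 (ne_zero_of_mem_wedge hω hγ0)
  set z := inner ℂ u (T u)
  have hz : |z.im| ≤ ‖T‖ * ‖u‖ ^ 2 := by
    refine (Complex.abs_im_le_norm z).trans ((norm_inner_le_norm _ _).trans ?_)
    nlinarith [T.le_opNorm u, norm_nonneg u]
  have e : (inner ℂ u (ω⁻¹ • T u)).re = (ω.re * z.re + ω.im * z.im) / ‖ω‖ ^ 2 := by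
    rw [inner_smul_right, Complex.mul_re, Complex.inv_re, Complex.inv_im, Complex.sq_norm]
    simp only [z]
    ring
  have h2 : -(γ * ω.re * (‖T‖ * ‖u‖ ^ 2)) ≤ ω.im * z.im := by
    refine neg_le_of_abs_le ?_
    rw [abs_mul]
    exact mul_le_mul hω.1.le hz (abs_nonneg _) (by positivity)
  have h3 := hT u
  rw [e, div_mul_eq_mul_div, div_le_div_iff₀ (by positivity) (by positivity)]
  have hu : 0 ≤ ‖u‖ ^ 2 := by positivity
  have h4 : ω.re * (c / 2) * ‖u‖ ^ 2 ≤ ω.re * z.re + ω.im * z.im := by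
    have := mul_le_mul_of_nonneg_left h3 h0.le
    have := mul_le_mul_of_nonneg_right hγT (mul_nonneg h0.le hu)
    nlinarith
  have h5 : ‖ω‖ * (c / 4) * ‖u‖ ^ 2 ≤ ω.re * z.re + ω.im * z.im := by
    refine le_trans ?_ h4
    refine mul_le_mul_of_nonneg_right ?_ hu
    nlinarith
  nlinarith [mul_le_mul_of_nonneg_left h5 hpos.le]

/-- Let `δ = c / (8 |ω|)` and expand the square. The cross term contributes `-4δ`, and `‖T‖²/|ω|²`
is at most `2δ` because `|ω| ≥ 4‖T‖²/c`; finally `1 - 2δ ≤ (1 - δ)²`. The extra `c` in the bound for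
`R` ensures `δ ≤ 1`. -/
theorem norm_sub_inv_smul_le (hc : 0 < c) (hT : ∀ u, c * ‖u‖ ^ 2 ≤ (inner ℂ u (T u)).re)
    (hω : ω ∈ wedge γ R) (hγ0 : 0 < γ) (hγ : γ ≤ 1) (hγT : γ * ‖T‖ ≤ c / 2)
    (hR : 4 * ‖T‖ ^ 2 / c + c ≤ R) (u : U) :
    ‖u - ω⁻¹ • T u‖ ≤ (1 - c / 8 / ‖ω‖) * ‖u‖ := by
  have hpos : 0 < ‖ω‖ := norm_pos_iff.2 (ne_zero_of_mem_wedge hω hγ0)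
  have h1 := le_re_inner_inv_smul hc hT hω hγ0 hγ hγT u
  have hRω : 4 * ‖T‖ ^ 2 / c + c ≤ ‖ω‖ := hR.trans hω.2.le
  have h0 : 0 ≤ 4 * ‖T‖ ^ 2 / c := by positivity
  have hc8 : c / 8 / ‖ω‖ ≤ 1 := by
    rw [div_le_one hpos]; linarith
  refine le_of_sq_le_sq ?_ (mul_nonneg (by linarith) (norm_nonneg _))
  have e := norm_sub_sq (𝕜 := ℂ) u (ω⁻¹ • T u)
  rw [RCLike.re_eq_complex_re] at e
  rw [e]
  have h2 : ‖ω⁻¹ • T u‖ ^ 2 ≤ c / (4 * ‖ω‖) * ‖u‖ ^ 2 := by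
    rw [norm_smul, norm_inv, mul_pow]
    have h3 : ‖T u‖ ^ 2 ≤ ‖T‖ ^ 2 * ‖u‖ ^ 2 := by
      rw [← mul_pow]; exact pow_le_pow_left₀ (norm_nonneg _) (T.le_opNorm u) 2
    have h4 : ‖ω‖⁻¹ ^ 2 * ‖T‖ ^ 2 ≤ c / (4 * ‖ω‖) := by
      have : 4 * ‖T‖ ^ 2 ≤ c * ‖ω‖ := by
        have : 4 * ‖T‖ ^ 2 / c ≤ ‖ω‖ := by linarith
        rw [div_le_iff₀ hc] at this
        linarith
      rw [inv_pow, inv_mul_eq_div, div_le_div_iff₀ (by positivity) (by positivity)]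
      nlinarith
    calc ‖ω‖⁻¹ ^ 2 * ‖T u‖ ^ 2 ≤ ‖ω‖⁻¹ ^ 2 * (‖T‖ ^ 2 * ‖u‖ ^ 2) := by gcongr
      _ = ‖ω‖⁻¹ ^ 2 * ‖T‖ ^ 2 * ‖u‖ ^ 2 := by ring
      _ ≤ _ := by gcongr
  have h5 : c / (4 * ‖ω‖) = 2 * (c / 8 / ‖ω‖) := by field_simp; ring
  rw [h5] at h1 h2
  have : 0 ≤ (c / 8 / ‖ω‖) ^ 2 * ‖u‖ ^ 2 := by positivity
  nlinarith

theorem norm_le_norm_add_inv_smul (hc : 0 < c) (hT : ∀ u, c * ‖u‖ ^ 2 ≤ (inner ℂ u (T u)).re)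
    (hω : ω ∈ wedge γ R) (hγ0 : 0 < γ) (hγ : γ ≤ 1) (hγT : γ * ‖T‖ ≤ c / 2) (u : U) :
    ‖u‖ ≤ ‖u + ω⁻¹ • T u‖ := by
  have h1 := le_re_inner_inv_smul hc hT hω hγ0 hγ hγT u
  have h2 : 0 ≤ c / (4 * ‖ω‖) * ‖u‖ ^ 2 := by positivity
  refine le_of_sq_le_sq ?_ (norm_nonneg _)
  have e := norm_add_sq (𝕜 := ℂ) u (ω⁻¹ • T u)
  rw [RCLike.re_eq_complex_re] at e
  rw [e]
  nlinarith [sq_nonneg ‖ω⁻¹ • T u‖]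

end accretive

theorem norm_cpow_ofReal {w : ℂ} (hw : w ≠ 0) (b : ℝ) : ‖w ^ (b : ℂ)‖ = ‖w‖ ^ b := by
  rw [Complex.norm_cpow_of_ne_zero hw]
  simp

/-- A uniform bound, summable in `n`, for powers of `‖w + n‖`. -/
theorem rpow_norm_add_natCast_le {γ R : ℝ} {w : ℂ} (hw : w ∈ wedge γ R) (hγ0 : 0 < γ) (hγ : γ ≤ 1)
    (hR : 1 ≤ R) {b : ℝ} (hb : 0 < b) (hb1 : b ≤ 1 / 2) (n : ℕ) :
    ‖w + n‖ ^ (-(1 + 2 * b)) ≤ 4 * ‖w‖ ^ (-b) * ((n : ℝ) + 1) ^ (-(1 + b)) := by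
  have h1 := norm_add_le_two_mul_norm_add_natCast hw hγ0 hγ n
  have hn : (0 : ℝ) ≤ n := Nat.cast_nonneg n
  have hw1 : 1 < ‖w‖ := hR.trans_lt hw.2
  -- The exponent `1 + 2b` is divided as `b + (1 + b)`: the first part keeps decay in `w`, the
  -- second is summable in `n`. The factor `4` bounds `2^(1+2b)`.
  calc ‖w + n‖ ^ (-(1 + 2 * b)) ≤ ((‖w‖ + n) / 2) ^ (-(1 + 2 * b)) :=
        Real.rpow_le_rpow_of_nonpos (by linarith) (by linarith) (by linarith)
    _ = (‖w‖ + n) ^ (-(1 + 2 * b)) * 2 ^ (1 + 2 * b) := by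
        rw [Real.div_rpow (by linarith) (by norm_num), Real.rpow_neg (by norm_num : (0 : ℝ) ≤ 2), div_inv_eq_mul]
    _ ≤ (‖w‖ + n) ^ (-(1 + 2 * b)) * 2 ^ (2 : ℝ) := by
        gcongr
        · norm_num
        · linarith
    _ = 4 * ((‖w‖ + n) ^ (-b) * (‖w‖ + n) ^ (-(1 + b))) := by
        rw [← Real.rpow_add (by linarith)]
        norm_num
        ring_nf
    _ ≤ 4 * (‖w‖ ^ (-b) * ((n : ℝ) + 1) ^ (-(1 + b))) := by
        gcongr 4 * (?_ * ?_)
        · exact Real.rpow_le_rpow_of_nonpos (by linarith) (by linarith) (by linarith)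
        · exact Real.rpow_le_rpow_of_nonpos (by linarith) (by linarith) (by linarith)
    _ = _ := by ring

theorem summable_natCast_add_one_rpow {b : ℝ} (hb : 0 < b) :
    Summable (fun n : ℕ => ((n : ℝ) + 1) ^ (-(1 + b))) := by
  have := (summable_nat_add_iff 1).2 (Real.summable_nat_rpow.2 (by linarith : -(1 + b) < -1))
  simpa using this

/-! ### Hyperbolic maps on a wedge in coordinates relative to a model orbit. -/

section hyperbolic
variable {U V : Type*} [NormedAddCommGroup U] [InnerProductSpace ℂ U] [NormedAddCommGroup V]
  [InnerProductSpace ℂ V]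

/-- The map `F` is, on a sector at infinity, a perturbation of the hyperbolic map
`(w, u, v) ↦ (w + 1, u - w⁻¹ P u, v + w⁻¹ Q v)`. -/
structure IsHyperbolicOnWedge (F : ℂ × U × V → ℂ × U × V) (P : U →L[ℂ] U) (Q : V →L[ℂ] V)
    (a γ R C : ℝ) : Prop where
  differentiableOn : DifferentiableOn ℂ F (wedge γ R ×ˢ Metric.ball 0 1)
  base : ∀ q ∈ wedge γ R ×ˢ Metric.ball 0 1, ‖(F q).1 - q.1 - 1‖ ≤ C * ‖q.1‖ ^ (-a)
  stable : ∀ q ∈ wedge γ R ×ˢ Metric.ball 0 1,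
    ‖(F q).2.1 - (q.2.1 - q.1⁻¹ • P q.2.1)‖ ≤ C * ‖q.1‖ ^ (-(1 + a))
  unstable : ∀ q ∈ wedge γ R ×ˢ Metric.ball 0 1,
    ‖(F q).2.2 - (q.2.2 + q.1⁻¹ • Q q.2.2)‖ ≤ C * ‖q.1‖ ^ (-(1 + a))

/-- The point with coordinates `ξ = ((ζ, u), v)` relative to the model point `ω`. -/
noncomputable def relativePoint (β : ℝ) (ω : ℂ) (ξ : (ℂ × U) × V) : ℂ × U × V :=
  (ω + ω ^ (β : ℂ) * ξ.1.1, ξ.1.2, ξ.2)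

/-- The linear part of the dynamics of the variables `(ζ, u)`. -/
noncomputable def stableLinear (P : U →L[ℂ] U) (β : ℝ) (ω : ℂ) : ℂ × U →L[ℂ] ℂ × U :=
  ((ω ^ (β : ℂ) * ((ω + 1) ^ (β : ℂ))⁻¹) • ContinuousLinearMap.id ℂ ℂ).prodMap
    (ContinuousLinearMap.id ℂ U - ω⁻¹ • P)

/-- The inverse of the linear part of the dynamics of the variable `v`. -/
noncomputable def unstableInverse (Q : V →L[ℂ] V) (ω : ℂ) : V →L[ℂ] V :=
  Ring.inverse (1 - ω⁻¹ • (-Q))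

/-- The nonlinear part of the dynamics of the variables `(ζ, u)`. -/
noncomputable def stableRemainder (F : ℂ × U × V → ℂ × U × V) (P : U →L[ℂ] U) (β : ℝ) (ω : ℂ)
    (ξ : (ℂ × U) × V) : ℂ × U :=
  (((ω + 1) ^ (β : ℂ))⁻¹ * ((F (relativePoint β ω ξ)).1 - (relativePoint β ω ξ).1 - 1),
    (F (relativePoint β ω ξ)).2.1 - (ξ.1.2 - ω⁻¹ • P ξ.1.2))

/-- The nonlinear part of the dynamics of the variable `v`. -/
noncomputable def unstableRemainder (F : ℂ × U × V → ℂ × U × V) (Q : V →L[ℂ] V) (β : ℝ) (ω : ℂ)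
    (ξ : (ℂ × U) × V) : V :=
  (F (relativePoint β ω ξ)).2.2 - (ξ.2 + ω⁻¹ • Q ξ.2)

theorem isUnit_one_sub_inv_smul [CompleteSpace V] {Q : V →L[ℂ] V} {ω : ℂ} (hω : ‖Q‖ < ‖ω‖) :
    IsUnit (1 - ω⁻¹ • (-Q)) := by
  apply isUnit_one_sub_of_norm_lt_one
  have : 0 < ‖ω‖ := (norm_nonneg _).trans_lt hω
  rw [norm_smul, norm_neg, norm_inv, inv_mul_lt_iff₀ this, mul_one]
  exact hω

theorem eq_unstableInverse_iff [CompleteSpace V] {Q : V →L[ℂ] V} {ω : ℂ} (hω : ‖Q‖ < ‖ω‖) (v v' : V) :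
    v = unstableInverse Q ω v' ↔ v' = v + ω⁻¹ • Q v := by
  have hu := isUnit_one_sub_inv_smul hω
  have h1 : ∀ x, (1 - ω⁻¹ • (-Q)) (unstableInverse Q ω x) = x := fun x => by
    have := congrArg (fun T : V →L[ℂ] V => T x) (Ring.mul_inverse_cancel _ hu)
    exact this
  have h2 : ∀ x, unstableInverse Q ω ((1 - ω⁻¹ • (-Q)) x) = x := fun x => by
    have := congrArg (fun T : V →L[ℂ] V => T x) (Ring.inverse_mul_cancel _ hu)
    exact this
  have h3 : ∀ x, (1 - ω⁻¹ • (-Q)) x = x + ω⁻¹ • Q x := fun x => by simp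
  constructor
  · rintro rfl
    rw [← h3, h1]
  · rintro rfl
    rw [← h3, h2]

theorem stableLinear_apply (P : U →L[ℂ] U) (β : ℝ) (ω : ℂ) (y : ℂ × U) :
    stableLinear P β ω y =
      (ω ^ (β : ℂ) * ((ω + 1) ^ (β : ℂ))⁻¹ * y.1, y.2 - ω⁻¹ • P y.2) := rfl

/-- An exact rewriting of one step of `F` as one step of the Lyapunov–Perron system: forward for
`(ζ, u)`, and backward for `v` after inverting `1 + ω⁻¹ Q`. -/
theorem step_iff [CompleteSpace V] (F : ℂ × U × V → ℂ × U × V) {P : U →L[ℂ] U} {Q : V →L[ℂ] V}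
    {β : ℝ} {ω : ℂ} (hω : ‖Q‖ < ‖ω‖) (hω1 : ω + 1 ≠ 0) (ξ ξ' : (ℂ × U) × V) :
    F (relativePoint β ω ξ) = relativePoint β (ω + 1) ξ' ↔
      ξ'.1 = stableLinear P β ω ξ.1 + stableRemainder F P β ω ξ ∧
      ξ.2 = unstableInverse Q ω (ξ'.2 - unstableRemainder F Q β ω ξ) := by
  have hne : (ω + 1) ^ (β : ℂ) ≠ 0 := by simp [Complex.cpow_eq_zero_iff, hω1]
  rw [eq_unstableInverse_iff hω]
  obtain ⟨⟨ζ, u⟩, v⟩ := ξ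
  obtain ⟨⟨ζ', u'⟩, v'⟩ := ξ'
  set q := relativePoint β ω ((ζ, u), v) with hq
  have hq1 : q.1 = ω + ω ^ (β : ℂ) * ζ := rfl
  have hr : relativePoint β (ω + 1) ((ζ', u'), v') = (ω + 1 + (ω + 1) ^ (β : ℂ) * ζ', u', v') := rfl
  simp only [stableLinear_apply, stableRemainder, unstableRemainder, hr, Prod.ext_iff, ← hq,
    Prod.fst_add, Prod.snd_add, hq1]
  have e1 : (F q).1 = ω + 1 + (ω + 1) ^ (β : ℂ) * ζ' ↔
      ζ' = ω ^ (β : ℂ) * ((ω + 1) ^ (β : ℂ))⁻¹ * ζ +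
        ((ω + 1) ^ (β : ℂ))⁻¹ * ((F q).1 - (ω + ω ^ (β : ℂ) * ζ) - 1) := by
    have : ω ^ (β : ℂ) * ((ω + 1) ^ (β : ℂ))⁻¹ * ζ +
        ((ω + 1) ^ (β : ℂ))⁻¹ * ((F q).1 - (ω + ω ^ (β : ℂ) * ζ) - 1)
        = ((ω + 1) ^ (β : ℂ))⁻¹ * ((F q).1 - (ω + 1)) := by ring
    rw [this, eq_inv_mul_iff_mul_eq₀ hne]
    constructor
    · intro h; rw [h]; ring
    · intro h; rw [h]; ring
  have e2 : (F q).2.1 = u' ↔ u' = u - ω⁻¹ • P u + ((F q).2.1 - (u - ω⁻¹ • P u)) := by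
    rw [add_sub_cancel]; exact eq_comm
  have e3 : (F q).2.2 = v' ↔ v' - ((F q).2.2 - (v + ω⁻¹ • Q v)) = v + ω⁻¹ • Q v := by
    rw [sub_eq_iff_eq_add, add_sub_cancel]; exact eq_comm
  rw [e1, e2, e3, and_assoc]

section region
variable {F : ℂ × U × V → ℂ × U × V} {P : U →L[ℂ] U} {Q : V →L[ℂ] V} {a γ R C γ₀ R₀ : ℝ}

theorem rpow_neg_le_of_le {x b c : ℝ} (hR : 1 ≤ R₀) (hx : R₀ ≤ x) (hb : 0 < b) (hbc : b ≤ c) :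
    x ^ (-c) ≤ R₀ ^ (-b) :=
  (Real.rpow_le_rpow_of_exponent_le (hR.trans hx) (neg_le_neg hbc)).trans
    (Real.rpow_le_rpow_of_nonpos (by linarith) hx (by linarith))

omit [InnerProductSpace ℂ U] [InnerProductSpace ℂ V] in
-- The displacement `ω^(1-a/2) ζ` is small relative to `ω`: the ratio is at most `R₀^(-a/4) ≤ γ₀ /
-- 8`. So the displaced point stays in the larger wedge and has size comparable to `ω`.
theorem relativePoint_spec (ha : 0 < a) (hγ₀ : 0 < γ₀) (hγ₁ : γ₀ ≤ 1) (hγ : 2 * γ₀ ≤ γ)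
    (hR₀ : 1 ≤ R₀) (hR : R ≤ R₀ / 2) (hs : R₀ ^ (-(a / 4)) ≤ γ₀ / 8) {ω : ℂ}
    (hω : ω ∈ wedge γ₀ R₀) {ξ : (ℂ × U) × V} (hξ : ‖ξ‖ < 1 / 2) :
    relativePoint (1 - a / 2) ω ξ ∈ wedge γ R ×ˢ Metric.ball (0 : U × V) 1 ∧
    ‖(relativePoint (1 - a / 2) ω ξ).1 - ω‖ ≤ ‖ω‖ ^ (1 - a / 2) ∧
    ‖ω‖ ≤ 2 * ‖(relativePoint (1 - a / 2) ω ξ).1‖ := by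
  have hω0 := ne_zero_of_mem_wedge hω hγ₀
  have hpos : 0 < ‖ω‖ := norm_pos_iff.2 hω0
  have hξ11 : ‖ξ.1.1‖ < 1 / 2 := ((norm_fst_le _).trans (norm_fst_le _)).trans_lt hξ
  have hξ12 : ‖ξ.1.2‖ < 1 / 2 := ((norm_snd_le _).trans (norm_fst_le _)).trans_lt hξ
  have hξ2 : ‖ξ.2‖ < 1 / 2 := (norm_snd_le _).trans_lt hξ
  have h1 : ‖(relativePoint (1 - a / 2) ω ξ).1 - ω‖ ≤ ‖ω‖ ^ (1 - a / 2) := by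
    simp only [relativePoint, add_sub_cancel_left]
    rw [norm_mul, norm_cpow_ofReal hω0]
    nlinarith [Real.rpow_nonneg hpos.le (1 - a / 2)]
  have h2 : ‖ω‖ ^ (1 - a / 2) ≤ γ₀ / 8 * ‖ω‖ := by
    rw [sub_eq_add_neg, Real.rpow_add hpos, Real.rpow_one, mul_comm]
    gcongr
    exact (rpow_neg_le_of_le hR₀ hω.2.le (by linarith) (by linarith)).trans hs
  have h3 := mem_wedge_of_norm_sub_le hω hγ₀ hγ₁ (h1.trans h2)
  refine ⟨⟨wedge_mono (by linarith) hγ hR h3, ?_⟩, h1, ?_⟩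
  · rw [mem_ball_zero_iff]
    exact max_lt (by simp only [relativePoint]; linarith) (by simp only [relativePoint]; linarith)
  · have := norm_sub_norm_le ω (relativePoint (1 - a / 2) ω ξ).1
    rw [norm_sub_rev] at this
    nlinarith

theorem rpow_neg_le_four_mul {x y b : ℝ} (hx : 0 < x) (hxy : x ≤ 2 * y) (hb : 0 ≤ b) (hb2 : b ≤ 2) :
    y ^ (-b) ≤ 4 * x ^ (-b) := by
  calc y ^ (-b) ≤ (x / 2) ^ (-b) := Real.rpow_le_rpow_of_nonpos (by linarith) (by linarith) (by linarith)
    _ = x ^ (-b) * 2 ^ b := by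
        rw [Real.div_rpow hx.le (by norm_num), Real.rpow_neg (by norm_num : (0 : ℝ) ≤ 2), div_inv_eq_mul]
    _ ≤ x ^ (-b) * 2 ^ (2 : ℝ) := by
        gcongr
        norm_num
    _ = _ := by norm_num; ring

/-- The linear part of `F` has coefficient `W⁻¹` at the true base point `W`, whereas the model uses
`ω⁻¹`. Their difference is `|W - ω| / (|W| |ω|)`, which a displacement of order `|ω|^(1-a/2)` makes
summable along the model orbit. -/
theorem norm_linear_difference_le {E : Type*} [NormedAddCommGroup E] [NormedSpace ℂ E] (T : E →L[ℂ] E)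
    {ω W : ℂ} (hω : ω ≠ 0) (hW : ‖W - ω‖ ≤ ‖ω‖ ^ (1 - a / 2)) (hωW : ‖ω‖ ≤ 2 * ‖W‖) {x : E}
    (hx : ‖x‖ ≤ 1) :
    ‖W⁻¹ • T x - ω⁻¹ • T x‖ ≤ 2 * ‖T‖ * ‖ω‖ ^ (-(1 + a / 2)) := by
  have hpos : 0 < ‖ω‖ := norm_pos_iff.2 hω
  have hWpos : 0 < ‖W‖ := by linarith
  have hW0 : W ≠ 0 := norm_pos_iff.1 hWpos
  rw [← sub_smul, inv_sub_inv hW0 hω, norm_smul, norm_div, norm_mul, norm_sub_rev]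
  have h1 : ‖T x‖ ≤ ‖T‖ := by
    have := T.le_opNorm x
    nlinarith [norm_nonneg T]
  have h2 : ‖W - ω‖ / (‖W‖ * ‖ω‖) ≤ 2 * ‖ω‖ ^ (-(1 + a / 2)) := by
    rw [div_le_iff₀ (by positivity)]
    calc ‖W - ω‖ ≤ ‖ω‖ ^ (1 - a / 2) := hW
      _ = ‖ω‖ ^ (-(1 + a / 2)) * (‖ω‖ * ‖ω‖) := by
          rw [← pow_two, ← Real.rpow_natCast, ← Real.rpow_add hpos]
          norm_num; ring_nf
      _ ≤ ‖ω‖ ^ (-(1 + a / 2)) * (2 * ‖W‖ * ‖ω‖) := by gcongr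
      _ = _ := by ring
  calc _ ≤ 2 * ‖ω‖ ^ (-(1 + a / 2)) * ‖T‖ := by gcongr
    _ = _ := by ring

/-- This explains the exponent `1 - a/2` of the displacement. Dividing the base error `|ω|^(-a)` by
`|ω + 1|^(1-a/2)` gives the order `-(1 + a/2)`, the same as the cost of replacing `W⁻¹` by `ω⁻¹`;
the errors in `u` and `v` are of the smaller order `-(1 + a)`. -/
theorem norm_remainder_le (hF : IsHyperbolicOnWedge F P Q a γ R C) (hC : 0 ≤ C) (ha : 0 < a)
    (ha1 : a ≤ 1) (hγ₀ : 0 < γ₀) (hγ₁ : γ₀ ≤ 1) (hγ : 2 * γ₀ ≤ γ)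
    (hR₀ : 1 ≤ R₀) (hR : R ≤ R₀ / 2) (hs : R₀ ^ (-(a / 4)) ≤ γ₀ / 8) {ω : ℂ}
    (hω : ω ∈ wedge γ₀ R₀) {ξ : (ℂ × U) × V} (hξ : ‖ξ‖ < 1 / 2) :
    ‖stableRemainder F P (1 - a / 2) ω ξ‖ ≤ (4 * C + 2 * ‖P‖ + 2 * ‖Q‖) * ‖ω‖ ^ (-(1 + a / 2)) ∧
    ‖unstableRemainder F Q (1 - a / 2) ω ξ‖
      ≤ (4 * C + 2 * ‖P‖ + 2 * ‖Q‖) * ‖ω‖ ^ (-(1 + a / 2)) := by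
  obtain ⟨h1, h2, h3⟩ := relativePoint_spec ha hγ₀ hγ₁ hγ hR₀ hR hs hω hξ
  set q := relativePoint (1 - a / 2) ω ξ with hq
  have hω0 := ne_zero_of_mem_wedge hω hγ₀
  have hpos : 0 < ‖ω‖ := norm_pos_iff.2 hω0
  have hone : 1 ≤ ‖ω‖ := hR₀.trans hω.2.le
  have hξ12 : ‖ξ.1.2‖ ≤ 1 := by linarith [((norm_snd_le _).trans (norm_fst_le _)).trans_lt hξ]
  have hξ2 : ‖ξ.2‖ ≤ 1 := by linarith [(norm_snd_le _).trans_lt hξ]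
  have hp : 0 ≤ ‖ω‖ ^ (-(1 + a / 2)) := Real.rpow_nonneg hpos.le _
  have hP := norm_nonneg P
  have hQ := norm_nonneg Q
  have hexp : C * ‖q.1‖ ^ (-(1 + a)) ≤ 4 * C * ‖ω‖ ^ (-(1 + a / 2)) := by
    calc C * ‖q.1‖ ^ (-(1 + a)) ≤ C * (4 * ‖ω‖ ^ (-(1 + a))) := by
          gcongr
          exact rpow_neg_le_four_mul hpos h3 (by linarith) (by linarith)
      _ ≤ C * (4 * ‖ω‖ ^ (-(1 + a / 2))) := by
          gcongr ?_ * (_ * ?_)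
          exact Real.rpow_le_rpow_of_exponent_le hone (by linarith)
      _ = _ := by ring
  constructor
  · refine max_le ?_ ?_
    · simp only [stableRemainder, ← hq]
      have hω1 : ω + 1 ∈ wedge γ₀ R₀ := by simpa using add_natCast_mem_wedge hω hγ₀ hγ₁ 1
      have hω10 := ne_zero_of_mem_wedge hω1 hγ₀
      rw [norm_mul, norm_inv, norm_cpow_ofReal hω10, ← Real.rpow_neg (norm_nonneg _)]
      have hle : ‖ω‖ ≤ ‖ω + 1‖ := by
        have := norm_add_lt_norm_add_one_add hω hγ₀ hγ₁ (f := 0) (by simp)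
        rw [add_zero] at this
        linarith
      calc ‖ω + 1‖ ^ (-(1 - a / 2)) * ‖(F q).1 - q.1 - 1‖
          ≤ ‖ω‖ ^ (-(1 - a / 2)) * (C * (4 * ‖ω‖ ^ (-a))) := by
            refine mul_le_mul ?_ ((hF.base q h1).trans ?_) (norm_nonneg _) (by positivity)
            · exact Real.rpow_le_rpow_of_nonpos hpos hle (by linarith)
            · gcongr
              exact rpow_neg_le_four_mul hpos h3 (by linarith) (by linarith)
        _ = 4 * C * (‖ω‖ ^ (-(1 - a / 2)) * ‖ω‖ ^ (-a)) := by ring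
        _ = 4 * C * ‖ω‖ ^ (-(1 + a / 2)) := by
            rw [← Real.rpow_add hpos]; ring_nf
        _ ≤ _ := by gcongr; linarith
    · have hd := norm_linear_difference_le (a := a) P hω0 h2 h3 hξ12
      have hst := hF.stable q h1
      have e : (stableRemainder F P (1 - a / 2) ω ξ).2 =
          ((F q).2.1 - (q.2.1 - q.1⁻¹ • P q.2.1)) - (q.1⁻¹ • P ξ.1.2 - ω⁻¹ • P ξ.1.2) := by
        simp only [stableRemainder, ← hq]
        have : q.2.1 = ξ.1.2 := rfl
        rw [this]; abel
      rw [e]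
      refine (norm_sub_le _ _).trans ?_
      nlinarith
  · have hd := norm_linear_difference_le (a := a) Q hω0 h2 h3 hξ2
    have hst := hF.unstable q h1
    have e : unstableRemainder F Q (1 - a / 2) ω ξ =
        ((F q).2.2 - (q.2.2 + q.1⁻¹ • Q q.2.2)) + (q.1⁻¹ • Q ξ.2 - ω⁻¹ • Q ξ.2) := by
      simp only [unstableRemainder, ← hq]
      have : q.2.2 = ξ.2 := rfl
      rw [this]; abel
    rw [e]
    refine (norm_add_le _ _).trans ?_
    nlinarith

end region
end hyperbolic

/-! ### Choice of the region and the estimates along model orbits. -/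

section stableManifold
variable {U V : Type*} [NormedAddCommGroup U] [InnerProductSpace ℂ U] [NormedAddCommGroup V]
  [InnerProductSpace ℂ V]

/-- The inequalities that make the Lyapunov–Perron method work on `wedge γ₀ R₀`. -/
structure IsPerronRegion (P : U →L[ℂ] U) (Q : V →L[ℂ] V) (a γ R C c γ₀ R₀ : ℝ) : Prop where
  a_pos : 0 < a
  a_le_one : a ≤ 1
  C_nonneg : 0 ≤ C
  c_pos : 0 < c
  γ₀_pos : 0 < γ₀
  γ₀_le_one : γ₀ ≤ 1
  two_γ₀_le : 2 * γ₀ ≤ γ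
  one_le : 1 ≤ R₀
  R_le : R ≤ R₀ / 2
  rpow_le : R₀ ^ (-(a / 4)) ≤ γ₀ / 8
  γ₀_mul_norm_P : γ₀ * ‖P‖ ≤ c / 2
  γ₀_mul_norm_Q : γ₀ * ‖Q‖ ≤ c / 2
  norm_P_le : 4 * ‖P‖ ^ 2 / c + c ≤ R₀
  norm_Q_le : ‖Q‖ ≤ R₀
  sum_le : 32 * (4 * C + 2 * ‖P‖ + 2 * ‖Q‖) * R₀ ^ (-(a / 4)) *
    ∑' n : ℕ, ((n : ℝ) + 1) ^ (-(1 + a / 4)) ≤ 1 / 32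
  base_le : C * R₀ ^ (-a) ≤ γ₀ / 8
  accretive_P : ∀ u, c * ‖u‖ ^ 2 ≤ (inner ℂ u (P u)).re
  accretive_Q : ∀ v, c * ‖v‖ ^ 2 ≤ (inner ℂ v (Q v)).re

theorem exists_isPerronRegion {P : U →L[ℂ] U} {Q : V →L[ℂ] V} {a γ R C c : ℝ} (ha : 0 < a)
    (ha1 : a ≤ 1) (hγ : 0 < γ) (hC : 0 ≤ C) (hc : 0 < c)
    (hP : ∀ u, c * ‖u‖ ^ 2 ≤ (inner ℂ u (P u)).re)
    (hQ : ∀ v, c * ‖v‖ ^ 2 ≤ (inner ℂ v (Q v)).re) :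
    ∃ γ₀ R₀, IsPerronRegion P Q a γ R C c γ₀ R₀ := by
  -- The aperture comes first, small in terms of `P`, `Q`, `c` and `γ` only. The conditions on `R₀`
  -- depend on it, and all hold for large `R₀`.
  obtain ⟨γ₀, hγ₀, h1⟩ : ∃ γ₀ : ℝ, 0 < γ₀ ∧ γ₀ ≤ 1 ∧ 2 * γ₀ ≤ γ ∧ γ₀ * ‖P‖ ≤ c / 2 ∧ γ₀ * ‖Q‖ ≤ c / 2 := by
    have h : ∀ x y : ℝ, 0 < y → ∀ᶠ t : ℝ in 𝓝[>] 0, t * x ≤ y := by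
      intro x y hy
      have : Tendsto (fun t : ℝ => t * x) (𝓝[>] 0) (𝓝 (0 * x)) :=
        (tendsto_id.mono_left nhdsWithin_le_nhds).mul_const x
      rw [zero_mul] at this
      filter_upwards [this.eventually (gt_mem_nhds hy)] with t ht using ht.le
    obtain ⟨t, h⟩ := ((eventually_mem_nhdsWithin (a := (0 : ℝ)) (s := Ioi 0)).and ((h 1 1 one_pos).and ((h 2 γ hγ).and
      ((h ‖P‖ (c / 2) (by positivity)).and (h ‖Q‖ (c / 2) (by positivity)))))).exists
    refine ⟨t, h.1, by linarith [h.2.1], by linarith [h.2.2.1], h.2.2.2.1, h.2.2.2.2⟩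
  have hlim : ∀ (b x y : ℝ), 0 < b → 0 < y → ∀ᶠ t : ℝ in atTop, x * t ^ (-b) ≤ y := by
    intro b x y hb hy
    have := (tendsto_rpow_neg_atTop hb).const_mul x
    rw [mul_zero] at this
    filter_upwards [this.eventually (gt_mem_nhds hy)] with t ht using ht.le
  set S := ∑' n : ℕ, ((n : ℝ) + 1) ^ (-(1 + a / 4))
  obtain ⟨t, h⟩ := ((eventually_ge_atTop (1 : ℝ)).and ((eventually_ge_atTop (2 * R)).and
    ((hlim (a / 4) 1 (γ₀ / 8) (by positivity) (by positivity)).and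
    ((eventually_ge_atTop (4 * ‖P‖ ^ 2 / c + c)).and ((eventually_ge_atTop ‖Q‖).and
    ((hlim (a / 4) (32 * (4 * C + 2 * ‖P‖ + 2 * ‖Q‖) * S) (1 / 32) (by positivity) (by positivity)).and
    (hlim a C (γ₀ / 8) ha (by positivity)))))))).exists
  obtain ⟨t1, t2, t3, t4, t5, t6, t7⟩ := h
  exact ⟨γ₀, t, ha, ha1, hC, hc, hγ₀, h1.1, h1.2.1, t1, by linarith, by simpa using t3, h1.2.2.1,
    h1.2.2.2, t4, t5, by linarith, t7, hP, hQ⟩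

variable {F : ℂ × U × V → ℂ × U × V} {P : U →L[ℂ] U} {Q : V →L[ℂ] V} {a γ R C c γ₀ R₀ : ℝ}

/-- The factor of `ζ` is `(ω / (ω + 1))^(1-a/2)` in modulus, at most one since the model orbit moves
outward; the factor of `u` contracts by accretivity. -/
theorem norm_stableLinear_le (hr : IsPerronRegion P Q a γ R C c γ₀ R₀) {ω : ℂ}
    (hω : ω ∈ wedge γ₀ R₀) (y : ℂ × U) : ‖stableLinear P (1 - a / 2) ω y‖ ≤ ‖y‖ := by
  have ha := hr.a_le_one
  rw [stableLinear_apply]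
  have hω1 : ω + 1 ∈ wedge γ₀ R₀ := by
    simpa using add_natCast_mem_wedge hω hr.γ₀_pos hr.γ₀_le_one 1
  have hω10 := ne_zero_of_mem_wedge hω1 hr.γ₀_pos
  have hle : ‖ω‖ ≤ ‖ω + 1‖ := by
    have := norm_add_lt_norm_add_one_add hω hr.γ₀_pos hr.γ₀_le_one (f := 0) (by simp)
    rw [add_zero] at this
    linarith
  refine max_le ?_ ?_
  · refine le_trans ?_ (norm_fst_le y)
    rw [norm_mul, norm_mul, norm_inv, norm_cpow_ofReal hω10,
      norm_cpow_ofReal (ne_zero_of_mem_wedge hω hr.γ₀_pos), ← div_eq_mul_inv]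
    refine mul_le_of_le_one_left (norm_nonneg _) ?_
    exact div_le_one_of_le₀ (Real.rpow_le_rpow (norm_nonneg _) hle (by linarith)) (by positivity)
  · refine le_trans ?_ (norm_snd_le y)
    refine (norm_sub_inv_smul_le hr.c_pos hr.accretive_P hω hr.γ₀_pos hr.γ₀_le_one
      hr.γ₀_mul_norm_P hr.norm_P_le y.2).trans ?_
    refine mul_le_of_le_one_left (norm_nonneg _) ?_
    have hc := hr.c_pos
    have : 0 ≤ c / 8 / ‖ω‖ := by positivity
    linarith

/-- The map being inverted is expanding, because `Q` is accretive. -/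
theorem norm_unstableInverse_le [CompleteSpace V] (hr : IsPerronRegion P Q a γ R C c γ₀ R₀) {ω : ℂ}
    (hω : ω ∈ wedge γ₀ R₀) (v : V) : ‖unstableInverse Q ω v‖ ≤ ‖v‖ := by
  have h := (eq_unstableInverse_iff (hr.norm_Q_le.trans_lt hω.2) _ v).1 rfl
  conv_rhs => rw [h]
  exact norm_le_norm_add_inv_smul hr.c_pos hr.accretive_Q hω hr.γ₀_pos hr.γ₀_le_one
      hr.γ₀_mul_norm_Q _

section differentiability
variable {G : Type*} [NormedAddCommGroup G] [NormedSpace ℂ G] {Ω : Set G} {ω : G → ℂ}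
  (hωd : DifferentiableOn ℂ ω Ω)
include hωd

theorem differentiableOn_unstableInverse [CompleteSpace V]
    (hr : IsPerronRegion P Q a γ R C c γ₀ R₀)
    (hω : ∀ q ∈ Ω, ω q ∈ wedge γ₀ R₀) {v : G → V} (hv : DifferentiableOn ℂ v Ω) :
    DifferentiableOn ℂ (fun q => unstableInverse Q (ω q) (v q)) Ω := by
  refine DifferentiableOn.clm_apply (fun q hq => ?_) hv
  have h0 := ne_zero_of_mem_wedge (hω q hq) hr.γ₀_pos
  have hu := isUnit_one_sub_inv_smul (hr.norm_Q_le.trans_lt (hω q hq).2)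
  have h1 : DifferentiableWithinAt ℂ (fun q => 1 - (ω q)⁻¹ • (-Q)) Ω q :=
    (((hωd q hq).inv h0).smul_const (-Q)).const_sub 1
  exact (differentiableAt_inverse (𝕜 := ℂ) hu).comp_differentiableWithinAt q h1

theorem differentiableOn_stableLinear (hr : IsPerronRegion P Q a γ R C c γ₀ R₀)
    (hω : ∀ q ∈ Ω, ω q ∈ wedge γ₀ R₀) {y : G → ℂ × U} (hy : DifferentiableOn ℂ y Ω) (β : ℝ) :
    DifferentiableOn ℂ (fun q => stableLinear P β (ω q) (y q)) Ω := by
  simp only [stableLinear_apply]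
  have hω1 : ∀ q ∈ Ω, ω q + 1 ∈ wedge γ₀ R₀ := fun q hq => by
    simpa using add_natCast_mem_wedge (hω q hq) hr.γ₀_pos hr.γ₀_le_one 1
  have h1 : DifferentiableOn ℂ (fun q => ω q ^ (β : ℂ)) Ω :=
    hωd.cpow (differentiableOn_const _) (fun q hq => mem_slitPlane_of_mem_wedge (hω q hq) hr.γ₀_pos)
  have h2 : DifferentiableOn ℂ (fun q => (ω q + 1) ^ (β : ℂ)) Ω :=
    (hωd.add_const 1).cpow (differentiableOn_const _)
      (fun q hq => mem_slitPlane_of_mem_wedge (hω1 q hq) hr.γ₀_pos)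
  have h2ne : ∀ q ∈ Ω, (ω q + 1) ^ (β : ℂ) ≠ 0 := fun q hq => by
    simp [Complex.cpow_eq_zero_iff, ne_zero_of_mem_wedge (hω1 q hq) hr.γ₀_pos]
  refine ((h1.mul (h2.inv h2ne)).mul hy.fst).prodMk (hy.snd.sub ?_)
  exact (hωd.inv (fun q hq => ne_zero_of_mem_wedge (hω q hq) hr.γ₀_pos)).smul
    (P.differentiable.comp_differentiableOn hy.snd)

theorem differentiableOn_comp_relativePoint (hF : IsHyperbolicOnWedge F P Q a γ R C)
    (hr : IsPerronRegion P Q a γ R C c γ₀ R₀)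
    (hω : ∀ q ∈ Ω, ω q ∈ wedge γ₀ R₀) {ξ : G → (ℂ × U) × V} (hξ : DifferentiableOn ℂ ξ Ω)
    (hξ1 : ∀ q ∈ Ω, ‖ξ q‖ < 1 / 2) :
    DifferentiableOn ℂ (fun q => relativePoint (1 - a / 2) (ω q) (ξ q)) Ω ∧
    DifferentiableOn ℂ (fun q => F (relativePoint (1 - a / 2) (ω q) (ξ q))) Ω := by
  have h1 : DifferentiableOn ℂ (fun q => ω q ^ ((1 - a / 2 : ℝ) : ℂ)) Ω :=
    hωd.cpow (differentiableOn_const _) (fun q hq => mem_slitPlane_of_mem_wedge (hω q hq) hr.γ₀_pos)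
  have h2 : DifferentiableOn ℂ (fun q => relativePoint (1 - a / 2) (ω q) (ξ q)) Ω :=
    (hωd.add (h1.mul hξ.fst.fst)).prodMk (hξ.fst.snd.prodMk hξ.snd)
  exact ⟨h2, hF.differentiableOn.comp h2 (fun q hq => (relativePoint_spec hr.a_pos hr.γ₀_pos
    hr.γ₀_le_one hr.two_γ₀_le hr.one_le hr.R_le hr.rpow_le (hω q hq) (hξ1 q hq)).1)⟩

theorem differentiableOn_remainder (hF : IsHyperbolicOnWedge F P Q a γ R C)
    (hr : IsPerronRegion P Q a γ R C c γ₀ R₀)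
    (hω : ∀ q ∈ Ω, ω q ∈ wedge γ₀ R₀) {ξ : G → (ℂ × U) × V} (hξ : DifferentiableOn ℂ ξ Ω)
    (hξ1 : ∀ q ∈ Ω, ‖ξ q‖ < 1 / 2) :
    DifferentiableOn ℂ (fun q => stableRemainder F P (1 - a / 2) (ω q) (ξ q)) Ω ∧
    DifferentiableOn ℂ (fun q => unstableRemainder F Q (1 - a / 2) (ω q) (ξ q)) Ω := by
  obtain ⟨h1, h2⟩ := differentiableOn_comp_relativePoint hωd hF hr hω hξ hξ1
  have hω1 : ∀ q ∈ Ω, ω q + 1 ∈ wedge γ₀ R₀ := fun q hq => by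
    simpa using add_natCast_mem_wedge (hω q hq) hr.γ₀_pos hr.γ₀_le_one 1
  have h3 : DifferentiableOn ℂ (fun q => (ω q + 1) ^ ((1 - a / 2 : ℝ) : ℂ)) Ω :=
    (hωd.add_const 1).cpow (differentiableOn_const _)
      (fun q hq => mem_slitPlane_of_mem_wedge (hω1 q hq) hr.γ₀_pos)
  have h3ne : ∀ q ∈ Ω, (ω q + 1) ^ ((1 - a / 2 : ℝ) : ℂ) ≠ 0 := fun q hq => by
    rw [Ne, Complex.cpow_eq_zero_iff]
    exact fun h => ne_zero_of_mem_wedge (hω1 q hq) hr.γ₀_pos h.1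
  have hinv := hωd.inv (fun q hq => ne_zero_of_mem_wedge (hω q hq) hr.γ₀_pos)
  refine ⟨((h3.inv h3ne).mul ((h2.fst.sub h1.fst).sub_const 1)).prodMk (h2.snd.fst.sub
    (hξ.fst.snd.sub (hinv.smul (P.differentiable.comp_differentiableOn hξ.fst.snd)))),
    h2.snd.snd.sub (hξ.snd.add (hinv.smul (Q.differentiable.comp_differentiableOn hξ.snd)))⟩

end differentiability

/-- The summable majorant of the nonlinear terms along the model orbit. -/
noncomputable def perronMajorant (P : U →L[ℂ] U) (Q : V →L[ℂ] V) (a C R₀ : ℝ) (n : ℕ) : ℝ :=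
  32 * (4 * C + 2 * ‖P‖ + 2 * ‖Q‖) * R₀ ^ (-(a / 4)) * ((n : ℝ) + 1) ^ (-(1 + a / 4))

theorem IsPerronRegion.majorant_nonneg (hr : IsPerronRegion P Q a γ R C c γ₀ R₀) (n : ℕ) :
    0 ≤ perronMajorant P Q a C R₀ n := by
  have := hr.C_nonneg
  have := hr.one_le
  unfold perronMajorant
  positivity

theorem IsPerronRegion.summable_majorant (hr : IsPerronRegion P Q a γ R C c γ₀ R₀) :
    Summable (perronMajorant P Q a C R₀) :=
  (summable_natCast_add_one_rpow (by linarith [hr.a_pos] : 0 < a / 4)).mul_left _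

theorem IsPerronRegion.tsum_majorant_le (hr : IsPerronRegion P Q a γ R C c γ₀ R₀) :
    ∑' n, perronMajorant P Q a C R₀ n ≤ 1 / 32 := by
  unfold perronMajorant
  rw [tsum_mul_left]
  exact hr.sum_le

/-- This version retains the factor `‖w‖ ^ (-(a / 4))`, the source of the decay of the graph at
infinity; the majorant replaces it by its value at `R₀`. -/
theorem norm_remainder_le_natCast (hF : IsHyperbolicOnWedge F P Q a γ R C)
    (hr : IsPerronRegion P Q a γ R C c γ₀ R₀) {w : ℂ} (hw : w ∈ wedge γ₀ R₀) (n : ℕ)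
    {ξ : (ℂ × U) × V} (hξ : ‖ξ‖ < 1 / 2) :
    ‖stableRemainder F P (1 - a / 2) (w + n) ξ‖ ≤ 4 * (4 * C + 2 * ‖P‖ + 2 * ‖Q‖) * ‖w‖ ^ (-(a / 4)) *
      ((n : ℝ) + 1) ^ (-(1 + a / 4)) ∧
    ‖unstableRemainder F Q (1 - a / 2) (w + n) ξ‖ ≤
      4 * (4 * C + 2 * ‖P‖ + 2 * ‖Q‖) * ‖w‖ ^ (-(a / 4)) * ((n : ℝ) + 1) ^ (-(1 + a / 4)) := by
  have h := norm_remainder_le hF hr.C_nonneg hr.a_pos hr.a_le_one hr.γ₀_pos hr.γ₀_le_one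
    hr.two_γ₀_le hr.one_le hr.R_le hr.rpow_le
    (add_natCast_mem_wedge hw hr.γ₀_pos hr.γ₀_le_one n) hξ
  have h2 := rpow_norm_add_natCast_le hw hr.γ₀_pos hr.γ₀_le_one hr.one_le
    (b := a / 4) (by linarith [hr.a_pos]) (by linarith [hr.a_le_one]) n
  rw [show 1 + 2 * (a / 4) = 1 + a / 2 by ring] at h2
  have hC := hr.C_nonneg
  have h3 := mul_le_mul_of_nonneg_left h2 (by positivity : 0 ≤ 4 * C + 2 * ‖P‖ + 2 * ‖Q‖)
  exact ⟨h.1.trans (by linarith), h.2.trans (by linarith)⟩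

theorem norm_remainder_le_majorant (hF : IsHyperbolicOnWedge F P Q a γ R C)
    (hr : IsPerronRegion P Q a γ R C c γ₀ R₀) {w : ℂ} (hw : w ∈ wedge γ₀ R₀) (n : ℕ)
    {ξ : (ℂ × U) × V} (hξ : ‖ξ‖ < 1 / 2) :
    ‖stableRemainder F P (1 - a / 2) (w + n) ξ‖ ≤ perronMajorant P Q a C R₀ n / 8 ∧
    ‖unstableRemainder F Q (1 - a / 2) (w + n) ξ‖ ≤ perronMajorant P Q a C R₀ n / 8 := by
  have h := norm_remainder_le_natCast hF hr hw n hξ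
  have hC := hr.C_nonneg
  have h2 : ‖w‖ ^ (-(a / 4)) ≤ R₀ ^ (-(a / 4)) :=
    Real.rpow_le_rpow_of_nonpos (by linarith [hr.one_le]) hw.2.le (by linarith [hr.a_pos])
  have h3 : 4 * (4 * C + 2 * ‖P‖ + 2 * ‖Q‖) * ‖w‖ ^ (-(a / 4)) * ((n : ℝ) + 1) ^ (-(1 + a / 4))
      ≤ 4 * (4 * C + 2 * ‖P‖ + 2 * ‖Q‖) * R₀ ^ (-(a / 4)) * ((n : ℝ) + 1) ^ (-(1 + a / 4)) := by
    gcongr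
  have h4 : 4 * (4 * C + 2 * ‖P‖ + 2 * ‖Q‖) * R₀ ^ (-(a / 4)) * ((n : ℝ) + 1) ^ (-(1 + a / 4)) =
      perronMajorant P Q a C R₀ n / 8 := by
    unfold perronMajorant; ring
  exact ⟨h.1.trans (h3.trans_eq h4), h.2.trans (h3.trans_eq h4)⟩

/-- Cauchy's estimate from the ball of radius `1/2` to that of radius `1/4` multiplies the sup bound
by `8`; hence the division by `8` in the bound for the remainder itself. -/
theorem norm_remainder_sub_le (hF : IsHyperbolicOnWedge F P Q a γ R C)
    (hr : IsPerronRegion P Q a γ R C c γ₀ R₀) {w : ℂ} (hw : w ∈ wedge γ₀ R₀) (n : ℕ)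
    {ξ ξ' : (ℂ × U) × V} (hξ : ‖ξ‖ ≤ 1 / 4) (hξ' : ‖ξ'‖ ≤ 1 / 4) :
    ‖stableRemainder F P (1 - a / 2) (w + n) ξ - stableRemainder F P (1 - a / 2) (w + n) ξ'‖ ≤
      perronMajorant P Q a C R₀ n * ‖ξ - ξ'‖ ∧
    ‖unstableRemainder F Q (1 - a / 2) (w + n) ξ - unstableRemainder F Q (1 - a / 2) (w + n) ξ'‖ ≤
      perronMajorant P Q a C R₀ n * ‖ξ - ξ'‖ := by
  have hn := add_natCast_mem_wedge hw hr.γ₀_pos hr.γ₀_le_one n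
  have hlt : ∀ η ∈ Metric.ball (0 : (ℂ × U) × V) (2 * (1 / 4)), ‖η‖ < 1 / 2 := fun η hη => by
    rw [mem_ball_zero_iff] at hη; linarith
  obtain ⟨h1, h2⟩ := differentiableOn_remainder (ω := fun _ : (ℂ × U) × V => w + n)
    (Ω := Metric.ball 0 (2 * (1 / 4))) (differentiableOn_const _) hF hr (fun _ _ => hn)
    (ξ := fun η => η) differentiableOn_id hlt
  have h3 := norm_sub_le_of_norm_le_ball (by norm_num : (0 : ℝ) < 1 / 4) h1
    (fun η hη => (norm_remainder_le_majorant hF hr hw n (hlt η hη)).1) hξ hξ'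
  have h4 := norm_sub_le_of_norm_le_ball (by norm_num : (0 : ℝ) < 1 / 4) h2
    (fun η hη => (norm_remainder_le_majorant hF hr hw n (hlt η hη)).2) hξ hξ'
  have e : 2 * (perronMajorant P Q a C R₀ n / 8) / (1 / 4) = perronMajorant P Q a C R₀ n := by ring
  rw [e] at h3 h4
  exact ⟨h3, h4⟩

end stableManifold

/-! ### The invariant stable graph. -/

section stableManifold
variable {U V : Type*} [NormedAddCommGroup U] [InnerProductSpace ℂ U] [NormedAddCommGroup V]
  [InnerProductSpace ℂ V] {F : ℂ × U × V → ℂ × U × V} {P : U →L[ℂ] U} {Q : V →L[ℂ] V}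
  {a γ R C c γ₀ R₀ : ℝ}

/-- `(y, v)` is a bounded orbit of `F` relative to the model orbit `w + n`. -/
abbrev IsRelativeOrbit (F : ℂ × U × V → ℂ × U × V) (P : U →L[ℂ] U) (Q : V →L[ℂ] V) (a : ℝ) (w : ℂ)
    (y : ℕ → ℂ × U) (v : ℕ → V) : Prop :=
  IsStableOrbit (fun n => stableLinear P (1 - a / 2) (w + n)) (fun n => unstableInverse Q (w + n))
    (fun n => stableRemainder F P (1 - a / 2) (w + n))
    (fun n => unstableRemainder F Q (1 - a / 2) (w + n)) (1 / 4) y v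

theorem IsRelativeOrbit.step [CompleteSpace V] (hr : IsPerronRegion P Q a γ R C c γ₀ R₀) {w : ℂ}
    (hw : w ∈ wedge γ₀ R₀) {y : ℕ → ℂ × U} {v : ℕ → V} (h : IsRelativeOrbit F P Q a w y v) (n : ℕ) :
    F (relativePoint (1 - a / 2) (w + n) (y n, v n)) =
      relativePoint (1 - a / 2) (w + (n + 1 : ℕ)) (y (n + 1), v (n + 1)) := by
  have hn := add_natCast_mem_wedge hw hr.γ₀_pos hr.γ₀_le_one n
  have hn1 := add_natCast_mem_wedge hw hr.γ₀_pos hr.γ₀_le_one (n + 1)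
  have e : w + (n + 1 : ℕ) = w + n + 1 := by push_cast; ring
  rw [e] at hn1 ⊢
  exact (step_iff F (hr.norm_Q_le.trans_lt hn.2) (ne_zero_of_mem_wedge hn1 hr.γ₀_pos) _ _).2
    ⟨h.forward n, h.backward n⟩

theorem isRelativeOrbit_of_step [CompleteSpace V] (hr : IsPerronRegion P Q a γ R C c γ₀ R₀) {w : ℂ}
    (hw : w ∈ wedge γ₀ R₀) {y : ℕ → ℂ × U} {v : ℕ → V} (hle : ∀ n, ‖(y n, v n)‖ ≤ 1 / 4)
    (hv : Tendsto v atTop (𝓝 0))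
    (h : ∀ n : ℕ, F (relativePoint (1 - a / 2) (w + n) (y n, v n)) =
      relativePoint (1 - a / 2) (w + (n + 1 : ℕ)) (y (n + 1), v (n + 1))) :
    IsRelativeOrbit F P Q a w y v := by
  have key : ∀ n : ℕ, _ := fun n : ℕ => by
    have hn := add_natCast_mem_wedge hw hr.γ₀_pos hr.γ₀_le_one n
    have hn1 := add_natCast_mem_wedge hw hr.γ₀_pos hr.γ₀_le_one (n + 1)
    have e : w + (n + 1 : ℕ) = w + n + 1 := by push_cast; ring
    have h' := h n
    rw [e] at hn1 h'
    exact (step_iff F (P := P) (hr.norm_Q_le.trans_lt hn.2)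
      (ne_zero_of_mem_wedge hn1 hr.γ₀_pos) _ _).1 h'
  exact ⟨hle, fun n => (key n).1, fun n => (key n).2, hv⟩

theorem IsRelativeOrbit.unique (hF : IsHyperbolicOnWedge F P Q a γ R C) [CompleteSpace V]
    (hr : IsPerronRegion P Q a γ R C c γ₀ R₀) {w : ℂ}
    (hw : w ∈ wedge γ₀ R₀) {y y' : ℕ → ℂ × U} {v v' : ℕ → V} (h : IsRelativeOrbit F P Q a w y v)
    (h' : IsRelativeOrbit F P Q a w y' v') (h0 : y 0 = y' 0) (n : ℕ) : y n = y' n ∧ v n = v' n := by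
  have hn := add_natCast_mem_wedge hw hr.γ₀_pos hr.γ₀_le_one
  exact IsStableOrbit.unique h h' (fun n => norm_stableLinear_le hr (hn n))
    (fun n => norm_unstableInverse_le hr (hn n)) hr.majorant_nonneg hr.summable_majorant
    (hr.tsum_majorant_le.trans (by norm_num))
    (fun n ξ ξ' hξ hξ' => (norm_remainder_sub_le hF hr hw n hξ hξ').1)
    (fun n ξ ξ' hξ hξ' => (norm_remainder_sub_le hF hr hw n hξ hξ').2) h0 n

/-- The parameters are `q = (w, u)`: the model orbit starts at `w` and the deviation at `(0, u)`.
The radius `1/8` for `u` is half of the radius `1/4` allowed to orbits. -/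
theorem exists_isRelativeOrbit [CompleteSpace U] [CompleteSpace V]
    (hF : IsHyperbolicOnWedge F P Q a γ R C) (hr : IsPerronRegion P Q a γ R C c γ₀ R₀) :
    ∃ (y : ℕ → ℂ × U → ℂ × U) (v : ℕ → ℂ × U → V),
      (∀ n, DifferentiableOn ℂ (v n) (wedge γ₀ R₀ ×ˢ Metric.ball 0 (1 / 8))) ∧
      ∀ q ∈ wedge γ₀ R₀ ×ˢ Metric.ball (0 : U) (1 / 8), y 0 q = (0, q.2) ∧
        IsRelativeOrbit F P Q a q.1 (fun n => y n q) (fun n => v n q) := by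
  set Ω : Set (ℂ × U) := wedge γ₀ R₀ ×ˢ Metric.ball (0 : U) (1 / 8)
  have hn : ∀ n : ℕ, ∀ q ∈ Ω, q.1 + n ∈ wedge γ₀ R₀ := fun n q hq =>
    add_natCast_mem_wedge hq.1 hr.γ₀_pos hr.γ₀_le_one n
  have hωd : ∀ n : ℕ, DifferentiableOn ℂ (fun q : ℂ × U => q.1 + n) Ω := fun n =>
    (differentiable_fst.add_const _).differentiableOn
  have hsum := hr.tsum_majorant_le
  have hlt : ∀ x : (ℂ × U) × V, ‖x‖ ≤ 1 / 4 → ‖x‖ < 1 / 2 := fun x hx => by linarith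
  have hle8 : ∀ n, perronMajorant P Q a C R₀ n / 8 ≤ perronMajorant P Q a C R₀ n := fun n => by
    linarith [hr.majorant_nonneg n]
  exact exists_isStableOrbit (V := V) (Ω := Ω) (y₀ := fun q => (0, q.2))
    (B := fun n q => stableLinear P (1 - a / 2) (q.1 + n))
    (C := fun n q => unstableInverse Q (q.1 + n))
    (H := fun n q => stableRemainder F P (1 - a / 2) (q.1 + n))
    (K := fun n q => unstableRemainder F Q (1 - a / 2) (q.1 + n))
    (μ := perronMajorant P Q a C R₀)
    ((isOpen_wedge _ _).prod Metric.isOpen_ball) (by norm_num)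
    (fun n y hy => differentiableOn_stableLinear (hωd n) hr (hn n) hy _)
    (fun n v hv => differentiableOn_unstableInverse (hωd n) hr (hn n) hv)
    ((differentiableOn_const _).prodMk differentiable_snd.differentiableOn)
    (fun n ξ hξ hξ1 =>
      (differentiableOn_remainder (hωd n) hF hr (hn n) hξ (fun q hq => hlt _ (hξ1 q hq))).1)
    (fun n ξ hξ hξ1 =>
      (differentiableOn_remainder (hωd n) hF hr (hn n) hξ (fun q hq => hlt _ (hξ1 q hq))).2)
    (fun n q hq => norm_stableLinear_le hr (hn n q hq))
    (fun n q hq => norm_unstableInverse_le hr (hn n q hq))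
    hr.majorant_nonneg hr.summable_majorant (by linarith) (by linarith)
    (fun q hq => by
      have := mem_ball_zero_iff.1 hq.2
      rw [Prod.norm_mk, norm_zero]
      exact max_le (by norm_num) (by linarith))
    (fun n q hq ξ hξ => ((norm_remainder_le_majorant hF hr hq.1 n (hlt ξ hξ)).1).trans (hle8 n))
    (fun n q hq ξ hξ => ((norm_remainder_le_majorant hF hr hq.1 n (hlt ξ hξ)).2).trans (hle8 n))
    (fun n q hq ξ ξ' hξ hξ' => (norm_remainder_sub_le hF hr hq.1 n hξ hξ').1)
    (fun n q hq ξ ξ' hξ hξ' => (norm_remainder_sub_le hF hr hq.1 n hξ hξ').2)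

/-- The linear part does not mix `ζ` and `u`, so the forward estimate applies to `ζ` alone, which
starts at `0`. Being far below `1/4`, the bound leaves room for a change of model orbit. -/
theorem IsRelativeOrbit.norm_deviation_le (hF : IsHyperbolicOnWedge F P Q a γ R C)
    (hr : IsPerronRegion P Q a γ R C c γ₀ R₀) {w : ℂ}
    (hw : w ∈ wedge γ₀ R₀) {y : ℕ → ℂ × U} {v : ℕ → V} (h : IsRelativeOrbit F P Q a w y v)
    (h0 : (y 0).1 = 0) (n : ℕ) : ‖(y n).1‖ ≤ 1 / 32 := by
  have hn := add_natCast_mem_wedge hw hr.γ₀_pos hr.γ₀_le_one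
  have hle8 : ∀ n, perronMajorant P Q a C R₀ n / 8 ≤ perronMajorant P Q a C R₀ n := fun n => by
    linarith [hr.majorant_nonneg n]
  have := norm_le_add_sum_of_forward (y := fun n => (y n).1)
    (B := fun n : ℕ => (((w + n) ^ ((1 - a / 2 : ℝ) : ℂ) * ((w + n + 1) ^ ((1 - a / 2 : ℝ) : ℂ))⁻¹) •
      ContinuousLinearMap.id ℂ ℂ))
    (h := fun n => (stableRemainder F P (1 - a / 2) (w + n) (y n, v n)).1)
    (fun n x => by
      have h1 := norm_stableLinear_le hr (hn n) ((x, 0) : ℂ × U)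
      rw [stableLinear_apply] at h1
      have h2 := (norm_fst_le _).trans h1
      simpa using h2)
    (fun n => congrArg Prod.fst (h.forward n)) hr.majorant_nonneg hr.summable_majorant
    (fun n => (norm_fst_le _).trans (((norm_remainder_le_majorant hF hr hw n
      (by have := h.norm_le n; linarith)).1).trans (hle8 n))) n
  rw [h0, norm_zero, zero_add] at this
  exact this.trans hr.tsum_majorant_le

theorem IsRelativeOrbit.norm_unstable_le (hF : IsHyperbolicOnWedge F P Q a γ R C) [CompleteSpace V]
    (hr : IsPerronRegion P Q a γ R C c γ₀ R₀) {w : ℂ}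
    (hw : w ∈ wedge γ₀ R₀) {y : ℕ → ℂ × U} {v : ℕ → V} (h : IsRelativeOrbit F P Q a w y v) (n : ℕ) :
    ‖v n‖ ≤ 4 * (4 * C + 2 * ‖P‖ + 2 * ‖Q‖) * (∑' n : ℕ, ((n : ℝ) + 1) ^ (-(1 + a / 4))) *
      ‖w‖ ^ (-(a / 4)) := by
  have hn := add_natCast_mem_wedge hw hr.γ₀_pos hr.γ₀_le_one
  have := norm_le_tsum_of_backward (fun n => norm_unstableInverse_le hr (hn n)) h.backward h.tendsto
    ((summable_natCast_add_one_rpow (by linarith [hr.a_pos] : 0 < a / 4)).mul_left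
      (4 * (4 * C + 2 * ‖P‖ + 2 * ‖Q‖) * ‖w‖ ^ (-(a / 4))))
    (fun n => (norm_remainder_le_natCast hF hr hw n (by have := h.norm_le n; linarith)).2) n
  rw [tsum_mul_left] at this
  linarith

omit [NormedAddCommGroup U] [InnerProductSpace ℂ U] [NormedAddCommGroup V] [InnerProductSpace ℂ V] in
theorem relativePoint_zero (β : ℝ) (w : ℂ) (u : U) (v : V) :
    relativePoint β w ((0, u), v) = (w, u, v) := by
  simp [relativePoint]

/-- The part of an orbit after its first step is an orbit relative to its own model orbit. -/
theorem IsRelativeOrbit.exists_shift (hF : IsHyperbolicOnWedge F P Q a γ R C) [CompleteSpace V]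
    (hr : IsPerronRegion P Q a γ R C c γ₀ R₀) {w w₁ : ℂ}
    (hw : w ∈ wedge γ₀ R₀) {y : ℕ → ℂ × U} {v : ℕ → V} (h : IsRelativeOrbit F P Q a w y v)
    (h0 : (y 0).1 = 0) (hw₁ : w₁ = (F (w, (y 0).2, v 0)).1) (hw₁' : w₁ ∈ wedge γ₀ R₀) :
    ∃ y' : ℕ → ℂ × U, y' 0 = (0, (y 1).2) ∧ IsRelativeOrbit F P Q a w₁ y' (fun n => v (n + 1)) := by
  set β : ℝ := 1 - a / 2 with hβ
  have ha := hr.a_pos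
  have ha1 := hr.a_le_one
  set X : ℕ → ℂ := fun n => (relativePoint β (w + (n + 1 : ℕ)) (y (n + 1), v (n + 1))).1 with hX
  have hn1 : ∀ n : ℕ, w₁ + n ∈ wedge γ₀ R₀ := add_natCast_mem_wedge hw₁' hr.γ₀_pos hr.γ₀_le_one
  have hne : ∀ n : ℕ, (w₁ + n) ^ (β : ℂ) ≠ 0 := fun n => by
    simp [Complex.cpow_eq_zero_iff, ne_zero_of_mem_wedge (hn1 n) hr.γ₀_pos]
  have hp0 : relativePoint β (w + (0 : ℕ)) (y 0, v 0) = (w, (y 0).2, v 0) := by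
    rw [Nat.cast_zero, add_zero, ← relativePoint_zero β w (y 0).2 (v 0), ← h0]
  have hstep := h.step hr hw
  have hX0 : X 0 = w₁ := by
    rw [hw₁, ← hp0, hstep 0]
  -- The same points, measured from the model orbit `w₁ + n` in place of `w + (n + 1)`. Only the
  -- coordinate `ζ` changes, and it now starts at `0`.
  refine ⟨fun n => ((X n - (w₁ + n)) * ((w₁ + n) ^ (β : ℂ))⁻¹, (y (n + 1)).2), ?_, ?_⟩
  · simp [hX0]
  have hrel : ∀ n : ℕ, relativePoint β (w₁ + n)
      (((X n - (w₁ + n)) * ((w₁ + n) ^ (β : ℂ))⁻¹, (y (n + 1)).2), v (n + 1)) =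
      relativePoint β (w + (n + 1 : ℕ)) (y (n + 1), v (n + 1)) := by
    intro n
    have : w₁ + n + (w₁ + n) ^ (β : ℂ) * ((X n - (w₁ + n)) * ((w₁ + n) ^ (β : ℂ))⁻¹) = X n := by
      have := hne n
      field_simp
      ring
    simp only [relativePoint] at this ⊢
    rw [this]
    rfl
  refine isRelativeOrbit_of_step hr hw₁' (fun n => ?_) (h.tendsto.comp (tendsto_add_atTop_nat 1))
    (fun n => ?_)
  · have hyv := h.norm_le (n + 1)
    refine max_le (max_le ?_ ?_) ?_
    · set ω := w + (n + 1 : ℕ) with hω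
      have hωmem : ω ∈ wedge γ₀ R₀ := add_natCast_mem_wedge hw hr.γ₀_pos hr.γ₀_le_one (n + 1)
      have hf : ‖w₁ - w - 1‖ ≤ 1 / 8 := by
        have hmem : (w, (y 0).2, v 0) ∈ wedge γ R ×ˢ Metric.ball (0 : U × V) 1 := by
          rw [← hp0]
          exact (relativePoint_spec ha hr.γ₀_pos hr.γ₀_le_one hr.two_γ₀_le hr.one_le hr.R_le
            hr.rpow_le (add_natCast_mem_wedge hw hr.γ₀_pos hr.γ₀_le_one 0)
            (by have := h.norm_le 0; linarith)).1
        have := hF.base _ hmem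
        rw [← hw₁] at this
        refine this.trans ?_
        have h2 : C * ‖w‖ ^ (-a) ≤ C * R₀ ^ (-a) := mul_le_mul_of_nonneg_left
          (Real.rpow_le_rpow_of_nonpos (by linarith [hr.one_le]) hw.2.le (by linarith)) hr.C_nonneg
        have := hr.base_le
        have := hr.γ₀_le_one
        simp only
        linarith
      have e1 : X n - (w₁ + n) = ω ^ (β : ℂ) * (y (n + 1)).1 - (w₁ - w - 1) := by
        simp only [hX, relativePoint, hω]
        push_cast
        ring
      have hone : 1 ≤ ‖w₁ + n‖ := hr.one_le.trans (hn1 n).2.le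
      have h2 : ‖ω‖ ≤ 2 * ‖w₁ + n‖ := by
        have : ω = (w₁ + n) - (w₁ - w - 1) := by rw [hω]; push_cast; ring
        rw [this]
        linarith [norm_sub_le (w₁ + n) (w₁ - w - 1)]
      have h3 : ‖ω‖ ^ β ≤ 2 * ‖w₁ + n‖ ^ β := by
        calc ‖ω‖ ^ β ≤ (2 * ‖w₁ + n‖) ^ β := Real.rpow_le_rpow (norm_nonneg _) h2 (by linarith)
          _ = 2 ^ β * ‖w₁ + n‖ ^ β := Real.mul_rpow (by norm_num) (norm_nonneg _)
          _ ≤ 2 ^ (1 : ℝ) * ‖w₁ + n‖ ^ β := by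
              gcongr
              · norm_num
              · linarith
          _ = _ := by rw [Real.rpow_one]
      have h4 : 1 ≤ ‖w₁ + n‖ ^ β := Real.one_le_rpow hone (by linarith)
      have h5 := h.norm_deviation_le hF hr hw h0 (n + 1)
      -- After division by `‖w₁ + n‖ ^ β ≥ 1` the new deviation is at most `2/32 + 1/8`, which is
      -- below `1/4`. The bound `1/32` on the sum of the majorant is chosen for this.
      have h6 : ‖X n - (w₁ + n)‖ ≤ ‖ω‖ ^ β * (1 / 32) + 1 / 8 := by
        rw [e1]
        refine (norm_sub_le _ _).trans (add_le_add ?_ hf)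
        rw [norm_mul, norm_cpow_ofReal (ne_zero_of_mem_wedge hωmem hr.γ₀_pos)]
        gcongr
      simp only
      rw [norm_mul, norm_inv, norm_cpow_ofReal (ne_zero_of_mem_wedge (hn1 n) hr.γ₀_pos),
        ← div_eq_mul_inv, div_le_iff₀ (by positivity)]
      linarith
    · exact ((norm_snd_le (y (n + 1))).trans (norm_fst_le (y (n + 1), v (n + 1)))).trans hyv
    · exact (norm_snd_le (y (n + 1), v (n + 1))).trans hyv
  · simp only [← hβ]
    rw [hrel n, hrel (n + 1), hstep (n + 1)]

/-- Stable manifold theorem for perturbations of a hyperbolic map on a sector at infinity: the set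
of points with convergent orbits contains an invariant holomorphic graph over the stable variables. -/
theorem exists_stable_graph [CompleteSpace U] [CompleteSpace V]
    (hF : IsHyperbolicOnWedge F P Q a γ R C) (hr : IsPerronRegion P Q a γ R C c γ₀ R₀) :
    ∃ (φ : ℂ × U → V) (D : ℝ), DifferentiableOn ℂ φ (wedge γ₀ R₀ ×ˢ Metric.ball 0 (1 / 8)) ∧
      ∀ q ∈ wedge γ₀ R₀ ×ˢ Metric.ball (0 : U) (1 / 8),
        ‖φ q‖ ≤ D * ‖q.1‖ ^ (-(a / 4)) ∧ ‖φ q‖ ≤ 1 / 4 ∧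
        (∃ x : ℕ → ℂ × U × V, x 0 = (q.1, q.2, φ q) ∧ (∀ n, x (n + 1) = F (x n)) ∧
          (∀ n, x n ∈ wedge γ R ×ˢ Metric.ball (0 : U × V) 1) ∧
          Tendsto (fun n => ‖(x n).1‖) atTop atTop) ∧
        (((F (q.1, q.2, φ q)).1, (F (q.1, q.2, φ q)).2.1) ∈
            wedge γ₀ R₀ ×ˢ Metric.ball (0 : U) (1 / 8) →
          φ ((F (q.1, q.2, φ q)).1, (F (q.1, q.2, φ q)).2.1) = (F (q.1, q.2, φ q)).2.2) := by
  obtain ⟨y, v, hd, h⟩ := exists_isRelativeOrbit hF hr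
  refine ⟨v 0, 4 * (4 * C + 2 * ‖P‖ + 2 * ‖Q‖) * (∑' n : ℕ, ((n : ℝ) + 1) ^ (-(1 + a / 4))), hd 0,
    fun q hq => ?_⟩
  obtain ⟨h0, ho⟩ := h q hq
  have hw := hq.1
  have hstep := ho.step hr hw
  have hx0 : relativePoint (1 - a / 2) (q.1 + (0 : ℕ)) (y 0 q, v 0 q) = (q.1, q.2, v 0 q) := by
    rw [h0, Nat.cast_zero, add_zero, relativePoint_zero]
  have hspec : ∀ n : ℕ, _ := fun n : ℕ => relativePoint_spec (ξ := (y n q, v n q)) hr.a_pos hr.γ₀_pos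
    hr.γ₀_le_one hr.two_γ₀_le hr.one_le hr.R_le hr.rpow_le
    (add_natCast_mem_wedge hw hr.γ₀_pos hr.γ₀_le_one n) (by have := ho.norm_le n; linarith)
  refine ⟨ho.norm_unstable_le hF hr hw 0, (norm_snd_le _).trans (ho.norm_le 0),
    ⟨fun n => relativePoint (1 - a / 2) (q.1 + n) (y n q, v n q), hx0, fun n => (hstep n).symm,
      fun n => (hspec n).1, ?_⟩, fun hmem => ?_⟩
  -- One factor `2` compares the point with `w + n`, the other compares `w + n` with `n`.
  · refine tendsto_atTop_mono (f := fun n : ℕ => (n : ℝ) / 4) (fun n => ?_)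
      (tendsto_natCast_atTop_atTop.atTop_div_const (by norm_num))
    have h1 := (hspec n).2.2
    have h2 := norm_add_le_two_mul_norm_add_natCast hw hr.γ₀_pos hr.γ₀_le_one n
    have h3 := norm_nonneg q.1
    linarith
  · have h01 : (y 0 q).1 = 0 := by rw [h0]
    have h02 : (y 0 q).2 = q.2 := by rw [h0]
    obtain ⟨y', hy'0, hy'⟩ := ho.exists_shift hF hr hw h01 (by rw [h02]) hmem.1
    have hF1 : F (q.1, q.2, v 0 q) =
        relativePoint (1 - a / 2) (q.1 + (0 + 1 : ℕ)) (y (0 + 1) q, v (0 + 1) q) := by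
      rw [← hx0]; exact hstep 0
    have e1 : (F (q.1, q.2, v 0 q)).2.1 = (y 1 q).2 := by rw [hF1]; rfl
    have e2 : (F (q.1, q.2, v 0 q)).2.2 = v 1 q := by rw [hF1]; rfl
    -- The shifted orbit and the orbit constructed from the image point are both bounded orbits
    -- relative to the same model orbit, with the same initial `(0, u)`. Uniqueness identifies their
    -- `v`, which is the invariance of the graph.
    obtain ⟨h0', ho'⟩ := h _ hmem
    have := (ho'.unique hF hr hmem.1 hy' (by rw [h0', hy'0, e1]) 0).2
    rw [e2]
    exact this

/-- On the ball of radius `ρ` the contraction gains `(c/8) ρ / |w|`, while the error is `C |w|^(-a)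
/ |w|`; far out the gain wins, and the base point satisfies the condition for staying in the wedge.
-/
theorem exists_invariant_wedge (hF : IsHyperbolicOnWedge F P Q a γ R C)
    (hr : IsPerronRegion P Q a γ R C c γ₀ R₀) {ρ : ℝ} (hρ : 0 < ρ) :
    ∃ R₁, 2 * R₀ ≤ R₁ ∧ ∀ w ∈ wedge (γ₀ / 2) R₁, ∀ u ∈ Metric.ball (0 : U) ρ, ∀ v : V,
      (u, v) ∈ Metric.ball (0 : U × V) 1 →
      (F (w, u, v)).1 ∈ wedge (γ₀ / 2) R₁ ∧ (F (w, u, v)).2.1 ∈ Metric.ball (0 : U) ρ := by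
  have hc := hr.c_pos
  have hlim := (tendsto_rpow_neg_atTop hr.a_pos).const_mul C
  rw [mul_zero] at hlim
  obtain ⟨R₁, hR₁, hR₁', hR₁''⟩ := ((eventually_ge_atTop (2 * R₀)).and
    ((hlim.eventually (gt_mem_nhds (by have := hr.γ₀_pos; positivity : 0 < γ₀ / 8))).and
    (hlim.eventually (gt_mem_nhds (by positivity : 0 < c / 8 * ρ / 2))))).exists
  have hR₀ := hr.one_le
  have hR₀' := hr.R_le
  refine ⟨R₁, hR₁, fun w hw u hu v huv => ?_⟩
  have hγ₀ := hr.γ₀_pos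
  have hγ₁ := hr.γ₀_le_one
  have hw0 : w ∈ wedge γ₀ R₀ := wedge_mono (by positivity) (by linarith) (by linarith) hw
  have hmem : (w, u, v) ∈ wedge γ R ×ˢ Metric.ball (0 : U × V) 1 :=
    ⟨wedge_mono hγ₀ (by linarith [hr.two_γ₀_le]) (by linarith [hr.R_le, hr.one_le]) hw0, huv⟩
  have hCw : C * ‖w‖ ^ (-a) ≤ C * R₁ ^ (-a) := mul_le_mul_of_nonneg_left
    (Real.rpow_le_rpow_of_nonpos (by linarith [hr.one_le]) hw.2.le (by linarith [hr.a_pos])) hr.C_nonneg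
  have hwpos : 0 < ‖w‖ := norm_pos_iff.2 (ne_zero_of_mem_wedge hw0 hγ₀)
  constructor
  · have h1 := (hF.base _ hmem).trans hCw
    have h2 := add_one_add_mem_wedge hw (by positivity) (by linarith) (f := (F (w, u, v)).1 - w - 1)
      (by simp only at h1; linarith)
    convert h2 using 1
    ring
  · rw [mem_ball_zero_iff] at hu ⊢
    have h1 := hF.stable _ hmem
    have h2 := norm_sub_inv_smul_le hc hr.accretive_P hw0 hγ₀ hγ₁ hr.γ₀_mul_norm_P hr.norm_P_le u
    have h3 : ‖(F (w, u, v)).2.1‖ ≤ ‖u - w⁻¹ • P u‖ + C * ‖w‖ ^ (-(1 + a)) := by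
      have := norm_add_le ((F (w, u, v)).2.1 - (u - w⁻¹ • P u)) (u - w⁻¹ • P u)
      rw [sub_add_cancel] at this
      simp only at h1
      linarith
    have h4 : C * ‖w‖ ^ (-(1 + a)) ≤ c / 8 * ρ / 2 / ‖w‖ := by
      rw [neg_add, Real.rpow_add hwpos, Real.rpow_neg_one, div_eq_inv_mul, mul_left_comm]
      gcongr
      linarith
    have h5 : 0 ≤ 1 - c / 8 / ‖w‖ := by
      have : c / 8 / ‖w‖ ≤ 1 := by
        rw [div_le_one hwpos]
        have := hw0.2
        have := hr.norm_P_le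
        have : 0 ≤ 4 * ‖P‖ ^ 2 / c := by positivity
        linarith
      linarith
    have h6 : (1 - c / 8 / ‖w‖) * ‖u‖ ≤ (1 - c / 8 / ‖w‖) * ρ := mul_le_mul_of_nonneg_left hu.le h5
    have h7 : c / 8 * ρ / 2 / ‖w‖ < c / 8 / ‖w‖ * ρ := by
      have : 0 < c / 8 / ‖w‖ * ρ := by positivity
      have e : c / 8 * ρ / 2 / ‖w‖ = c / 8 / ‖w‖ * ρ / 2 := by ring
      rw [e]; linarith
    linarith

end stableManifold

/-! ### Taylor expansion of the germ at the origin. -/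

open Asymptotics

section expansion
variable {p : ℕ} {Φ : Cn p → Cn p} {k : ℕ}

theorem homPart_smul (Φ : Cn p → Cn p) (n : ℕ) (c : ℂ) (z : Cn p) :
    homPart Φ n (c • z) = c ^ n • homPart Φ n z := by
  unfold homPart
  have := (iteratedFDeriv ℂ n Φ 0).map_smul_univ (fun _ => c) (fun _ => z)
  simp only [Finset.prod_const, Finset.card_univ, Fintype.card_fin] at this
  rw [this, smul_smul, smul_smul, mul_comm]

theorem analyticAt_homPart (Φ : Cn p → Cn p) (n : ℕ) (z : Cn p) : AnalyticAt ℂ (homPart Φ n) z := by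
  have h : AnalyticAt ℂ (fun z : Cn p => iteratedFDeriv ℂ n Φ 0 (fun _ => z)) z :=
    (iteratedFDeriv ℂ n Φ 0).analyticAt.comp
      ((ContinuousLinearMap.pi (fun _ : Fin n => ContinuousLinearMap.id ℂ (Cn p))).analyticAt z)
  exact (analyticAt_const (v := ((n.factorial : ℂ))⁻¹)).smul h

theorem AnalyticAt.isBigO_sub_fderiv {E F : Type*} [NormedAddCommGroup E] [NormedSpace ℂ E]
    [NormedAddCommGroup F] [NormedSpace ℂ F] {f : E → F} {x : E} (h : AnalyticAt ℂ f x) :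
    (fun t => f (x + t) - f x - fderiv ℂ f x t) =O[𝓝 0] (fun t => ‖t‖ ^ 2) := by
  obtain ⟨s, hs⟩ := h
  refine (hs.isBigO_sub_partialSum_pow 2).congr_left (fun t => ?_)
  rw [FormalMultilinearSeries.partialSum, Finset.sum_range_succ, Finset.sum_range_one, hs.fderiv_eq,
    hs.coeff_zero, sub_add_eq_sub_sub]
  rfl

theorem IsTangentToIdentityOfOrder.one_le (h : IsTangentToIdentityOfOrder Φ k) : 1 ≤ k := by
  have := h.order.1.1
  omega

/-- In the Taylor polynomial of degree `k + 1` only `z` and `P_{k+1}` survive: the constant term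
vanishes, and by minimality of the order so do the degrees from `2` to `k`. -/
theorem IsTangentToIdentityOfOrder.isBigO (h : IsTangentToIdentityOfOrder Φ k) :
    (fun z => Φ z - z - homPart Φ (k + 1) z) =O[𝓝 0] (fun z => ‖z‖ ^ (k + 2)) := by
  obtain ⟨s, hs⟩ := h.analyticAt
  have hk := h.one_le
  have hpart : ∀ n z, s n (fun _ => z) = homPart Φ n z := by
    intro n z
    obtain ⟨r, hr⟩ := hs
    rw [homPart, ← hr.factorial_smul z n, ← Nat.cast_smul_eq_nsmul ℂ, smul_smul,
      inv_mul_cancel₀ (Nat.cast_ne_zero.2 n.factorial_ne_zero), one_smul]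
  refine (hs.isBigO_sub_partialSum_pow (k + 2)).congr_left (fun z => ?_)
  have h0 : homPart Φ 0 z = 0 := by
    rw [← hpart, hs.coeff_zero, h.map_zero]
  have hmid : ∀ n, 2 ≤ n → n < k + 1 → homPart Φ n z = 0 := by
    intro n h2 hn
    by_contra hne
    have := h.order.2 (show n ∈ {ν : ℕ | 2 ≤ ν ∧ ∃ z, homPart Φ ν z ≠ 0} from ⟨h2, z, hne⟩)
    omega
  have hsum : s.partialSum (k + 2) z = z + homPart Φ (k + 1) z := by
    rw [FormalMultilinearSeries.partialSum, Finset.sum_range_succ]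
    simp only [hpart]
    congr 1
    rw [Finset.sum_eq_single 1]
    · exact h.homPart_one z
    · intro n hn hn1
      rw [Finset.mem_range] at hn
      rcases Nat.lt_or_ge n 2 with h2 | h2
      · have : n = 0 := by omega
        rw [this, h0]
      · exact hmid n h2 hn
    · intro hn
      exact absurd (Finset.mem_range.2 (by omega)) hn
  rw [hsum, zero_add, sub_add_eq_sub_sub]

end expansion

/-! ### The germ in the blow-up chart at `[V]`. -/

section blowUp
variable {p : ℕ} {j : Fin p}

theorem affinePoint_add (u t : Others j → ℂ) :
    affinePoint j (u + t) = affinePoint j u + includeOthers j t := by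
  ext i
  by_cases h : i = j <;> simp [affinePoint, includeOthers, h]

@[simp] theorem affinePoint_self (u : Others j → ℂ) : affinePoint j u j = 1 := by
  simp [affinePoint]

@[simp] theorem affinePoint_others (u : Others j → ℂ) (i : Others j) : affinePoint j u i.1 = u i := by
  simp [affinePoint, i.2]

/-- The blow-up chart `(x, t) ↦ x (1, u₀ + t)`. -/
noncomputable def blowUp (u₀ : Others j → ℂ) (q : ℂ × (Others j → ℂ)) : Cn p :=
  q.1 • affinePoint j (u₀ + q.2)

/-- The factor by which `Φ` multiplies the coordinate `x` of the blow-up chart. -/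
noncomputable def blowUpRatio (Φ : Cn p → Cn p) (u₀ : Others j → ℂ) (q : ℂ × (Others j → ℂ)) : ℂ :=
  Φ (blowUp u₀ q) j / q.1

/-- The coordinate `t` of the image under `Φ` in the blow-up chart. -/
noncomputable def blowUpSlope (Φ : Cn p → Cn p) (u₀ : Others j → ℂ) (q : ℂ × (Others j → ℂ)) : Others j → ℂ :=
  fun i => Φ (blowUp u₀ q) i.1 / Φ (blowUp u₀ q) j - u₀ i

theorem blowUp_ratio_slope (Φ : Cn p → Cn p) (u₀ : Others j → ℂ) (q : ℂ × (Others j → ℂ))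
    (hx : q.1 ≠ 0) (hm : blowUpRatio Φ u₀ q ≠ 0) :
    blowUp u₀ (q.1 * blowUpRatio Φ u₀ q, blowUpSlope Φ u₀ q) = Φ (blowUp u₀ q) := by
  have h1 : q.1 * blowUpRatio Φ u₀ q = Φ (blowUp u₀ q) j := by
    unfold blowUpRatio; field_simp
  have h2 : Φ (blowUp u₀ q) j ≠ 0 := by
    rw [← h1]; exact mul_ne_zero hx hm
  ext i
  nth_rewrite 1 [blowUp]
  rw [PiLp.smul_apply, smul_eq_mul, h1]
  by_cases h : i = j
  · subst h; simp
  · have := affinePoint_others (u₀ + blowUpSlope Φ u₀ q) ⟨i, h⟩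
    simp only at this
    rw [this]
    simp only [Pi.add_apply, blowUpSlope]
    field_simp
    ring

theorem charMap_analyticAt (Φ : Cn p → Cn p) (n : ℕ) (u₀ : Others j → ℂ) :
    AnalyticAt ℂ (charMap (homPart Φ n) j) u₀ := by
  have haff : AnalyticAt ℂ (fun u : Others j → ℂ => affinePoint j u) u₀ := by
    have : (fun u : Others j → ℂ => affinePoint j u) =
        fun u => affinePoint j 0 + (includeOthers j).toContinuousLinearMap u := by
      ext1 u
      rw [← zero_add u, affinePoint_add]
      simp
    rw [this]
    exact analyticAt_const.add (ContinuousLinearMap.analyticAt _ _)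
  have hP := (analyticAt_homPart Φ n (affinePoint j u₀)).comp haff
  have hc : ∀ i, AnalyticAt ℂ (fun u : Others j → ℂ => homPart Φ n (affinePoint j u) i) u₀ := fun i =>
    ((EuclideanSpace.proj (𝕜 := ℂ) i : Cn p →L[ℂ] ℂ).analyticAt _).comp hP
  refine analyticAt_pi_iff.2 (fun i => ?_)
  exact (hc i.1).sub ((hc j).mul ((ContinuousLinearMap.proj (R := ℂ) i).analyticAt u₀))

variable {Φ : Cn p → Cn p} {k : ℕ}

/-- The filter of small `(x, t)` with `x ≠ 0`. -/
noncomputable abbrev puncturedZero (j : Fin p) : Filter (ℂ × (Others j → ℂ)) :=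
  𝓝 0 ⊓ 𝓟 {q | q.1 ≠ 0}

/-- The remainder of order `k + 2` of `Φ`, divided by `x` in the blow-up chart. -/
noncomputable def blowUpRemainder (Φ : Cn p → Cn p) (k : ℕ) (u₀ : Others j → ℂ) (q : ℂ × (Others j → ℂ)) : Cn p :=
  q.1⁻¹ • (Φ (blowUp u₀ q) - blowUp u₀ q - homPart Φ (k + 1) (blowUp u₀ q))

theorem continuous_affinePoint (j : Fin p) : Continuous (affinePoint j) := by
  have : affinePoint j = fun u => affinePoint j 0 + (includeOthers j).toContinuousLinearMap u := by
    ext1 u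
    rw [← zero_add u, affinePoint_add]
    simp
  rw [this]
  exact continuous_const.add (ContinuousLinearMap.continuous _)

theorem continuous_blowUp (u₀ : Others j → ℂ) : Continuous (blowUp u₀) :=
  continuous_fst.smul ((continuous_affinePoint j).comp (continuous_const.add continuous_snd))

theorem tendsto_blowUp (u₀ : Others j → ℂ) : Tendsto (blowUp u₀) (𝓝 0) (𝓝 0) := by
  have := (continuous_blowUp u₀).tendsto 0
  simpa [blowUp] using this

theorem isBigO_blowUp (u₀ : Others j → ℂ) : blowUp u₀ =O[𝓝 0] (fun q => q.1) := by
  have h : (fun q : ℂ × (Others j → ℂ) => affinePoint j (u₀ + q.2)) =O[𝓝 0] (fun _ => (1 : ℂ)) :=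
    (((continuous_affinePoint j).comp (continuous_const.add continuous_snd)).tendsto _).isBigO_one ℂ
  exact ((isBigO_refl (fun q : ℂ × (Others j → ℂ) => q.1) (𝓝 0)).smul h).congr_right
    (fun q => by simp)

theorem isBigO_blowUpRemainder (h : IsTangentToIdentityOfOrder Φ k) (u₀ : Others j → ℂ) :
    blowUpRemainder Φ k u₀ =O[puncturedZero j] (fun q => ‖q.1‖ ^ (k + 1)) := by
  have h1 : (fun q => Φ (blowUp u₀ q) - blowUp u₀ q - homPart Φ (k + 1) (blowUp u₀ q))
      =O[puncturedZero j] (fun q => ‖q.1‖ ^ (k + 2)) :=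
    ((h.isBigO.comp_tendsto (tendsto_blowUp u₀)).trans ((isBigO_blowUp u₀).norm_left.norm_right.pow (k + 2))).mono inf_le_left
  have h2 := (isBigO_refl (fun q : ℂ × (Others j → ℂ) => q.1⁻¹) (puncturedZero j)).norm_right.smul h1
  refine h2.trans (IsBigO.of_bound 1 ?_)
  filter_upwards [mem_inf_of_right (mem_principal_self _)] with q hq
  have hq' : ‖q.1‖ ≠ 0 := norm_ne_zero_iff.2 hq
  rw [norm_smul, norm_norm, norm_inv, norm_pow, norm_pow, norm_norm, one_mul, pow_succ _ (k + 1)]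
  field_simp
  exact le_rfl

/-- By homogeneity `P_{k+1}` contributes `x · x^k P_{k+1}(1, u₀ + t)`, so a factor `x` comes out of
the whole expansion. -/
theorem apply_eq_of_blowUp (Φ : Cn p → Cn p) (k : ℕ) (u₀ : Others j → ℂ) {q : ℂ × (Others j → ℂ)}
    (hq : q.1 ≠ 0) : Φ (blowUp u₀ q) = q.1 • (affinePoint j (u₀ + q.2) +
      q.1 ^ k • homPart Φ (k + 1) (affinePoint j (u₀ + q.2)) + blowUpRemainder Φ k u₀ q) := by
  have e : q.1 • blowUpRemainder Φ k u₀ q =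
      Φ (blowUp u₀ q) - blowUp u₀ q - homPart Φ (k + 1) (blowUp u₀ q) := by
    rw [blowUpRemainder, smul_inv_smul₀ hq]
  have e2 : homPart Φ (k + 1) (blowUp u₀ q) =
      q.1 • q.1 ^ k • homPart Φ (k + 1) (affinePoint j (u₀ + q.2)) := by
    rw [blowUp, homPart_smul, smul_smul, pow_succ']
  rw [smul_add, smul_add, e, e2]
  simp only [blowUp]
  abel

theorem blowUpRatio_eq (Φ : Cn p → Cn p) (k : ℕ) (u₀ : Others j → ℂ) {q : ℂ × (Others j → ℂ)}
    (hq : q.1 ≠ 0) : blowUpRatio Φ u₀ q = 1 +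
      q.1 ^ k * homPart Φ (k + 1) (affinePoint j (u₀ + q.2)) j + blowUpRemainder Φ k u₀ q j := by
  rw [blowUpRatio, apply_eq_of_blowUp Φ k u₀ hq]
  simp only [PiLp.smul_apply, PiLp.add_apply, affinePoint_self, smul_eq_mul]
  field_simp

theorem isBigO_apply {α : Type*} {l : Filter α} {f : α → Cn p} {g : α → ℝ} (h : f =O[l] g) (i : Fin p) :
    (fun a => f a i) =O[l] g :=
  (IsBigO.of_bound 1 (Eventually.of_forall fun a => by
    simpa using PiLp.norm_apply_le (f a) i)).trans h

/-- Two errors occur: freezing `P_{k+1}` at `t = 0` costs `|x|^k |t|`, and the Taylor remainder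
costs `|x|^(k+1)`. -/
theorem isBigO_blowUpRatio (h : IsTangentToIdentityOfOrder Φ k) (u₀ : Others j → ℂ) :
    (fun q => blowUpRatio Φ u₀ q - 1 - homPart Φ (k + 1) (affinePoint j u₀) j * q.1 ^ k)
      =O[puncturedZero j] (fun q => ‖q.1‖ ^ k * (‖q.1‖ + ‖q.2‖)) := by
  have hd : (fun t => homPart Φ (k + 1) (affinePoint j (u₀ + t)) j
      - homPart Φ (k + 1) (affinePoint j u₀) j) =O[𝓝 0] (fun t : Others j → ℂ => t) := by
    have h1 : DifferentiableAt ℂ (fun z => homPart Φ (k + 1) z j) (affinePoint j u₀) :=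
      (EuclideanSpace.proj (𝕜 := ℂ) j : Cn p →L[ℂ] ℂ).differentiableAt.comp _
        (analyticAt_homPart Φ (k + 1) _).differentiableAt
    have ht : Tendsto (fun t => affinePoint j (u₀ + t)) (𝓝 0) (𝓝 (affinePoint j u₀)) := by
      have := ((continuous_affinePoint j).comp (continuous_const_add u₀)).tendsto 0
      rw [Function.comp_apply, add_zero] at this
      exact this
    refine (h1.isBigO_sub.comp_tendsto ht).trans ?_
    have : ((fun z => z - affinePoint j u₀) ∘ fun t => affinePoint j (u₀ + t)) =
        fun t => (includeOthers j).toContinuousLinearMap t := by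
      ext1 t
      simp [affinePoint_add]
    rw [this]
    exact ContinuousLinearMap.isBigO_id _ _
  have hd' : (fun q : ℂ × (Others j → ℂ) => homPart Φ (k + 1) (affinePoint j (u₀ + q.2)) j
      - homPart Φ (k + 1) (affinePoint j u₀) j) =O[puncturedZero j] (fun q => ‖q.1‖ + ‖q.2‖) := by
    refine ((hd.comp_tendsto (continuous_snd.tendsto (0 : ℂ × (Others j → ℂ)))).mono inf_le_left).trans ?_
    exact IsBigO.of_bound 1 (Eventually.of_forall fun q => by
      simp only [Function.comp, one_mul]
      exact (le_add_of_nonneg_left (norm_nonneg _)).trans (le_abs_self _))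
  have h1 := ((isBigO_refl (fun q : ℂ × (Others j → ℂ) => q.1 ^ k) (puncturedZero j)).norm_right.mul hd')
  have h2 := isBigO_apply (isBigO_blowUpRemainder h u₀) j
  have h3 : (fun q : ℂ × (Others j → ℂ) => ‖q.1‖ ^ (k + 1)) =O[puncturedZero j]
      (fun q => ‖q.1‖ ^ k * (‖q.1‖ + ‖q.2‖)) :=
    IsBigO.of_bound 1 (Eventually.of_forall fun q => by
      rw [one_mul, Real.norm_of_nonneg (by positivity), Real.norm_of_nonneg (by positivity), pow_succ]
      gcongr
      exact le_add_of_nonneg_right (norm_nonneg _))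
  refine ((h1.congr_right (fun q => by rw [norm_pow])).add (h2.trans h3)).congr' ?_ EventuallyEq.rfl
  filter_upwards [mem_inf_of_right (mem_principal_self _)] with q hq
  rw [blowUpRatio_eq Φ k u₀ hq]
  ring

theorem tendsto_blowUpRatio (h : IsTangentToIdentityOfOrder Φ k) (u₀ : Others j → ℂ) :
    Tendsto (blowUpRatio Φ u₀) (puncturedZero j) (𝓝 1) := by
  have hk := h.one_le
  have h0 : Tendsto (fun q : ℂ × (Others j → ℂ) => ‖q.1‖ ^ k * (‖q.1‖ + ‖q.2‖)) (𝓝 0) (𝓝 0) := by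
    have : Continuous (fun q : ℂ × (Others j → ℂ) => ‖q.1‖ ^ k * (‖q.1‖ + ‖q.2‖)) := by fun_prop
    simpa using this.tendsto 0
  have h1 := (isBigO_blowUpRatio h u₀).trans_tendsto (h0.mono_left inf_le_left)
  have h2 : Tendsto (fun q : ℂ × (Others j → ℂ) => 1 + homPart Φ (k + 1) (affinePoint j u₀) j * q.1 ^ k) (𝓝 0) (𝓝 1) := by
    have : Continuous (fun q : ℂ × (Others j → ℂ) => 1 + homPart Φ (k + 1) (affinePoint j u₀) j * q.1 ^ k) := by fun_prop
    simpa [show k ≠ 0 by omega] using this.tendsto 0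
  have h3 := h1.add (h2.mono_left inf_le_left)
  rw [zero_add] at h3
  exact h3.congr (fun q => by ring)

/-- With `m` the ratio, the displacement `t' - t` equals `m⁻¹ (x^k r(u₀ + t) + ρ)` exactly, where `ρ
= O(|x|^(k+1))` collects the Taylor remainders. As `r(u₀) = 0`, linearising `r` costs only `|t|²`.
-/
theorem isBigO_blowUpSlope (h : IsTangentToIdentityOfOrder Φ k) {u₀ : Others j → ℂ}
    (hu₀ : charMap (homPart Φ (k + 1)) j u₀ = 0) :
    (fun q => blowUpSlope Φ u₀ q - q.2
        - q.1 ^ k • fderiv ℂ (charMap (homPart Φ (k + 1)) j) u₀ q.2)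
      =O[puncturedZero j] (fun q => ‖q.1‖ ^ k * (‖q.1‖ + ‖q.2‖ ^ 2)) := by
  set r := charMap (homPart Φ (k + 1)) j
  set B := fderiv ℂ r u₀
  set l := puncturedZero j
  have hk := h.one_le
  have hm := tendsto_blowUpRatio h u₀
  have hm1 : (fun q => (blowUpRatio Φ u₀ q)⁻¹) =O[l] (fun _ => (1 : ℝ)) :=
    (hm.inv₀ one_ne_zero).isBigO_one ℝ
  have hx1 : ∀ᶠ q : ℂ × (Others j → ℂ) in l, ‖q.1‖ ≤ 1 ∧ ‖q.2‖ ≤ 1 := by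
    refine Eventually.filter_mono inf_le_left ?_
    filter_upwards [Metric.ball_mem_nhds (0 : ℂ × (Others j → ℂ)) one_pos] with q hq
    rw [mem_ball_zero_iff] at hq
    exact ⟨(norm_fst_le q).trans hq.le, (norm_snd_le q).trans hq.le⟩
  have hmm : (fun q => (blowUpRatio Φ u₀ q)⁻¹ - 1) =O[l] (fun q => ‖q.1‖ ^ k) := by
    have h1 : (fun q => blowUpRatio Φ u₀ q - 1) =O[l] (fun q => ‖q.1‖ ^ k) := by
      have e1 : (fun q : ℂ × (Others j → ℂ) => ‖q.1‖ ^ k * (‖q.1‖ + ‖q.2‖)) =O[l] (fun q => ‖q.1‖ ^ k) :=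
        IsBigO.of_bound 2 (by
          filter_upwards [hx1] with q hq
          rw [Real.norm_of_nonneg (by positivity), Real.norm_of_nonneg (by positivity), mul_comm]
          gcongr
          linarith [hq.1, hq.2])
      have e2 : (fun q : ℂ × (Others j → ℂ) => homPart Φ (k + 1) (affinePoint j u₀) j * q.1 ^ k)
          =O[l] (fun q => ‖q.1‖ ^ k) :=
        IsBigO.const_mul_left (IsBigO.of_bound 1 (Eventually.of_forall fun q => by simp)) _
      exact (((isBigO_blowUpRatio h u₀).trans e1).add e2).congr_left (fun q => by ring)
    have h2 := (h1.mul hm1).neg_left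
    refine (h2.congr' ?_ EventuallyEq.rfl).congr_right (fun q => by ring)
    filter_upwards [hm.eventually_ne one_ne_zero] with q hq
    field_simp
    ring
  have hr : (fun q : ℂ × (Others j → ℂ) => r (u₀ + q.2) - B q.2) =O[l] (fun q => ‖q.2‖ ^ 2) := by
    have := ((charMap_analyticAt (j := j) Φ (k + 1) u₀).isBigO_sub_fderiv.comp_tendsto
      (continuous_snd.tendsto (0 : ℂ × (Others j → ℂ)))).mono (inf_le_left : l ≤ _)
    refine this.congr_left (fun q => ?_)
    simp only [Function.comp]
    rw [show charMap (homPart Φ (k + 1)) j u₀ = 0 from hu₀, sub_zero]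
  have hR := isBigO_blowUpRemainder h u₀
  set ρ : ℂ × (Others j → ℂ) → Others j → ℂ := fun q i =>
    blowUpRemainder Φ k u₀ q i.1 - (u₀ i + q.2 i) * blowUpRemainder Φ k u₀ q j
  have hρ : ρ =O[l] (fun q => ‖q.1‖ ^ (k + 1)) := by
    rw [isBigO_pi]
    intro i
    have e1 : (fun q : ℂ × (Others j → ℂ) => u₀ i + q.2 i) =O[l] (fun _ => (1 : ℝ)) :=
      ((((continuous_const.add ((continuous_apply i).comp continuous_snd)).tendsto
        (0 : ℂ × (Others j → ℂ))).mono_left (inf_le_left : l ≤ _)).isBigO_one ℝ)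
    exact (isBigO_apply hR i.1).sub ((e1.mul (isBigO_apply hR j)).congr_right (fun q => by ring))
  have hBt : (fun q : ℂ × (Others j → ℂ) => B q.2) =O[l] (fun _ => (1 : ℝ)) :=
    (((B.continuous.comp continuous_snd).tendsto (0 : ℂ × (Others j → ℂ))).mono_left
      (inf_le_left : l ≤ _)).isBigO_one ℝ
  have hxk : (fun q : ℂ × (Others j → ℂ) => q.1 ^ k) =O[l] (fun q => ‖q.1‖ ^ k) :=
    IsBigO.of_bound 1 (Eventually.of_forall fun q => by simp)
  -- The three errors: `t1` linearises `r`; `t2` replaces `m⁻¹` by `1`, at the cost `|x|^(2k) ≤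
  -- |x|^(k+1)` since `k ≥ 1`; `t3` is the Taylor remainder.
  set g : ℂ × (Others j → ℂ) → ℝ := fun q => ‖q.1‖ ^ k * (‖q.1‖ + ‖q.2‖ ^ 2)
  have t1 : (fun q => (blowUpRatio Φ u₀ q)⁻¹ • q.1 ^ k • (r (u₀ + q.2) - B q.2)) =O[l] g := by
    refine (hm1.smul (hxk.smul hr)).trans (IsBigO.of_bound 1 (Eventually.of_forall fun q => ?_))
    simp only [g, smul_eq_mul, one_mul]
    rw [Real.norm_of_nonneg (by positivity), Real.norm_of_nonneg (by positivity)]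
    gcongr
    exact le_add_of_nonneg_left (norm_nonneg _)
  have hkx : (fun q : ℂ × (Others j → ℂ) => ‖q.1‖ ^ (k + 1)) =O[l] g := by
    refine IsBigO.of_bound 1 (Eventually.of_forall fun q => ?_)
    simp only [g, one_mul]
    rw [Real.norm_of_nonneg (by positivity), Real.norm_of_nonneg (by positivity), pow_succ]
    gcongr
    exact le_add_of_nonneg_right (by positivity)
  have t2 : (fun q => ((blowUpRatio Φ u₀ q)⁻¹ - 1) • q.1 ^ k • B q.2) =O[l] g := by
    refine ((hmm.smul (hxk.smul hBt)).trans (IsBigO.of_bound 1 ?_)).trans hkx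
    filter_upwards [hx1] with q hq
    simp only [smul_eq_mul, one_mul, mul_one]
    rw [Real.norm_of_nonneg (by positivity), Real.norm_of_nonneg (by positivity), pow_succ]
    gcongr
    exact pow_le_of_le_one (norm_nonneg _) hq.1 (by omega)
  have t3 : (fun q => (blowUpRatio Φ u₀ q)⁻¹ • ρ q) =O[l] g :=
    ((hm1.smul hρ).congr_right (fun q => by simp)).trans hkx
  refine ((t1.add t2).add t3).congr' ?_ EventuallyEq.rfl
  filter_upwards [mem_inf_of_right (mem_principal_self _), hm.eventually_ne one_ne_zero] with q hq hmq
  have hq' : q.1 ≠ 0 := hq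
  ext i
  have e1 : Φ (blowUp u₀ q) j = q.1 * blowUpRatio Φ u₀ q := by
    unfold blowUpRatio; field_simp
  have e2 : Φ (blowUp u₀ q) i.1 = q.1 * (u₀ i + q.2 i +
      q.1 ^ k * homPart Φ (k + 1) (affinePoint j (u₀ + q.2)) i.1 + blowUpRemainder Φ k u₀ q i.1) := by
    rw [apply_eq_of_blowUp Φ k u₀ hq']
    simp only [PiLp.smul_apply, PiLp.add_apply, affinePoint_others, smul_eq_mul, Pi.add_apply]
  have e3 := blowUpRatio_eq Φ k u₀ hq'
  simp only [Pi.add_apply, Pi.sub_apply, Pi.smul_apply, smul_eq_mul, blowUpSlope, ρ, r, charMap]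
  rw [e1, e2]
  set m := blowUpRatio Φ u₀ q
  set b := (B q.2) i
  have e4 : q.1 * (u₀ i + q.2 i +
      q.1 ^ k * homPart Φ (k + 1) (affinePoint j (u₀ + q.2)) i.1 + blowUpRemainder Φ k u₀ q i.1) / (q.1 * m)
      = m⁻¹ * (u₀ i + q.2 i +
      q.1 ^ k * homPart Φ (k + 1) (affinePoint j (u₀ + q.2)) i.1 + blowUpRemainder Φ k u₀ q i.1) := by
    field_simp
  have e5 : m⁻¹ * m = 1 := inv_mul_cancel₀ hmq
  rw [e4]
  linear_combination (-(u₀ i + q.2 i)) * e5 + m⁻¹ * (u₀ i + q.2 i) * e3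

end blowUp

/-! ### Orders of decay at infinity. -/

section decay
variable {E : Type*} [NormedAddCommGroup E]

/-- The filter of points `(w, s)` with `w` near infinity and `s` in the unit ball. -/
noncomputable def atInfinity (E : Type*) [NormedAddCommGroup E] : Filter (ℂ × E) :=
  comap (fun q => ‖q.1‖) atTop ⊓ 𝓟 {q | ‖q.2‖ < 1}

/-- The function `‖w‖ ^ (-b)`. -/
noncomputable def decay (b : ℝ) (q : ℂ × E) : ℝ := ‖q.1‖ ^ (-b)

theorem tendsto_norm_fst_atInfinity : Tendsto (fun q : ℂ × E => ‖q.1‖) (atInfinity E) atTop :=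
  tendsto_comap.mono_left inf_le_left

theorem eventually_atInfinity_iff {r : ℂ × E → Prop} :
    (∀ᶠ q in atInfinity E, r q) ↔ ∃ R : ℝ, ∀ q : ℂ × E, R ≤ ‖q.1‖ → ‖q.2‖ < 1 → r q := by
  rw [atInfinity, eventually_inf_principal, eventually_comap]
  simp only [eventually_atTop]
  exact ⟨fun ⟨R, h⟩ => ⟨R, fun q h1 h2 => h _ h1 q rfl h2⟩,
    fun ⟨R, h⟩ => ⟨R, fun b hb q hq h2 => h q (hq ▸ hb) h2⟩⟩

theorem eventually_norm_snd_lt : ∀ᶠ q in atInfinity E, ‖q.2‖ < 1 :=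
  mem_inf_of_right (mem_principal_self _)

theorem eventually_one_le_norm_fst : ∀ᶠ q in atInfinity E, 1 ≤ ‖q.1‖ :=
  tendsto_norm_fst_atInfinity.eventually_ge_atTop 1

theorem eventually_fst_ne_zero : ∀ᶠ q in atInfinity E, q.1 ≠ 0 := by
  filter_upwards [eventually_one_le_norm_fst] with q hq
  exact norm_pos_iff.1 (by linarith)

theorem decay_isBigO {b b' : ℝ} (h : b ≤ b') : decay b' =O[atInfinity E] decay b := by
  refine IsBigO.of_bound 1 ?_
  filter_upwards [eventually_one_le_norm_fst] with q hq
  rw [one_mul, decay, decay, Real.norm_of_nonneg (by positivity), Real.norm_of_nonneg (by positivity)]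
  exact Real.rpow_le_rpow_of_exponent_le hq (by linarith)

theorem decay_mul (b b' : ℝ) :
    (fun q : ℂ × E => decay b q * decay b' q) =ᶠ[atInfinity E] decay (b + b') := by
  filter_upwards [eventually_one_le_norm_fst] with q hq
  rw [decay, decay, decay, ← Real.rpow_add (by linarith)]
  ring_nf

theorem tendsto_decay {b : ℝ} (hb : 0 < b) : Tendsto (decay b) (atInfinity E) (𝓝 0) :=
  (tendsto_rpow_neg_atTop hb).comp tendsto_norm_fst_atInfinity

theorem isBigO_smul_decay {F : Type*} [NormedAddCommGroup F] [NormedSpace ℂ F] {f : ℂ × E → ℂ}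
    {g : ℂ × E → F} {b b' c : ℝ} (hf : f =O[atInfinity E] decay b) (hg : g =O[atInfinity E] decay b')
    (h : c ≤ b + b') : (fun q => f q • g q) =O[atInfinity E] decay c :=
  ((hf.smul hg).trans_eventuallyEq (decay_mul b b')).trans (decay_isBigO h)

theorem isBigO_cpow (b : ℝ) : (fun q : ℂ × E => q.1 ^ (b : ℂ)) =O[atInfinity E] decay (-b) := by
  refine IsBigO.of_bound 1 ?_
  filter_upwards [eventually_fst_ne_zero] with q hq
  rw [one_mul, norm_cpow_ofReal hq, decay, neg_neg, Real.norm_of_nonneg (by positivity)]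

theorem isBigO_inv : (fun q : ℂ × E => q.1⁻¹) =O[atInfinity E] decay 1 := by
  refine IsBigO.of_bound 1 (Eventually.of_forall fun q => ?_)
  rw [one_mul, decay, Real.rpow_neg_one, norm_inv, norm_inv, norm_norm]

theorem isBigO_snd : (fun q : ℂ × E => q.2) =O[atInfinity E] decay 0 := by
  refine IsBigO.of_bound 1 ?_
  filter_upwards [eventually_norm_snd_lt] with q hq
  simpa [decay] using hq.le

/-- If `M = 1 - 1 / (k w) + O(‖w‖ ^ (-(1 + a)))`, then
`exp (- b k log M) = 1 + b / w + O(‖w‖ ^ (-(1 + a)))`. -/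
theorem isBigO_exp_log {M : ℂ × E → ℂ} {k a : ℝ} (hk : k ≠ 0) (ha : 0 < a) (ha1 : a ≤ 1)
    (hM : (fun q => M q - 1 + (k * q.1 : ℂ)⁻¹) =O[atInfinity E] decay (1 + a)) (b : ℝ) :
    (fun q => -(b * k : ℂ) * Complex.log (M q)) =O[atInfinity E] decay 1 ∧
    (fun q => Complex.exp (-(b * k : ℂ) * Complex.log (M q)) - 1 - b * q.1⁻¹)
      =O[atInfinity E] decay (1 + a) := by
  have h1 : (fun q => M q - 1) =O[atInfinity E] decay 1 := by
    have e : (fun q : ℂ × E => (k * q.1 : ℂ)⁻¹) =O[atInfinity E] decay 1 :=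
      (isBigO_inv.const_mul_left (k : ℂ)⁻¹).congr_left (fun q => by rw [mul_inv])
    exact ((hM.trans (decay_isBigO (by linarith))).sub e).congr_left (fun q => by ring)
  have h1t : Tendsto (fun q => M q - 1) (atInfinity E) (𝓝 0) := h1.trans_tendsto (tendsto_decay one_pos)
  have hlog : (fun q => Complex.log (M q) - (M q - 1)) =O[atInfinity E] decay (1 + a) := by
    have e : (fun z : ℂ => Complex.log (1 + z) - z) =O[𝓝 0] (fun z => z ^ 2) := by
      refine IsBigO.of_bound 1 ?_
      filter_upwards [Metric.ball_mem_nhds (0 : ℂ) (by norm_num : (0 : ℝ) < 1 / 2)] with z hz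
      rw [mem_ball_zero_iff] at hz
      have := Complex.norm_log_one_add_sub_self_le (show ‖z‖ < 1 by linarith)
      rw [one_mul, norm_pow]
      refine this.trans ?_
      have h2 : (1 - ‖z‖)⁻¹ ≤ 2 := by
        rw [inv_le_comm₀ (by linarith) (by norm_num)]
        linarith
      nlinarith [sq_nonneg ‖z‖]
    refine ((e.comp_tendsto h1t).congr_left (fun q => ?_)).trans ?_
    · simp only [Function.comp]
      congr 2
      ring
    · refine ((isBigO_smul_decay h1 h1 (c := 1 + a) (by linarith))).congr_left (fun q => ?_)
      simp [pow_two]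
  have hE : (fun q => -(b * k : ℂ) * Complex.log (M q)) =O[atInfinity E] decay 1 := by
    refine IsBigO.const_mul_left ?_ _
    exact ((hlog.trans (decay_isBigO (by linarith))).add h1).congr_left (fun q => by ring)
  refine ⟨hE, ?_⟩
  have hEt := hE.trans_tendsto (tendsto_decay one_pos)
  have hexp : (fun q => Complex.exp (-(b * k : ℂ) * Complex.log (M q)) - 1
      - -(b * k : ℂ) * Complex.log (M q)) =O[atInfinity E] decay (1 + a) := by
    have e : (fun z : ℂ => Complex.exp z - 1 - z) =O[𝓝 0] (fun z => z ^ 2) := by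
      refine IsBigO.of_bound 1 ?_
      filter_upwards [Metric.ball_mem_nhds (0 : ℂ) one_pos] with z hz
      rw [mem_ball_zero_iff] at hz
      rw [one_mul, norm_pow]
      exact Complex.norm_exp_sub_one_sub_id_le hz.le
    refine (e.comp_tendsto hEt).trans ?_
    refine ((isBigO_smul_decay hE hE (c := 1 + a) (by linarith))).congr_left (fun q => ?_)
    simp only [Function.comp, smul_eq_mul]
    ring
  have hk' : (k : ℂ) ≠ 0 := by exact_mod_cast hk
  refine (hexp.add ((hlog.add hM).const_mul_left (-(b * k : ℂ)))).congr_left (fun q => ?_)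
  rw [mul_inv]
  field_simp
  ring

end decay

/-! ### The germ in the coordinates `(w, s)` at infinity. -/

section wedgeCoordinates
variable {p : ℕ} {j : Fin p} {d l : ℕ}

/-- The coordinate `x = w ^ (-1/k)`. -/
noncomputable def rootCoord (k : ℕ) (w : ℂ) : ℂ := w ^ ((-(1 / k : ℝ) : ℝ) : ℂ)

theorem rootCoord_pow {k : ℕ} (hk : 1 ≤ k) (w : ℂ) : rootCoord k w ^ k = w⁻¹ := by
  have : (k : ℂ) ≠ 0 := by exact_mod_cast (by omega : k ≠ 0)
  rw [rootCoord, ← Complex.cpow_mul_nat]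
  push_cast
  rw [neg_mul, one_div, inv_mul_cancel₀ this, Complex.cpow_neg_one]

theorem rootCoord_ne_zero {k : ℕ} {w : ℂ} (hw : w ≠ 0) : rootCoord k w ≠ 0 := by
  simp [rootCoord, Complex.cpow_eq_zero_iff, hw]

/-- The blow-up coordinates `(x, t) = (c w ^ (-1/k), w ^ (-a) L⁻¹ s)` of the point `(w, s)`. -/
noncomputable def toBlowUp (k : ℕ) (c : ℂ) (a : ℝ) (L : (Others j → ℂ) ≃L[ℂ] Cn d × Cn l)
    (q : ℂ × (Cn d × Cn l)) : ℂ × (Others j → ℂ) :=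
  (c * rootCoord k q.1, q.1 ^ ((-a : ℝ) : ℂ) • L.symm q.2)

/-- The map `Φ` in the coordinates `(w, s)`. -/
noncomputable def wedgeMap (Φ : Cn p → Cn p) (u₀ : Others j → ℂ) (k : ℕ) (c : ℂ) (a : ℝ)
    (L : (Others j → ℂ) ≃L[ℂ] Cn d × Cn l) (q : ℂ × (Cn d × Cn l)) : ℂ × (Cn d × Cn l) :=
  (q.1 * Complex.exp (-((1 : ℝ) * k : ℂ) * Complex.log (blowUpRatio Φ u₀ (toBlowUp k c a L q))),
    (q.1 ^ (a : ℂ) *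
      Complex.exp (-(a * k : ℂ) * Complex.log (blowUpRatio Φ u₀ (toBlowUp k c a L q)))) •
      L (blowUpSlope Φ u₀ (toBlowUp k c a L q)))

variable {Φ : Cn p → Cn p} {u₀ : Others j → ℂ} {k : ℕ} {c : ℂ} {a : ℝ}
  {L : (Others j → ℂ) ≃L[ℂ] Cn d × Cn l}

theorem isBigO_toBlowUp_fst (hak : 2 * a ≤ 1 / k) :
    (fun q => (toBlowUp k c a L q).1) =O[atInfinity (Cn d × Cn l)] decay (2 * a) := by
  refine IsBigO.const_mul_left ((isBigO_cpow _).trans (decay_isBigO ?_)) c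
  rw [neg_neg]
  exact hak

theorem isBigO_toBlowUp_snd :
    (fun q => (toBlowUp k c a L q).2) =O[atInfinity (Cn d × Cn l)] decay a :=
  isBigO_smul_decay (isBigO_cpow _)
    (((L.symm : (Cn d × Cn l) →L[ℂ] (Others j → ℂ)).isBigO_comp _ _).trans isBigO_snd) (by linarith)

theorem isBigO_toBlowUp_fst_pow (hk : 1 ≤ k) :
    (fun q => (toBlowUp k c a L q).1 ^ k) =O[atInfinity (Cn d × Cn l)] decay 1 := by
  refine (isBigO_inv.const_mul_left (c ^ k)).congr_left (fun q => ?_)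
  simp only [toBlowUp]
  rw [mul_pow, rootCoord_pow hk]

theorem tendsto_toBlowUp (hc : c ≠ 0) (ha : 0 < a) (hak : 2 * a ≤ 1 / k) :
    Tendsto (toBlowUp k c a L) (atInfinity (Cn d × Cn l)) (puncturedZero j) := by
  refine tendsto_inf.2 ⟨?_, tendsto_principal.2 ?_⟩
  · have h1 := (isBigO_toBlowUp_fst (c := c) (L := L) hak).trans_tendsto
      (tendsto_decay (by linarith : 0 < 2 * a))
    have h2 := (isBigO_toBlowUp_snd (k := k) (c := c) (L := L)).trans_tendsto (tendsto_decay ha)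
    exact h1.prodMk_nhds h2
  · filter_upwards [eventually_fst_ne_zero] with q hq
    exact mul_ne_zero hc (rootCoord_ne_zero hq)

/-- The normalisation of `c` turns the leading term `p x^k` into `-1 / (k w)`. The error `|x|^k (|x|
+ |t|)` is governed by `|t| = O(|w|^(-a))`, since `2 a ≤ 1/k` makes `x` smaller. -/
theorem isBigO_ratio (h : IsTangentToIdentityOfOrder Φ k) (hc : c ≠ 0) (ha : 0 < a)
    (hak : 2 * a ≤ 1 / k) (hck : c ^ k * (k * homPart Φ (k + 1) (affinePoint j u₀) j) = -1) :
    (fun q => blowUpRatio Φ u₀ (toBlowUp k c a L q) - 1 + ((k : ℝ) * q.1 : ℂ)⁻¹)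
      =O[atInfinity (Cn d × Cn l)] decay (1 + a) := by
  have hk := h.one_le
  have h1 := (isBigO_blowUpRatio h u₀).comp_tendsto (tendsto_toBlowUp (L := L) hc ha hak)
  have h2 : (fun q => ‖(toBlowUp k c a L q).1‖ ^ k * (‖(toBlowUp k c a L q).1‖ + ‖(toBlowUp k c a L q).2‖))
      =O[atInfinity (Cn d × Cn l)] decay (1 + a) := by
    refine IsBigO.trans ?_ ((decay_mul 1 a).isBigO)
    refine ((isBigO_toBlowUp_fst_pow hk).norm_left.congr_left (fun q => norm_pow _ _)).mul ?_
    exact ((isBigO_toBlowUp_fst hak).trans (decay_isBigO (by linarith))).norm_left.add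
      isBigO_toBlowUp_snd.norm_left
  refine (h1.trans h2).congr' ?_ EventuallyEq.rfl
  filter_upwards [eventually_fst_ne_zero] with q hq
  have hk0 : (k : ℂ) ≠ 0 := by exact_mod_cast (by omega : k ≠ 0)
  have e : homPart Φ (k + 1) (affinePoint j u₀) j * (toBlowUp k c a L q).1 ^ k = -((k : ℝ) * q.1 : ℂ)⁻¹ := by
    simp only [toBlowUp]
    rw [mul_pow, rootCoord_pow hk]
    push_cast
    field_simp
    linear_combination hck
  simp only [Function.comp]
  rw [e]
  ring

/-- The new `w` is `w m^(-k) = w + 1 + ...`. In the new `s`, the factor `w'^a = w^a (1 + a / w +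
...)` adds `(a / w) s` to the linear term `-w⁻¹ T s`, and this is what shifts the spectrum by `a`.
-/
theorem isHyperbolic_estimates (h : IsTangentToIdentityOfOrder Φ k) (hc : c ≠ 0) (ha : 0 < a)
    (hak : 2 * a ≤ 1 / k) (hck : c ^ k * (k * homPart Φ (k + 1) (affinePoint j u₀) j) = -1)
    (hu₀ : charMap (homPart Φ (k + 1)) j u₀ = 0) (T : Module.End ℂ (Others j → ℂ))
    (hT : ∀ t, fderiv ℂ (charMap (homPart Φ (k + 1)) j) u₀ t =
      (k * homPart Φ (k + 1) (affinePoint j u₀) j) • T t) :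
    (fun q => (wedgeMap Φ u₀ k c a L q).1 - q.1 - 1) =O[atInfinity (Cn d × Cn l)] decay a ∧
    (fun q => (wedgeMap Φ u₀ k c a L q).2 - (q.2 - q.1⁻¹ • (L (T (L.symm q.2)) - (a : ℂ) • q.2)))
      =O[atInfinity (Cn d × Cn l)] decay (1 + a) := by
  have hk := h.one_le
  have hk0 : (k : ℝ) ≠ 0 := by exact_mod_cast (by omega : k ≠ 0)
  have ha1 : a ≤ 1 := by
    have : (1 : ℝ) / k ≤ 1 := by
      rw [div_le_one (by positivity)]; exact_mod_cast hk
    linarith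
  have hM := isBigO_ratio (L := L) h hc ha hak hck
  set M : ℂ × (Cn d × Cn l) → ℂ := fun q => blowUpRatio Φ u₀ (toBlowUp k c a L q) with hMdef
  constructor
  · have h1 := (isBigO_exp_log hk0 ha ha1 hM 1).2
    have h2 : (fun q : ℂ × (Cn d × Cn l) => q.1) =O[atInfinity (Cn d × Cn l)] decay (-1) := by
      simpa using isBigO_cpow (E := Cn d × Cn l) 1
    refine (isBigO_smul_decay h2 h1 (c := a) (by linarith)).congr' ?_ EventuallyEq.rfl
    filter_upwards [eventually_fst_ne_zero] with q hq
    simp only [wedgeMap, smul_eq_mul]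
    push_cast
    field_simp
  · have hE := (isBigO_exp_log hk0 ha ha1 hM a).2
    set E : ℂ × (Cn d × Cn l) → ℂ := fun q => Complex.exp (-(a * (k : ℝ) : ℂ) * Complex.log (M q)) with hEdef
    set B := fderiv ℂ (charMap (homPart Φ (k + 1)) j) u₀
    set err : ℂ × (Cn d × Cn l) → Others j → ℂ := fun q => blowUpSlope Φ u₀ (toBlowUp k c a L q)
      - (toBlowUp k c a L q).2 - (toBlowUp k c a L q).1 ^ k • B (toBlowUp k c a L q).2 with herr
    -- Here `2 a ≤ 1/k` is needed in full: both `|x|` and `|t|²` are `O(|w|^(-2a))`. Multiplication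
    -- by `w^a` then leaves the order `1 + a`.
    have herr1 : err =O[atInfinity (Cn d × Cn l)] decay (1 + 2 * a) := by
      refine ((isBigO_blowUpSlope h hu₀).comp_tendsto (tendsto_toBlowUp (L := L) hc ha hak)).trans ?_
      refine IsBigO.trans ?_ ((decay_mul 1 (2 * a)).isBigO)
      refine ((isBigO_toBlowUp_fst_pow hk).norm_left.congr_left (fun q => norm_pow _ _)).mul ?_
      refine (isBigO_toBlowUp_fst hak).norm_left.add ?_
      have := (isBigO_toBlowUp_snd (L := L) (k := k) (c := c) (a := a)).norm_left
      refine ((this.mul this).trans ?_).congr_left (fun q => (pow_two _).symm)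
      refine (decay_mul a a).isBigO.trans (decay_isBigO (by linarith))
    set η : ℂ × (Cn d × Cn l) → Cn d × Cn l := fun q => q.1 ^ (a : ℂ) • L (err q)
    have hη : η =O[atInfinity (Cn d × Cn l)] decay (1 + a) :=
      isBigO_smul_decay (isBigO_cpow a)
        (((L : (Others j → ℂ) →L[ℂ] Cn d × Cn l).isBigO_comp _ _).trans herr1) (by linarith)
    set T' : (Cn d × Cn l) →L[ℂ] (Cn d × Cn l) :=
      (L : (Others j → ℂ) →L[ℂ] Cn d × Cn l) ∘L LinearMap.toContinuousLinearMap (T : (Others j → ℂ) →ₗ[ℂ] (Others j → ℂ)) ∘L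
        (L.symm : (Cn d × Cn l) →L[ℂ] (Others j → ℂ)) with hT'
    have hAs : (fun q : ℂ × (Cn d × Cn l) => T' q.2) =O[atInfinity (Cn d × Cn l)] decay 0 :=
      (T'.isBigO_comp _ _).trans isBigO_snd
    set σ : ℂ × (Cn d × Cn l) → Cn d × Cn l := fun q => q.2 - q.1⁻¹ • T' q.2 + η q
    have hσs : (fun q => σ q - q.2) =O[atInfinity (Cn d × Cn l)] decay 1 :=
      ((isBigO_smul_decay isBigO_inv hAs (c := 1) (by linarith)).neg_left.add
        (hη.trans (decay_isBigO (by linarith)))).congr_left (fun q => by simp only [σ]; abel)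
    have hσ : σ =O[atInfinity (Cn d × Cn l)] decay 0 :=
      ((hσs.trans (decay_isBigO (by linarith))).add isBigO_snd).congr_left (fun q => by simp)
    have f1 := isBigO_smul_decay hE hσ (c := 1 + a) (by linarith)
    have f2 := isBigO_smul_decay (isBigO_inv.const_mul_left (a : ℂ)) hσs (c := 1 + a) (by linarith)
    refine ((f1.add hη).add f2).congr' ?_ EventuallyEq.rfl
    filter_upwards [eventually_fst_ne_zero] with q hq
    have hqa : q.1 ^ (a : ℂ) * q.1 ^ ((-a : ℝ) : ℂ) = 1 := by
      rw [← Complex.cpow_add _ _ hq]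
      push_cast
      rw [add_neg_cancel, Complex.cpow_zero]
    have hxk : (toBlowUp k c a L q).1 ^ k * (k * homPart Φ (k + 1) (affinePoint j u₀) j) = -q.1⁻¹ := by
      simp only [toBlowUp]
      rw [mul_pow, rootCoord_pow hk]
      linear_combination q.1⁻¹ * hck
    have key : q.1 ^ (a : ℂ) • L (blowUpSlope Φ u₀ (toBlowUp k c a L q)) = σ q := by
      have e1 : blowUpSlope Φ u₀ (toBlowUp k c a L q) = (toBlowUp k c a L q).2
          + (toBlowUp k c a L q).1 ^ k • B (toBlowUp k c a L q).2 + err q := by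
        simp only [herr]; abel
      have e2 : (toBlowUp k c a L q).1 ^ k • B (toBlowUp k c a L q).2 =
          -q.1⁻¹ • q.1 ^ ((-a : ℝ) : ℂ) • T (L.symm q.2) := by
        rw [hT, smul_smul, hxk]
        simp only [toBlowUp, map_smul]
      rw [e1, e2, map_add, map_add, smul_add, smul_add]
      simp only [σ, η, toBlowUp, map_smul, L.apply_symm_apply]
      congr 1
      rw [smul_smul, hqa, one_smul, smul_comm (q.1 ^ (a : ℂ)), smul_smul (q.1 ^ (a : ℂ)), hqa, one_smul,
        neg_smul, ← sub_eq_add_neg]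
      rfl
    have hwm : (wedgeMap Φ u₀ k c a L q).2 = E q • σ q := by
      rw [← key, smul_smul, mul_comm (E q)]
      simp only [wedgeMap, hEdef, hMdef]
      push_cast
      rfl
    have hTs : L (T (L.symm q.2)) = T' q.2 := rfl
    rw [hwm, hTs]
    have : σ q = q.2 - q.1⁻¹ • T' q.2 + η q := rfl
    have hη' : η q = σ q - q.2 + q.1⁻¹ • T' q.2 := by rw [this]; abel
    rw [hη']
    module

/-- The formulas of `wedgeMap` use `exp` of multiples of `log m`, so that everything reduces to the
identity `log w' = log w - k log m`; all powers of `w'` then come out with the right branch. -/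
theorem eventually_conjugate (h : IsTangentToIdentityOfOrder Φ k) (hc : c ≠ 0) (ha : 0 < a)
    (hak : 2 * a ≤ 1 / k) (hck : c ^ k * (k * homPart Φ (k + 1) (affinePoint j u₀) j) = -1) :
    ∀ᶠ q in atInfinity (Cn d × Cn l), 0 < q.1.re →
      blowUp u₀ (toBlowUp k c a L (wedgeMap Φ u₀ k c a L q)) = Φ (blowUp u₀ (toBlowUp k c a L q)) := by
  have hk := h.one_le
  have hk0 : (k : ℝ) ≠ 0 := by exact_mod_cast (by omega : k ≠ 0)
  have hk0' : (k : ℂ) ≠ 0 := by exact_mod_cast (by omega : k ≠ 0)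
  have ha1 : a ≤ 1 := by
    have : (1 : ℝ) / k ≤ 1 := by
      rw [div_le_one (by positivity)]; exact_mod_cast hk
    linarith
  have hM := isBigO_ratio (L := L) h hc ha hak hck
  have hE := (isBigO_exp_log hk0 ha ha1 hM 1).1.trans_tendsto (tendsto_decay one_pos)
  have hm := (tendsto_blowUpRatio h u₀).comp (tendsto_toBlowUp (L := L) hc ha hak)
  filter_upwards [eventually_fst_ne_zero, hE.eventually (Metric.ball_mem_nhds 0 one_pos),
    hm.eventually_ne one_ne_zero] with q hq0 hE1 hm0 hre
  set m := blowUpRatio Φ u₀ (toBlowUp k c a L q) with hmdef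
  have hm0' : m ≠ 0 := hm0
  set lam := Complex.log m with hlam
  rw [dist_zero_right] at hE1
  have hlog : Complex.log (wedgeMap Φ u₀ k c a L q).1 = Complex.log q.1 - k * lam := by
    have e : (wedgeMap Φ u₀ k c a L q).1 = Complex.exp (Complex.log q.1 - k * lam) := by
      simp only [wedgeMap, ← hmdef, ← hlam]
      rw [sub_eq_add_neg, Complex.exp_add, Complex.exp_log hq0]
      push_cast
      ring_nf
    -- No branch is crossed: the argument of `w` is below `π/2` and the correction below `1`, so the
    -- sum remains within `(-π, π)`.
    have him : |((k : ℂ) * lam).im| < 1 := by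
      refine (Complex.abs_im_le_norm _).trans_lt ?_
      push_cast at hE1
      rwa [one_mul, neg_mul, norm_neg] at hE1
    have harg : |(Complex.log q.1).im| < Real.pi / 2 := by
      rw [Complex.log_im]
      exact Complex.abs_arg_lt_pi_div_two_iff.2 (Or.inl hre)
    have hpi := Real.pi_gt_three
    rw [abs_lt] at him harg
    rw [e, Complex.log_exp]
    · rw [Complex.sub_im]; linarith
    · rw [Complex.sub_im]; linarith
  have hw0 : (wedgeMap Φ u₀ k c a L q).1 ≠ 0 := by
    simp only [wedgeMap]
    exact mul_ne_zero hq0 (Complex.exp_ne_zero _)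
  have hcpow : ∀ b : ℝ, (wedgeMap Φ u₀ k c a L q).1 ^ (b : ℂ) =
      q.1 ^ (b : ℂ) * Complex.exp (-(b * k) * lam) := by
    intro b
    rw [Complex.cpow_def_of_ne_zero hw0, hlog, Complex.cpow_def_of_ne_zero hq0, ← Complex.exp_add]
    ring_nf
  have hx : (toBlowUp k c a L (wedgeMap Φ u₀ k c a L q)).1 = (toBlowUp k c a L q).1 * m := by
    simp only [toBlowUp, rootCoord]
    rw [hcpow, mul_assoc, ← Complex.exp_log hm0', ← hlam]
    congr 3
    push_cast
    field_simp
  have ht : (toBlowUp k c a L (wedgeMap Φ u₀ k c a L q)).2 = blowUpSlope Φ u₀ (toBlowUp k c a L q) := by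
    have e2 : (wedgeMap Φ u₀ k c a L q).2 = (wedgeMap Φ u₀ k c a L q).1 ^ (a : ℂ) •
        L (blowUpSlope Φ u₀ (toBlowUp k c a L q)) := by
      rw [hcpow]
      rfl
    have e1 : (toBlowUp k c a L (wedgeMap Φ u₀ k c a L q)).2 =
      (wedgeMap Φ u₀ k c a L q).1 ^ ((-a : ℝ) : ℂ) • L.symm (wedgeMap Φ u₀ k c a L q).2 := rfl
    rw [e1, e2, map_smul, L.symm_apply_apply, smul_smul, ← Complex.cpow_add _ _ hw0]
    push_cast
    rw [neg_add_cancel, Complex.cpow_zero, one_smul]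
  have hpair : toBlowUp k c a L (wedgeMap Φ u₀ k c a L q) =
      ((toBlowUp k c a L q).1 * m, blowUpSlope Φ u₀ (toBlowUp k c a L q)) := Prod.ext hx ht
  rw [hpair]
  exact blowUp_ratio_slope Φ u₀ _ (mul_ne_zero hc (rootCoord_ne_zero hq0)) hm0'

theorem differentiableAt_toBlowUp {q : ℂ × (Cn d × Cn l)} (hq : q.1 ∈ Complex.slitPlane) :
    DifferentiableAt ℂ (toBlowUp k c a L) q := by
  have h1 : ∀ b : ℂ, DifferentiableAt ℂ (fun q : ℂ × (Cn d × Cn l) => q.1 ^ b) q := fun b =>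
    differentiableAt_fst.cpow (differentiableAt_const _) hq
  exact ((h1 _).const_mul c).prodMk ((h1 _).smul
    ((L.symm : (Cn d × Cn l) →L[ℂ] (Others j → ℂ)).differentiableAt.comp q differentiableAt_snd))

theorem differentiable_blowUp (u₀ : Others j → ℂ) : Differentiable ℂ (blowUp u₀) := by
  have : blowUp u₀ = fun q : ℂ × (Others j → ℂ) =>
      q.1 • (affinePoint j u₀ + (includeOthers j).toContinuousLinearMap q.2) := by
    ext1 q
    rw [blowUp, affinePoint_add]
    rfl
  rw [this]
  have h : Differentiable ℂ (fun q : ℂ × (Others j → ℂ) =>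
      (includeOthers j).toContinuousLinearMap q.2) :=
    ((includeOthers j).toContinuousLinearMap.comp
      (ContinuousLinearMap.snd ℂ ℂ (Others j → ℂ))).differentiable
  exact differentiable_fst.smul (h.const_add _)

theorem differentiableAt_div {E : Type*} [NormedAddCommGroup E] [NormedSpace ℂ E] {f g : E → ℂ} {x : E}
    (hf : DifferentiableAt ℂ f x) (hg : DifferentiableAt ℂ g x) (hx : g x ≠ 0) :
    DifferentiableAt ℂ (fun y => f y / g y) x := by
  simp only [div_eq_mul_inv]
  exact hf.fun_mul (hg.fun_inv hx)

theorem eventually_differentiableAt_wedgeMap (h : IsTangentToIdentityOfOrder Φ k) (hc : c ≠ 0)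
    (ha : 0 < a) (hak : 2 * a ≤ 1 / k) :
    ∀ᶠ q in atInfinity (Cn d × Cn l), 0 < q.1.re → DifferentiableAt ℂ (wedgeMap Φ u₀ k c a L) q := by
  have htb := tendsto_toBlowUp (L := L) hc ha hak
  have han : ∀ᶠ q in atInfinity (Cn d × Cn l), AnalyticAt ℂ Φ (blowUp u₀ (toBlowUp k c a L q)) :=
    ((tendsto_blowUp u₀).comp (htb.mono_right inf_le_left)).eventually h.analyticAt.eventually_analyticAt
  have hm := (tendsto_blowUpRatio h u₀).comp htb
  filter_upwards [han, eventually_fst_ne_zero, hm.eventually (Complex.isOpen_slitPlane.mem_nhds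
    (Complex.one_mem_slitPlane)), hm.eventually_ne one_ne_zero] with q hq hq0 hmq hm0 hre
  have hslit : q.1 ∈ Complex.slitPlane := Or.inl hre
  have h1 := differentiableAt_toBlowUp (k := k) (c := c) (a := a) (L := L) hslit
  have h2 : DifferentiableAt ℂ (fun q => Φ (blowUp u₀ (toBlowUp k c a L q))) q :=
    hq.differentiableAt.comp q ((differentiable_blowUp u₀ _).comp q h1)
  have h3 : ∀ i, DifferentiableAt ℂ (fun q => Φ (blowUp u₀ (toBlowUp k c a L q)) i) q := fun i =>
    (EuclideanSpace.proj (𝕜 := ℂ) i : Cn p →L[ℂ] ℂ).differentiableAt.comp q h2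
  have hx0 : (toBlowUp k c a L q).1 ≠ 0 := mul_ne_zero hc (rootCoord_ne_zero hq0)
  have hj0 : Φ (blowUp u₀ (toBlowUp k c a L q)) j ≠ 0 := by
    intro h0
    apply hm0
    simp [blowUpRatio, h0]
  have hden : DifferentiableAt ℂ (fun q => (toBlowUp k c a L q).1) q := h1.fst
  have hratio := differentiableAt_div (h3 j) hden hx0
  have h4 : DifferentiableAt ℂ (fun q => Complex.log (blowUpRatio Φ u₀ (toBlowUp k c a L q))) q :=
    DifferentiableAt.clog (f := fun q => blowUpRatio Φ u₀ (toBlowUp k c a L q)) hratio hmq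
  have h5 : DifferentiableAt ℂ (fun q => blowUpSlope Φ u₀ (toBlowUp k c a L q)) q := by
    rw [differentiableAt_pi]
    exact fun i => (differentiableAt_div (h3 i.1) (h3 j) hj0).sub_const _
  refine (differentiableAt_fst.mul (h4.const_mul _).cexp).prodMk ((DifferentiableAt.mul
    (differentiableAt_fst.cpow (differentiableAt_const _) hslit) (h4.const_mul _).cexp).smul
    ((L : (Others j → ℂ) →L[ℂ] Cn d × Cn l).differentiableAt.comp q h5))

theorem exists_isHyperbolicOnWedge (h : IsTangentToIdentityOfOrder Φ k) (hc : c ≠ 0) (ha : 0 < a)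
    (hak : 2 * a ≤ 1 / k) (hck : c ^ k * (k * homPart Φ (k + 1) (affinePoint j u₀) j) = -1)
    (hu₀ : charMap (homPart Φ (k + 1)) j u₀ = 0) (T : Module.End ℂ (Others j → ℂ))
    (hT : ∀ t, fderiv ℂ (charMap (homPart Φ (k + 1)) j) u₀ t =
      (k * homPart Φ (k + 1) (affinePoint j u₀) j) • T t)
    (P : Cn d →L[ℂ] Cn d) (Q : Cn l →L[ℂ] Cn l)
    (hPQ : ∀ s, L (T (L.symm s)) = (P s.1 + (a : ℂ) • s.1, (a : ℂ) • s.2 - Q s.2)) :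
    ∃ R C, 0 ≤ C ∧ IsHyperbolicOnWedge (wedgeMap Φ u₀ k c a L) P Q a 1 R C ∧
      ∀ q ∈ wedge 1 R ×ˢ Metric.ball (0 : Cn d × Cn l) 1,
      blowUp u₀ (toBlowUp k c a L (wedgeMap Φ u₀ k c a L q)) = Φ (blowUp u₀ (toBlowUp k c a L q)) := by
  obtain ⟨h1, h2⟩ := isHyperbolic_estimates (L := L) h hc ha hak hck hu₀ T hT
  obtain ⟨C₁, hC₁⟩ := h1.bound
  obtain ⟨C₂, hC₂⟩ := h2.bound
  obtain ⟨R, hR⟩ := eventually_atInfinity_iff.1 (hC₁.and (hC₂.and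
    ((eventually_conjugate (L := L) h hc ha hak hck).and
      (eventually_differentiableAt_wedgeMap (u₀ := u₀) (L := L) h hc ha hak))))
  have hq' : ∀ q ∈ wedge 1 R ×ˢ Metric.ball (0 : Cn d × Cn l) 1, 0 < q.1.re ∧ _ := fun q hq =>
    ⟨re_pos_of_mem_wedge hq.1 one_pos, hR q hq.1.2.le (mem_ball_zero_iff.1 hq.2)⟩
  have hsnd : ∀ q ∈ wedge 1 R ×ˢ Metric.ball (0 : Cn d × Cn l) 1,
      ‖(wedgeMap Φ u₀ k c a L q).2 - (q.2.1 - q.1⁻¹ • P q.2.1, q.2.2 + q.1⁻¹ • Q q.2.2)‖ ≤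
      max 0 (max C₁ C₂) * ‖q.1‖ ^ (-(1 + a)) := by
    intro q hq
    have := (hq' q hq).2.2.1
    rw [hPQ, decay, Real.norm_of_nonneg (by positivity)] at this
    refine le_trans (le_of_eq ?_) (this.trans ?_)
    · congr 2
      ext1
      · simp
      · simp
    · gcongr
      exact (le_max_right _ _).trans (le_max_right _ _)
  refine ⟨R, max 0 (max C₁ C₂), le_max_left _ _, ⟨fun q hq => ?_, fun q hq => ?_, fun q hq => ?_,
    fun q hq => ?_⟩, fun q hq => (hq' q hq).2.2.2.1 (hq' q hq).1⟩
  · exact ((hq' q hq).2.2.2.2 (hq' q hq).1).differentiableWithinAt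
  · have := (hq' q hq).2.1
    rw [decay, Real.norm_of_nonneg (by positivity)] at this
    refine this.trans ?_
    gcongr
    exact (le_max_left _ _).trans (le_max_right _ _)
  · exact (norm_fst_le _).trans (hsnd q hq)
  · exact (norm_snd_le _).trans (hsnd q hq)

end wedgeCoordinates

/-! ### Passing between the sector of the `x`-plane and the wedge. -/

section planeSector
variable {k : ℕ} {γ R : ℝ}

/-- The coordinate `w = x ^ (-k)`. -/
noncomputable def invPow (k : ℕ) (x : ℂ) : ℂ := (x ^ k)⁻¹

theorem abs_im_inv_lt_iff {y : ℂ} (hy : y ≠ 0) : |y⁻¹.im| < γ * y⁻¹.re ↔ |y.im| < γ * y.re := by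
  have h := Complex.normSq_pos.2 hy
  rw [Complex.inv_im, Complex.inv_re, abs_div, abs_neg, abs_of_pos h, mul_div_assoc', div_lt_div_iff_of_pos_right h]

theorem ne_zero_of_abs_im_lt {y : ℂ} (hy : |y.im| < γ * y.re) : y ≠ 0 := by
  rintro rfl
  simp at hy

theorem ne_zero_of_mem_planeSector (hk : 1 ≤ k) {s : ℝ} {x : ℂ} (hx : x ∈ planeSector k γ s) : x ≠ 0 := by
  rintro rfl
  exact ne_zero_of_abs_im_lt hx.1 (zero_pow (by omega))

theorem zero_notMem_planeSector (hk : 1 ≤ k) {s : ℝ} : (0 : ℂ) ∉ planeSector k γ s := fun h =>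
  ne_zero_of_mem_planeSector hk h rfl

theorem invPow_mem_wedge (hk : 1 ≤ k) (hR : 0 < R) {x : ℂ} (hx : x ∈ planeSector k γ R⁻¹) :
    invPow k x ∈ wedge γ R := by
  have h0 : x ^ k ≠ 0 := pow_ne_zero _ (ne_zero_of_mem_planeSector hk hx)
  refine ⟨(abs_im_inv_lt_iff h0).2 hx.1, ?_⟩
  rw [invPow, norm_inv]
  exact (lt_inv_comm₀ hR (norm_pos_iff.2 h0)).2 hx.2.1

/-- The condition `|arg x| < π / k` says that `x` is the principal `k`-th root of `x^k`; among the
components of the preimage it selects the one on which the two maps are inverse. -/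
theorem rootCoord_invPow (hk : 1 ≤ k) (hγ : 0 < γ) {s : ℝ} {x : ℂ} (hx : x ∈ planeSector k γ s) :
    rootCoord k (invPow k x) = x := by
  have hre : 0 < (x ^ k).re := pos_of_mul_pos_right ((abs_nonneg _).trans_lt hx.1) hγ.le
  have harg : (x ^ k).arg ≠ Real.pi := by
    intro h
    rw [Complex.arg_eq_pi_iff] at h
    linarith [h.1]
  have h2 := abs_lt.1 hx.2.2
  rw [rootCoord, invPow, Complex.inv_cpow _ _ harg, ← Complex.cpow_neg]
  push_cast
  rw [neg_neg, one_div]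
  exact Complex.pow_cpow_nat_inv (by omega) h2.1 h2.2.le

theorem arg_rootCoord (hk : 1 ≤ k) {w : ℂ} (hw : w ≠ 0) (harg : |w.arg| < Real.pi) :
    (rootCoord k w).arg = -(w.arg / k) := by
  have hk' : (1 : ℝ) ≤ k := by exact_mod_cast hk
  have him : (Complex.log w * ((-(1 / k : ℝ) : ℝ) : ℂ)).im = -(w.arg / k) := by
    rw [Complex.im_mul_ofReal, Complex.log_im]
    ring
  have hb : |w.arg / k| < Real.pi := by
    rw [abs_div, abs_of_pos (by linarith : (0 : ℝ) < k)]
    exact (div_le_self (abs_nonneg _) hk').trans_lt harg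
  rw [abs_lt] at hb
  rw [rootCoord, Complex.cpow_def_of_ne_zero hw, ← Complex.log_im, Complex.log_exp, him]
  · rw [him]; linarith
  · rw [him]; linarith

theorem invPow_rootCoord (hk : 1 ≤ k) (w : ℂ) : invPow k (rootCoord k w) = w := by
  rw [invPow, rootCoord_pow hk, inv_inv]

theorem rootCoord_mem_planeSector (hk : 1 ≤ k) (hγ : 0 < γ) (hR : 0 < R) {w : ℂ} (hw : w ∈ wedge γ R) :
    rootCoord k w ∈ planeSector k γ R⁻¹ := by
  have h0 := ne_zero_of_mem_wedge hw hγ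
  have hre := re_pos_of_mem_wedge hw hγ
  have harg : |w.arg| < Real.pi := (Complex.abs_arg_lt_pi_div_two_iff.2 (Or.inl hre)).trans
    (by linarith [Real.pi_pos])
  have hk' : (0 : ℝ) < k := by exact_mod_cast hk
  refine ⟨?_, ?_, ?_⟩
  · rw [rootCoord_pow hk, abs_im_inv_lt_iff h0]
    exact hw.1
  · rw [rootCoord_pow hk, norm_inv]
    exact inv_strictAnti₀ hR hw.2
  · rw [arg_rootCoord hk h0 harg, abs_neg, abs_div, abs_of_pos hk']
    exact div_lt_div_of_pos_right harg hk'

theorem mem_slitPlane_of_mem_planeSector (hk : 1 ≤ k) {s : ℝ} {x : ℂ} (hx : x ∈ planeSector k γ s) :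
    x ∈ Complex.slitPlane := by
  rw [Complex.mem_slitPlane_iff_arg]
  refine ⟨fun h => ?_, ne_zero_of_mem_planeSector hk hx⟩
  have h1 := hx.2.2
  rw [h, abs_of_pos Real.pi_pos] at h1
  exact absurd (div_le_self Real.pi_pos.le (by exact_mod_cast hk : (1 : ℝ) ≤ k)) (not_le.2 h1)

theorem isOpen_planeSector (hk : 1 ≤ k) (γ s : ℝ) : IsOpen (planeSector k γ s) := by
  rw [isOpen_iff_mem_nhds]
  intro x hx
  have harg := Complex.continuousAt_arg (mem_slitPlane_of_mem_planeSector hk hx)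
  have hpow : ContinuousAt (fun x : ℂ => x ^ k) x := (continuous_pow k).continuousAt
  filter_upwards [((Complex.continuous_im.continuousAt.comp hpow).abs).eventually_lt
    ((Complex.continuous_re.continuousAt.comp hpow).const_mul γ) hx.1,
    hpow.norm.eventually_lt continuousAt_const hx.2.1,
    harg.abs.eventually_lt continuousAt_const hx.2.2] with y h1 h2 h3
  exact ⟨h1, h2, h3⟩

theorem isConnected_planeSector (hk : 1 ≤ k) (hγ : 0 < γ) (hR : 0 < R) :
    IsConnected (planeSector k γ R⁻¹) := by
  -- The truncated sector of the variable `y = x^k` is convex, and the plane sector is its image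
  -- under the principal `k`-th root, which is continuous there.
  set K : Set ℂ := {y | |y.im| < γ * y.re} ∩ Metric.ball 0 R⁻¹ with hK
  have hconv : Convex ℝ K := by
    refine Convex.inter ?_ (convex_ball _ _)
    have h := (convexOn_univ_norm (E := ℝ)).comp_linearMap Complex.imLm
    have h2 := (h.sub ((LinearMap.concaveOn (γ • Complex.reLm) convex_univ))).convex_lt 0
    refine (Eq.subst (motive := Convex ℝ) ?_ h2)
    ext y
    simp
  have hne : K.Nonempty := by
    refine ⟨((R⁻¹ / 2 : ℝ) : ℂ), ?_, ?_⟩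
    · rw [mem_ofPred_eq, Complex.ofReal_im, Complex.ofReal_re, abs_zero]; positivity
    · rw [mem_ball_zero_iff, Complex.norm_real, Real.norm_of_nonneg (by positivity)]
      linarith [inv_pos.2 hR]
  have himg : (fun y => rootCoord k y⁻¹) '' K = planeSector k γ R⁻¹ := by
    ext x
    constructor
    · rintro ⟨y, hy, rfl⟩
      have hy0 := ne_zero_of_abs_im_lt hy.1
      refine rootCoord_mem_planeSector hk hγ hR ⟨(abs_im_inv_lt_iff hy0).2 hy.1, ?_⟩
      rw [norm_inv]
      exact (lt_inv_comm₀ hR (norm_pos_iff.2 hy0)).2 (mem_ball_zero_iff.1 hy.2)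
    · intro hx
      exact ⟨x ^ k, ⟨hx.1, mem_ball_zero_iff.2 hx.2.1⟩, rootCoord_invPow hk hγ hx⟩
  rw [← himg]
  refine (hconv.isConnected hne).image _ (fun y hy => ContinuousAt.continuousWithinAt ?_)
  have hy0 := ne_zero_of_abs_im_lt hy.1
  have hre : 0 < y⁻¹.re := pos_of_mul_pos_right
    ((abs_nonneg _).trans_lt ((abs_im_inv_lt_iff hy0).2 hy.1)) hγ.le
  exact (continuousAt_inv₀ hy0).cpow continuousAt_const (Or.inl hre)

theorem zero_mem_closure_planeSector (hk : 1 ≤ k) (hγ : 0 < γ) (hR : 0 < R) :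
    (0 : ℂ) ∈ closure (planeSector k γ R⁻¹) := by
  have h1 : Tendsto (fun t : ℝ => (t : ℂ)) (𝓝[>] 0) (𝓝 0) :=
    (Complex.continuous_ofReal.tendsto' 0 0 Complex.ofReal_zero).mono_left nhdsWithin_le_nhds
  have h2 : Tendsto (fun t : ℝ => ‖(t : ℂ) ^ k‖) (𝓝[>] 0) (𝓝 0) := by
    have := (h1.pow k).norm
    rwa [zero_pow (by omega), norm_zero] at this
  refine mem_closure_of_tendsto h1 ?_
  filter_upwards [self_mem_nhdsWithin, h2.eventually (gt_mem_nhds (inv_pos.2 hR))] with t ht ht2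
  have ht' : (0 : ℝ) < t := ht
  have hk' : (0 : ℝ) < k := by exact_mod_cast hk
  refine ⟨?_, ht2, ?_⟩
  · rw [← Complex.ofReal_pow, Complex.ofReal_im, Complex.ofReal_re, abs_zero]; positivity
  · rw [Complex.arg_ofReal_of_nonneg ht'.le, abs_zero]
    exact div_pos Real.pi_pos hk'

theorem norm_invPow (k : ℕ) (x : ℂ) : ‖invPow k x‖ = (‖x‖ ^ k)⁻¹ := by
  rw [invPow, norm_inv, norm_pow]

theorem tendsto_norm_invPow (hk : 1 ≤ k) : Tendsto (fun x => ‖invPow k x‖) (𝓝[≠] 0) atTop := by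
  have h : Tendsto (fun x : ℂ => ‖x‖ ^ k) (𝓝[≠] 0) (𝓝[>] 0) := by
    refine tendsto_nhdsWithin_iff.2 ⟨?_, eventually_of_mem self_mem_nhdsWithin fun x hx => ?_⟩
    · have h0 : Continuous (fun x : ℂ => ‖x‖ ^ k) := by fun_prop
      exact (h0.tendsto' 0 0 (by rw [norm_zero, zero_pow (by omega)])).mono_left nhdsWithin_le_nhds
    · exact pow_pos (norm_pos_iff.2 hx) k
  exact (tendsto_inv_nhdsGT_zero.comp h).congr fun x => (norm_invPow k x).symm

theorem differentiableAt_invPow {x : ℂ} (hx : x ≠ 0) : DifferentiableAt ℂ (invPow k) x :=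
  (differentiableAt_pow k).inv (pow_ne_zero _ hx)

theorem hasDerivAt_invPow (k : ℕ) {x : ℂ} (hx : x ≠ 0) :
    HasDerivAt (invPow k) (-(k * x⁻¹ * invPow k x)) x := by
  have h := (hasDerivAt_pow k x).fun_inv (pow_ne_zero k hx)
  refine h.congr_deriv ?_
  rw [invPow]
  rcases k with _ | k
  · simp
  · rw [Nat.add_sub_cancel]
    field_simp
    ring

end planeSector

/-! ### The chart that straightens the graph. -/

/-- `φ` is a bounded holomorphic map, decaying at infinity, on a neighbourhood of the product of
`wedge γ R` and the ball of radius `1 / 16`. -/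
structure IsDecayingGraph {U V : Type*} [NormedAddCommGroup U] [NormedSpace ℂ U] [NormedAddCommGroup V]
    [NormedSpace ℂ V] (φ : ℂ × U → V) (γ R D b : ℝ) : Prop where
  γ_pos : 0 < γ
  γ_le_one : γ ≤ 1
  one_le : 1 ≤ R
  b_pos : 0 < b
  differentiableOn : DifferentiableOn ℂ φ (wedge (2 * γ) (R / 2) ×ˢ Metric.ball 0 (1 / 8))
  norm_le : ∀ q ∈ wedge (2 * γ) (R / 2) ×ˢ Metric.ball (0 : U) (1 / 8), ‖φ q‖ ≤ D * ‖q.1‖ ^ (-b)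
  norm_le_quarter : ∀ q ∈ wedge (2 * γ) (R / 2) ×ˢ Metric.ball (0 : U) (1 / 8), ‖φ q‖ ≤ 1 / 4

theorem IsDecayingGraph.mem {U V : Type*} [NormedAddCommGroup U] [NormedSpace ℂ U]
    [NormedAddCommGroup V] [NormedSpace ℂ V] {φ : ℂ × U → V} {γ R D b : ℝ}
    (h : IsDecayingGraph φ γ R D b) {w : ℂ} (hw : w ∈ wedge γ R) {u : U} (hu : ‖u‖ < 1 / 16) :
    (w, u) ∈ wedge (2 * γ) (R / 2) ×ˢ Metric.ball (0 : U) (1 / 8) :=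
  ⟨wedge_mono h.γ_pos (by linarith [h.γ_pos]) (by linarith [h.one_le]) hw,
    mem_ball_zero_iff.2 (hu.trans (by norm_num))⟩

theorem IsDecayingGraph.differentiableAt {U V : Type*} [NormedAddCommGroup U] [NormedSpace ℂ U]
    [NormedAddCommGroup V] [NormedSpace ℂ V] {φ : ℂ × U → V} {γ R D b : ℝ}
    (h : IsDecayingGraph φ γ R D b) {w : ℂ} (hw : w ∈ wedge γ R) {u : U} (hu : ‖u‖ < 1 / 16) :
    DifferentiableAt ℂ φ (w, u) :=
  h.differentiableOn.differentiableAt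
    (((isOpen_wedge _ _).prod Metric.isOpen_ball).mem_nhds (h.mem hw hu))

section graphChart
variable {p : ℕ} {j : Fin p} {d l : ℕ}

/-- The slope `t` of the point with coordinates `(x, u, v)`, where `v` measures the distance to the
graph of `φ`. -/
noncomputable def graphSlope (k : ℕ) (a : ℝ) (L : (Others j → ℂ) ≃L[ℂ] Cn d × Cn l)
    (φ : ℂ × Cn d → Cn l) (X : ℂ × Cn d × Cn l) : Others j → ℂ :=
  invPow k X.1 ^ ((-a : ℝ) : ℂ) • L.symm (X.2.1, X.2.2 + φ (invPow k X.1, X.2.1))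

/-- The point with coordinates `(x, u, v)`. -/
noncomputable def graphChartSymm (u₀ : Others j → ℂ) (k : ℕ) (c : ℂ) (a : ℝ)
    (L : (Others j → ℂ) ≃L[ℂ] Cn d × Cn l) (φ : ℂ × Cn d → Cn l) (X : ℂ × Cn d × Cn l) : Cn p :=
  blowUp u₀ (c * X.1, graphSlope k a L φ X)

/-- The rescaled slope `s` of a point. -/
noncomputable def scaledSlope (u₀ : Others j → ℂ) (k : ℕ) (c : ℂ) (a : ℝ)
    (L : (Others j → ℂ) ≃L[ℂ] Cn d × Cn l) (z : Cn p) : Cn d × Cn l :=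
  invPow k (z j / c) ^ (a : ℂ) • L (fun i => z i.1 / z j - u₀ i)

/-- The coordinates `(x, u, v)` of a point. -/
noncomputable def graphChart (u₀ : Others j → ℂ) (k : ℕ) (c : ℂ) (a : ℝ)
    (L : (Others j → ℂ) ≃L[ℂ] Cn d × Cn l) (φ : ℂ × Cn d → Cn l) (z : Cn p) : ℂ × Cn d × Cn l :=
  (z j / c, (scaledSlope u₀ k c a L z).1,
    (scaledSlope u₀ k c a L z).2 - φ (invPow k (z j / c), (scaledSlope u₀ k c a L z).1))

variable {u₀ : Others j → ℂ} {k : ℕ} {c : ℂ} {a γ R D b : ℝ}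
  {L : (Others j → ℂ) ≃L[ℂ] Cn d × Cn l} {φ : ℂ × Cn d → Cn l}

@[simp] theorem blowUp_self (q : ℂ × (Others j → ℂ)) : blowUp u₀ q j = q.1 := by
  simp [blowUp]

theorem blowUp_others (q : ℂ × (Others j → ℂ)) (i : Others j) :
    blowUp u₀ q i.1 = q.1 * (u₀ i + q.2 i) := by
  simp [blowUp]

theorem blowUp_slope {z : Cn p} (hz : z j ≠ 0) : blowUp u₀ (z j, fun i => z i.1 / z j - u₀ i) = z := by
  ext i
  by_cases h : i = j
  · subst h; simp
  · rw [blowUp_others _ (⟨i, h⟩ : Others j)]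
    simp only
    field_simp
    ring

theorem slope_blowUp {q : ℂ × (Others j → ℂ)} (hq : q.1 ≠ 0) :
    (fun i : Others j => blowUp u₀ q i.1 / blowUp u₀ q j - u₀ i) = q.2 := by
  ext i
  rw [blowUp_others, blowUp_self, mul_div_cancel_left₀ _ hq, add_sub_cancel_left]

theorem cpow_mul_cpow_neg {w : ℂ} (hw : w ≠ 0) (b : ℝ) : w ^ (b : ℂ) * w ^ ((-b : ℝ) : ℂ) = 1 := by
  rw [← Complex.cpow_add _ _ hw]
  push_cast
  rw [add_neg_cancel, Complex.cpow_zero]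

theorem invPow_ne_zero {x : ℂ} (hx : x ≠ 0) : invPow k x ≠ 0 := inv_ne_zero (pow_ne_zero _ hx)

/-- Nothing about `φ` is used: subtracting what was added cancels formally, for any function `φ`,
wherever `x ≠ 0`. -/
theorem graphChart_graphChartSymm (hc : c ≠ 0) {X : ℂ × Cn d × Cn l} (hX : X.1 ≠ 0) :
    graphChart u₀ k c a L φ (graphChartSymm u₀ k c a L φ X) = X := by
  have h1 : graphChartSymm u₀ k c a L φ X j / c = X.1 := by
    rw [graphChartSymm, blowUp_self, mul_div_cancel_left₀ _ hc]
  have h2 : scaledSlope u₀ k c a L (graphChartSymm u₀ k c a L φ X) =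
      (X.2.1, X.2.2 + φ (invPow k X.1, X.2.1)) := by
    rw [scaledSlope, h1, graphChartSymm, slope_blowUp (mul_ne_zero hc hX)]
    simp only [graphSlope]
    rw [map_smul, smul_smul, cpow_mul_cpow_neg (invPow_ne_zero hX), one_smul, L.apply_symm_apply]
  rw [graphChart, h2, h1]
  simp

theorem graphChartSymm_graphChart (hc : c ≠ 0) {z : Cn p} (hz : z j ≠ 0) :
    graphChartSymm u₀ k c a L φ (graphChart u₀ k c a L φ z) = z := by
  have h1 : graphSlope k a L φ (graphChart u₀ k c a L φ z) = fun i => z i.1 / z j - u₀ i := by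
    simp only [graphSlope, graphChart, sub_add_cancel]
    rw [scaledSlope, map_smul, smul_smul, mul_comm, cpow_mul_cpow_neg
      (invPow_ne_zero (div_ne_zero hz hc)), one_smul, L.symm_apply_apply]
  rw [graphChartSymm, h1]
  simp only [graphChart]
  rw [mul_div_cancel₀ _ hc]
  exact blowUp_slope hz

theorem differentiableAt_invPow_cpow (hk : 1 ≤ k) (hγ : 0 < γ) (hR : 0 < R) {x : ℂ}
    (hx : x ∈ planeSector k γ R⁻¹) (b : ℂ) : DifferentiableAt ℂ (fun x => invPow k x ^ b) x :=
  (differentiableAt_invPow (ne_zero_of_mem_planeSector hk hx)).cpow (differentiableAt_const _)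
    (mem_slitPlane_of_mem_wedge (invPow_mem_wedge hk hR hx) hγ)

theorem differentiableAt_graphSlope (hk : 1 ≤ k) (hφ : IsDecayingGraph φ γ R D b)
    {X : ℂ × Cn d × Cn l} (hX : X.1 ∈ planeSector k γ R⁻¹) (hu : ‖X.2.1‖ < 1 / 16) :
    DifferentiableAt ℂ (graphSlope k a L φ) X := by
  have hR : 0 < R := by linarith [hφ.one_le]
  have h1 : DifferentiableAt ℂ (fun X : ℂ × Cn d × Cn l => invPow k X.1 ^ ((-a : ℝ) : ℂ)) X :=
    (differentiableAt_invPow_cpow hk hφ.γ_pos hR hX _).comp X differentiableAt_fst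
  have h2 : DifferentiableAt ℂ (fun X : ℂ × Cn d × Cn l => (invPow k X.1, X.2.1)) X :=
    ((differentiableAt_invPow (ne_zero_of_mem_planeSector hk hX)).comp X
      differentiableAt_fst).prodMk differentiableAt_snd.fst
  have h3 : DifferentiableAt ℂ (fun X : ℂ × Cn d × Cn l => φ (invPow k X.1, X.2.1)) X :=
    (hφ.differentiableAt (invPow_mem_wedge hk hR hX) hu).comp X h2
  exact h1.smul ((L.symm : (Cn d × Cn l) →L[ℂ] (Others j → ℂ)).differentiableAt.comp X
    (differentiableAt_snd.fst.prodMk (differentiableAt_snd.snd.add h3)))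

theorem differentiableAt_graphChartSymm (hk : 1 ≤ k) (hφ : IsDecayingGraph φ γ R D b)
    {X : ℂ × Cn d × Cn l} (hX : X.1 ∈ planeSector k γ R⁻¹) (hu : ‖X.2.1‖ < 1 / 16) :
    DifferentiableAt ℂ (graphChartSymm u₀ k c a L φ) X :=
  (differentiable_blowUp u₀ _).comp X ((differentiableAt_fst.const_mul c).prodMk
    (differentiableAt_graphSlope hk hφ hX hu))

theorem differentiableAt_coord (i : Fin p) (z : Cn p) : DifferentiableAt ℂ (fun z : Cn p => z i) z :=
  (EuclideanSpace.proj (𝕜 := ℂ) i : Cn p →L[ℂ] ℂ).differentiableAt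

theorem differentiableAt_coord_div (c : ℂ) (z : Cn p) : DifferentiableAt ℂ (fun z : Cn p => z j / c) z := by
  simp only [div_eq_mul_inv]
  exact (differentiableAt_coord j z).mul_const c⁻¹

theorem apply_ne_zero_of_mem_planeSector (hk : 1 ≤ k) {s : ℝ} {z : Cn p}
    (hz : z j / c ∈ planeSector k γ s) : z j ≠ 0 := by
  intro h
  rw [h, zero_div] at hz
  exact zero_notMem_planeSector hk hz

theorem differentiableAt_scaledSlope (hk : 1 ≤ k) (hγ : 0 < γ) (hR : 0 < R) {z : Cn p}
    (hz : z j / c ∈ planeSector k γ R⁻¹) : DifferentiableAt ℂ (scaledSlope u₀ k c a L) z := by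
  have hj := apply_ne_zero_of_mem_planeSector hk hz
  have h1 : DifferentiableAt ℂ (fun z : Cn p => invPow k (z j / c) ^ (a : ℂ)) z :=
    DifferentiableAt.comp z (g := fun x => invPow k x ^ (a : ℂ))
      (differentiableAt_invPow_cpow hk hγ hR hz _) (differentiableAt_coord_div c z)
  have h2 : DifferentiableAt ℂ (fun (z : Cn p) (i : Others j) => z i.1 / z j - u₀ i) z := by
    rw [differentiableAt_pi]
    exact fun i => (differentiableAt_div (differentiableAt_coord _ z)
      (differentiableAt_coord _ z) hj).sub_const _
  exact h1.smul ((L : (Others j → ℂ) →L[ℂ] Cn d × Cn l).differentiableAt.comp z h2)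

theorem differentiableAt_graphChart (hk : 1 ≤ k) (hφ : IsDecayingGraph φ γ R D b) {z : Cn p}
    (hz : z j / c ∈ planeSector k γ R⁻¹) (hu : ‖(scaledSlope u₀ k c a L z).1‖ < 1 / 16) :
    DifferentiableAt ℂ (graphChart u₀ k c a L φ) z := by
  have hR : 0 < R := by linarith [hφ.one_le]
  have hj := apply_ne_zero_of_mem_planeSector hk hz
  have h1 := differentiableAt_scaledSlope (u₀ := u₀) (a := a) (L := L) hk hφ.γ_pos hR hz
  have h0 : DifferentiableAt ℂ (fun z : Cn p => z j / c) z := differentiableAt_coord_div c z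
  have h2 : DifferentiableAt ℂ (fun z : Cn p => invPow k (z j / c)) z :=
    DifferentiableAt.comp z (g := invPow k) (differentiableAt_invPow (ne_zero_of_mem_planeSector hk hz)) h0
  have h3 : DifferentiableAt ℂ
      (fun z => φ (invPow k (z j / c), (scaledSlope u₀ k c a L z).1)) z :=
    DifferentiableAt.comp z (g := φ) (hφ.differentiableAt (invPow_mem_wedge hk hR hz) hu) (h2.prodMk h1.fst)
  exact h0.prodMk (h1.fst.prodMk (h1.snd.sub h3))

theorem isOpen_sector (hk : 1 ≤ k) (γ s ρ : ℝ) : IsOpen (sector k d l γ s ρ) := by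
  have h : Continuous (fun X : ℂ × Cn d × Cn l => Real.sqrt (‖X.2.1‖ ^ 2 + ‖X.2.2‖ ^ 2)) := by fun_prop
  exact ((isOpen_planeSector hk γ s).preimage continuous_fst).inter (isOpen_lt h continuous_const)

theorem norm_fst_lt_of_mem_sector {s ρ : ℝ} {X : ℂ × Cn d × Cn l} (hX : X ∈ sector k d l γ s ρ) :
    ‖X.2.1‖ < ρ :=
  (Real.le_sqrt_of_sq_le (by linarith [sq_nonneg ‖X.2.2‖])).trans_lt hX.2

theorem norm_snd_lt_of_mem_sector {s ρ : ℝ} {X : ℂ × Cn d × Cn l} (hX : X ∈ sector k d l γ s ρ) :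
    ‖X.2.2‖ < ρ :=
  (Real.le_sqrt_of_sq_le (by linarith [sq_nonneg ‖X.2.1‖])).trans_lt hX.2

theorem mem_sector_zero_iff {s ρ : ℝ} {x : ℂ} {u : Cn d} :
    (x, u, (0 : Cn l)) ∈ sector k d l γ s ρ ↔ x ∈ planeSector k γ s ∧ ‖u‖ < ρ := by
  simp [sector]

theorem differentiableOn_graphChart (hk : 1 ≤ k) (hφ : IsDecayingGraph φ γ R D b) :
    DifferentiableOn ℂ (graphChart u₀ k c a L φ)
      {z | graphChart u₀ k c a L φ z ∈ sector k d l γ R⁻¹ (1 / 16)} := by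
  intro z hz
  have h1 : z j / c ∈ planeSector k γ R⁻¹ := hz.1
  have h2 := norm_fst_lt_of_mem_sector hz
  exact (differentiableAt_graphChart hk hφ h1 h2).differentiableWithinAt

theorem differentiableOn_graphChartSymm (hk : 1 ≤ k) (hφ : IsDecayingGraph φ γ R D b) :
    DifferentiableOn ℂ (graphChartSymm u₀ k c a L φ) (sector k d l γ R⁻¹ (1 / 16)) := by
  intro X hX
  have h1 := norm_fst_lt_of_mem_sector hX
  exact (differentiableAt_graphChartSymm hk hφ hX.1 h1).differentiableWithinAt

theorem isOpen_preimage_graphChart (hk : 1 ≤ k) (hφ : IsDecayingGraph φ γ R D b) :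
    IsOpen {z | graphChart u₀ k c a L φ z ∈ sector k d l γ R⁻¹ (1 / 16)} := by
  rw [isOpen_iff_mem_nhds]
  intro z hz
  have h1 : z j / c ∈ planeSector k γ R⁻¹ := hz.1
  have h2 := norm_fst_lt_of_mem_sector hz
  have h := differentiableAt_graphChart (u₀ := u₀) (a := a) (L := L) hk hφ (z := z) h1 h2
  exact h.continuousAt.preimage_mem_nhds ((isOpen_sector hk _ _ _).mem_nhds hz)

theorem graphChartSymm_graphChart_of_mem (hk : 1 ≤ k) (hc : c ≠ 0) {s ρ : ℝ} {z : Cn p}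
    (hz : graphChart u₀ k c a L φ z ∈ sector k d l γ s ρ) :
    graphChartSymm u₀ k c a L φ (graphChart u₀ k c a L φ z) = z := by
  have h1 : z j / c ∈ planeSector k γ s := hz.1
  exact graphChartSymm_graphChart hc (apply_ne_zero_of_mem_planeSector hk h1)

theorem graphChart_graphChartSymm_of_mem (hk : 1 ≤ k) (hc : c ≠ 0) {s ρ : ℝ} {X : ℂ × Cn d × Cn l}
    (hX : X ∈ sector k d l γ s ρ) :
    graphChart u₀ k c a L φ (graphChartSymm u₀ k c a L φ X) = X :=
  graphChart_graphChartSymm hc (ne_zero_of_mem_planeSector hk hX.1)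

/-- The coordinates `(x, u, v)` adapted to the graph of `φ`. -/
noncomputable def graphHomeomorph (u₀ : Others j → ℂ) (a : ℝ) (L : (Others j → ℂ) ≃L[ℂ] Cn d × Cn l)
    (hk : 1 ≤ k) (hc : c ≠ 0) (hφ : IsDecayingGraph φ γ R D b) :
    OpenPartialHomeomorph (Cn p) (ℂ × Cn d × Cn l) where
  toFun := graphChart u₀ k c a L φ
  invFun := graphChartSymm u₀ k c a L φ
  source := {z | graphChart u₀ k c a L φ z ∈ sector k d l γ R⁻¹ (1 / 16)}
  target := sector k d l γ R⁻¹ (1 / 16)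
  map_source' _ hz := hz
  map_target' X hX := by
    rw [mem_ofPred_eq, graphChart_graphChartSymm_of_mem hk hc hX]
    exact hX
  left_inv' _ hz := graphChartSymm_graphChart_of_mem hk hc hz
  right_inv' _ hX := graphChart_graphChartSymm_of_mem hk hc hX
  open_source := isOpen_preimage_graphChart hk hφ
  open_target := isOpen_sector hk _ _ _
  continuousOn_toFun := (differentiableOn_graphChart hk hφ).continuousOn
  continuousOn_invFun := (differentiableOn_graphChartSymm hk hφ).continuousOn

/-! ### The direction of approach -/

theorem tendstoDirection_of_tendsto_inv_smul {α : Type} {f : α → Cn p} {ℓ : Filter α} {V : Cn p}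
    (hV : V j ≠ 0) (h0 : ∀ᶠ x in ℓ, f x j ≠ 0)
    (h : Tendsto (fun x => (f x j)⁻¹ • f x) ℓ (𝓝 ((V j)⁻¹ • V))) : TendstoDirection f ℓ V := by
  refine ⟨h0.mono fun x hx h => hx (by simp [h]), fun x => V j * (f x j)⁻¹, ?_⟩
  have := h.const_smul (V j)
  rw [smul_inv_smul₀ hV] at this
  exact this.congr fun x => smul_smul _ _ _

theorem affinePoint_affineCoord {V : Cn p} (hV : V j ≠ 0) :
    affinePoint j (affineCoord j V) = (V j)⁻¹ • V := by
  ext i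
  by_cases h : i = j
  · subst h; simp [hV]
  · simp [affinePoint, affineCoord, h, div_eq_inv_mul]

/-- The point divided by its `j`-th coordinate is `(1, u₀ + t)`, so approach along `[V]` amounts to
`t → 0`. -/
theorem tendstoDirection_blowUp {α : Type} {f : α → ℂ × (Others j → ℂ)} {ℓ : Filter α} {V : Cn p}
    (hV : V j ≠ 0) (hf : Tendsto f ℓ (puncturedZero j)) :
    TendstoDirection (fun x => blowUp (affineCoord j V) (f x)) ℓ V := by
  obtain ⟨h1, h2⟩ := tendsto_inf.1 hf
  rw [tendsto_principal] at h2
  refine tendstoDirection_of_tendsto_inv_smul hV (h2.mono fun x hx => ?_) ?_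
  · rw [blowUp_self]; exact hx
  · rw [← affinePoint_affineCoord hV]
    have h3 : Tendsto (fun x => affinePoint j (affineCoord j V + (f x).2)) ℓ
        (𝓝 (affinePoint j (affineCoord j V))) := by
      have := ((continuous_affinePoint j).tendsto _).comp
        (((continuous_snd.tendsto _).comp h1).const_add (affineCoord j V))
      rwa [Prod.snd_zero, add_zero] at this
    refine h3.congr' (h2.mono fun x hx => ?_)
    simp only [blowUp_self]
    exact (inv_smul_smul₀ hx _).symm

/-- The filter of coordinates `(x, u, v)` with `x → 0`. -/
noncomputable abbrev sectorZero (k d l : ℕ) (γ R : ℝ) : Filter (ℂ × Cn d × Cn l) :=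
  comap Prod.fst (𝓝 0) ⊓ 𝓟 (sector k d l γ R⁻¹ (1 / 16))

theorem toBlowUp_eq (hk : 1 ≤ k) (hγ : 0 < γ) {X : ℂ × Cn d × Cn l} {s : ℝ}
    (hX : X.1 ∈ planeSector k γ s) :
    toBlowUp k c a L (invPow k X.1, (X.2.1, X.2.2 + φ (invPow k X.1, X.2.1))) =
      (c * X.1, graphSlope k a L φ X) := by
  rw [toBlowUp, rootCoord_invPow hk hγ hX]
  rfl

/-- The convergence `x → 0` alone suffices: `u` and `v` need only stay bounded, because the slope
carries the factor `w^(-a)`. The tangency statement relies on this, since points of `M` near `0`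
need not have small `u`. -/
theorem tendsto_coords (hk : 1 ≤ k) (hc : c ≠ 0) (ha : 0 < a) (hak : 2 * a ≤ 1 / k)
    (hφ : IsDecayingGraph φ γ R D b) :
    Tendsto (fun X => (c * X.1, graphSlope k a L φ X)) (sectorZero k d l γ R) (puncturedZero j) := by
  have hR : 0 < R := by linarith [hφ.one_le]
  have hS : ∀ᶠ X in sectorZero k d l γ R, X ∈ sector k d l γ R⁻¹ (1 / 16) :=
    mem_inf_of_right (mem_principal_self _)
  have h1 : Tendsto (fun X : ℂ × Cn d × Cn l => (invPow k X.1, (X.2.1, X.2.2 + φ (invPow k X.1, X.2.1))))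
      (sectorZero k d l γ R) (atInfinity (Cn d × Cn l)) := by
    refine tendsto_inf.2 ⟨tendsto_comap_iff.2 ?_, tendsto_principal.2 (hS.mono fun X hX => ?_)⟩
    · exact (tendsto_norm_invPow hk).comp (tendsto_nhdsWithin_iff.2
        ⟨tendsto_comap.mono_left inf_le_left, hS.mono fun X hX => ne_zero_of_mem_planeSector hk hX.1⟩)
    · have hu := norm_fst_lt_of_mem_sector hX
      have hv := norm_snd_lt_of_mem_sector hX
      have h3 := hφ.norm_le_quarter _ (hφ.mem (invPow_mem_wedge hk hR hX.1) hu)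
      have h4 := norm_add_le X.2.2 (φ (invPow k X.1, X.2.1))
      rw [mem_ofPred_eq, Prod.norm_mk]
      exact max_lt (by linarith) (by linarith)
  refine ((tendsto_toBlowUp (L := L) hc ha hak).comp h1).congr' (hS.mono fun X hX => ?_)
  exact toBlowUp_eq hk hφ.γ_pos hX.1

theorem nhdsWithin_sector_le (s : Set (ℂ × Cn d × Cn l)) : 𝓝[s] 0 ≤ comap Prod.fst (𝓝 0) ⊓ 𝓟 s :=
  inf_le_inf_right _ (by rw [nhds_prod_eq]; exact inf_le_left)

theorem isSectorialCoordinates_graphHomeomorph (hk : 1 ≤ k) (hc : c ≠ 0) (ha : 0 < a)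
    (hak : 2 * a ≤ 1 / k) (hφ : IsDecayingGraph φ γ R D b) {V : Cn p} (hV : V j ≠ 0) :
    IsSectorialCoordinates k V (graphHomeomorph (affineCoord j V) a L hk hc hφ) where
  target_eq := ⟨γ, R⁻¹, 1 / 16, hφ.γ_pos, inv_pos.2 (by linarith [hφ.one_le]), by norm_num, rfl⟩
  holomorphic := differentiableOn_graphChart hk hφ
  holomorphic_symm := differentiableOn_graphChartSymm hk hφ
  tendsto_zero := (tendsto_blowUp _).comp (((tendsto_coords (L := L) hk hc ha hak hφ).mono_right
    inf_le_left).mono_left (nhdsWithin_sector_le _))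
  tendsto_direction := tendstoDirection_blowUp hV
    ((tendsto_coords (L := L) hk hc ha hak hφ).mono_left (nhdsWithin_sector_le _))

end graphChart

/-! ### The parametrised manifold, its invariance and its orbits. -/

section graphManifold
variable {p : ℕ} {j : Fin p} {d l : ℕ} {u₀ : Others j → ℂ} {k : ℕ} {c : ℂ} {a γ R D b : ℝ}
  {L : (Others j → ℂ) ≃L[ℂ] Cn d × Cn l} {φ : ℂ × Cn d → Cn l}

/-- The domain of the parametrization of the invariant manifold. -/
abbrev graphDomain (k d : ℕ) (γ R : ℝ) : Set (ℂ × Cn d) := planeSector k γ R⁻¹ ×ˢ Metric.ball 0 (1 / 16)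

/-- The parametrization of the manifold `v = 0`. -/
noncomputable def graphParam (u₀ : Others j → ℂ) (k : ℕ) (c : ℂ) (a : ℝ)
    (L : (Others j → ℂ) ≃L[ℂ] Cn d × Cn l) (φ : ℂ × Cn d → Cn l) (q : ℂ × Cn d) : Cn p :=
  graphChartSymm u₀ k c a L φ (q.1, q.2, 0)

/-- The linear inclusion `(x, u) ↦ (x, u, 0)`. -/
noncomputable def zeroSection (d l : ℕ) : (ℂ × Cn d) →L[ℂ] ℂ × Cn d × Cn l :=
  (ContinuousLinearMap.fst ℂ ℂ (Cn d)).prod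
    ((ContinuousLinearMap.snd ℂ ℂ (Cn d)).prod (0 : (ℂ × Cn d) →L[ℂ] Cn l))

theorem zeroSection_mem_sector {q : ℂ × Cn d} :
    zeroSection d l q ∈ sector k d l γ R⁻¹ (1 / 16) ↔ q ∈ graphDomain k d γ R := by
  rw [mem_prod, mem_ball_zero_iff]
  exact mem_sector_zero_iff

theorem isOpen_graphDomain (hk : 1 ≤ k) (d : ℕ) (γ R : ℝ) : IsOpen (graphDomain k d γ R) :=
  (isOpen_planeSector hk _ _).prod Metric.isOpen_ball

theorem differentiableAt_graphParam (hk : 1 ≤ k) (hφ : IsDecayingGraph φ γ R D b) {q : ℂ × Cn d}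
    (hq : q ∈ graphDomain k d γ R) : DifferentiableAt ℂ (graphParam u₀ k c a L φ) q := by
  have h := differentiableAt_graphChartSymm (u₀ := u₀) (c := c) (a := a) (L := L) hk hφ
    (X := zeroSection d l q) hq.1 (mem_ball_zero_iff.1 hq.2)
  exact h.comp q (zeroSection d l).differentiableAt

theorem graphChart_graphParam (hk : 1 ≤ k) (hc : c ≠ 0) {q : ℂ × Cn d} (hq : q ∈ graphDomain k d γ R) :
    graphChart u₀ k c a L φ (graphParam u₀ k c a L φ q) = zeroSection d l q :=
  graphChart_graphChartSymm hc (X := zeroSection d l q) (ne_zero_of_mem_planeSector hk hq.1)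

theorem injOn_graphParam (hk : 1 ≤ k) (hc : c ≠ 0) :
    InjOn (graphParam u₀ k c a L φ) (graphDomain k d γ R) := by
  intro q hq q' hq' h
  have := congrArg (graphChart u₀ k c a L φ) h
  rw [graphChart_graphParam hk hc hq, graphChart_graphParam hk hc hq'] at this
  exact Prod.ext (congrArg (fun X => X.1) this) (congrArg (fun X => X.2.1) this)

/-- The chart composed with the parametrisation is the linear inclusion `(x, u) ↦ (x, u, 0)`; by the
chain rule the derivative has a left factor that makes it injective. -/
theorem injective_fderiv_graphParam (hk : 1 ≤ k) (hc : c ≠ 0) (hφ : IsDecayingGraph φ γ R D b)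
    {q : ℂ × Cn d} (hq : q ∈ graphDomain k d γ R) :
    Function.Injective (fderiv ℂ (graphParam u₀ k c a L φ) q) := by
  have hmem : graphChart u₀ k c a L φ (graphParam u₀ k c a L φ q) ∈ sector k d l γ R⁻¹ (1 / 16) := by
    rw [graphChart_graphParam hk hc hq]
    exact zeroSection_mem_sector.2 hq
  have h1 : DifferentiableAt ℂ (graphChart u₀ k c a L φ) (graphParam u₀ k c a L φ q) :=
    (differentiableOn_graphChart hk hφ).differentiableAt
      ((isOpen_preimage_graphChart hk hφ).mem_nhds hmem)
  have h2 := h1.hasFDerivAt.comp q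
    (differentiableAt_graphParam (u₀ := u₀) (c := c) (a := a) (L := L) hk hφ hq).hasFDerivAt
  have h3 : HasFDerivAt (graphChart u₀ k c a L φ ∘ graphParam u₀ k c a L φ) (zeroSection d l) q := by
    refine (zeroSection d l).hasFDerivAt.congr_of_eventuallyEq ?_
    filter_upwards [(isOpen_graphDomain hk d γ R).mem_nhds hq] with q' hq'
    exact graphChart_graphParam hk hc hq'
  intro x y hxy
  have e := congrArg (fderiv ℂ (graphChart u₀ k c a L φ) (graphParam u₀ k c a L φ q)) hxy
  have h4 := h2.unique h3
  have h5 : ∀ z, fderiv ℂ (graphChart u₀ k c a L φ) (graphParam u₀ k c a L φ q)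
      (fderiv ℂ (graphParam u₀ k c a L φ) q z) = zeroSection d l z := fun z => by rw [← h4]; rfl
  rw [h5, h5] at e
  exact Prod.ext (congrArg (fun X => X.1) e) (congrArg (fun X => X.2.1) e)

theorem graphParam_apply_self (q : ℂ × Cn d) : graphParam u₀ k c a L φ q j = c * q.1 := by
  rw [graphParam, graphChartSymm, blowUp_self]

theorem image_graphParam (hk : 1 ≤ k) (hc : c ≠ 0) (hφ : IsDecayingGraph φ γ R D b) :
    graphParam u₀ k c a L φ '' graphDomain k d γ R =
      {z | z ∈ (graphHomeomorph u₀ a L hk hc hφ).source ∧ (graphHomeomorph u₀ a L hk hc hφ z).2.2 = 0} := by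
  ext z
  constructor
  · rintro ⟨q, hq, rfl⟩
    have e : graphHomeomorph u₀ a L hk hc hφ (graphParam u₀ k c a L φ q) = zeroSection d l q :=
      graphChart_graphParam hk hc hq
    refine ⟨?_, ?_⟩
    · change graphChart u₀ k c a L φ (graphParam u₀ k c a L φ q) ∈ sector k d l γ R⁻¹ (1 / 16)
      rw [graphChart_graphParam hk hc hq]
      exact zeroSection_mem_sector.2 hq
    · rw [e]; rfl
  · rintro ⟨hz, h0⟩
    change graphChart u₀ k c a L φ z ∈ sector k d l γ R⁻¹ (1 / 16) at hz
    change (graphChart u₀ k c a L φ z).2.2 = 0 at h0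
    have e : graphChart u₀ k c a L φ z = zeroSection d l
        ((graphChart u₀ k c a L φ z).1, (graphChart u₀ k c a L φ z).2.1) :=
      Prod.ext rfl (Prod.ext rfl h0)
    refine ⟨((graphChart u₀ k c a L φ z).1, (graphChart u₀ k c a L φ z).2.1), ?_, ?_⟩
    · rw [e] at hz
      exact zeroSection_mem_sector.1 hz
    · have h1 := graphChartSymm_graphChart_of_mem hk hc hz
      rw [e] at h1
      exact h1

/-- The filter of the points `(x, u)` of the domain of the parametrization with `x → 0`. -/
noncomputable abbrev domainZero (k d : ℕ) (γ R : ℝ) : Filter (ℂ × Cn d) :=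
  comap Prod.fst (𝓝 0) ⊓ 𝓟 (graphDomain k d γ R)

theorem tendsto_zeroSection : Tendsto (zeroSection d l) (domainZero k d γ R) (sectorZero k d l γ R) := by
  refine tendsto_inf.2 ⟨tendsto_comap_iff.2 ?_, tendsto_principal.2 ?_⟩
  · exact tendsto_comap.mono_left inf_le_left
  · exact mem_inf_of_right (fun q hq => zeroSection_mem_sector.2 hq)

/-- The slope `t` along the manifold `v = 0`. -/
noncomputable def paramSlope (k : ℕ) (a : ℝ) (L : (Others j → ℂ) ≃L[ℂ] Cn d × Cn l)
    (φ : ℂ × Cn d → Cn l) (q : ℂ × Cn d) : Others j → ℂ := graphSlope k a L φ (zeroSection d l q)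

theorem graphParam_eq (q : ℂ × Cn d) :
    graphParam u₀ k c a L φ q = blowUp u₀ (c * q.1, paramSlope k a L φ q) := rfl

theorem tendsto_paramCoords (hk : 1 ≤ k) (hc : c ≠ 0) (ha : 0 < a) (hak : 2 * a ≤ 1 / k)
    (hφ : IsDecayingGraph φ γ R D b) :
    Tendsto (fun q => (c * q.1, paramSlope k a L φ q)) (domainZero k d γ R) (puncturedZero j) :=
  (tendsto_coords (L := L) hk hc ha hak hφ).comp tendsto_zeroSection

theorem isConnected_graphDomain (hk : 1 ≤ k) (hγ : 0 < γ) (hR : 0 < R) :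
    IsConnected (graphDomain k d γ R) :=
  (isConnected_planeSector hk hγ hR).prod
    ((convex_ball _ _).isConnected ⟨0, Metric.mem_ball_self (by norm_num)⟩)

theorem zero_mem_closure_graphDomain (hk : 1 ≤ k) (hγ : 0 < γ) (hR : 0 < R) :
    (0 : ℂ × Cn d) ∈ closure (graphDomain k d γ R) := by
  rw [closure_prod_eq]
  exact ⟨zero_mem_closure_planeSector hk hγ hR, subset_closure (Metric.mem_ball_self (by norm_num))⟩

theorem isParabolicManifold_graphParam (hk : 1 ≤ k) (hc : c ≠ 0) (ha : 0 < a) (hak : 2 * a ≤ 1 / k)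
    (hφ : IsDecayingGraph φ γ R D b) {V : Cn p} (hV : V j ≠ 0) {Φ : Cn p → Cn p}
    (hinv : MapsTo Φ (graphParam (affineCoord j V) k c a L φ '' graphDomain k d γ R)
      (graphParam (affineCoord j V) k c a L φ '' graphDomain k d γ R))
    (horb : ∀ z ∈ graphParam (affineCoord j V) k c a L φ '' graphDomain k d γ R,
      Tendsto (fun m : ℕ => Φ^[m] z) atTop (𝓝 0))
    (J : Cn (d + 1) ≃L[ℂ] ℂ × Cn d) :
    IsParabolicManifold Φ V (d + 1) (graphParam (affineCoord j V) k c a L φ '' graphDomain k d γ R)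
      (J ⁻¹' graphDomain k d γ R) (graphParam (affineCoord j V) k c a L φ ∘ J) := by
  have hR : 0 < R := by linarith [hφ.one_le]
  have hopen : IsOpen (J ⁻¹' graphDomain k d γ R) := (isOpen_graphDomain hk d γ R).preimage J.continuous
  have hJ : Tendsto J (𝓝[J ⁻¹' graphDomain k d γ R] 0) (domainZero k d γ R) := by
    refine tendsto_inf.2 ⟨tendsto_comap_iff.2 ?_, tendsto_principal.2 self_mem_nhdsWithin⟩
    have := (continuous_fst.comp J.continuous).tendsto 0
    simp only [Function.comp, map_zero, Prod.fst_zero] at this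
    exact this.mono_left nhdsWithin_le_nhds
  have hcoords := (tendsto_paramCoords (L := L) hk hc ha hak hφ).comp hJ
  refine
    { isOpen := hopen
      isConnected := ?_
      zero_mem_frontier := ?_
      holomorphic := fun X hX => ?_
      injOn := fun X hX Y hY h => J.injective (injOn_graphParam hk hc hX hY h)
      immersion := fun X hX => ?_
      image_eq := ?_
      tendsto_zero := (tendsto_blowUp (affineCoord j V)).comp (hcoords.mono_right inf_le_left)
      tendsto_direction := tendstoDirection_blowUp hV hcoords
      invariant := hinv
      orbit := horb }
  · have := (isConnected_graphDomain (d := d) hk hφ.γ_pos hR).image J.symm J.symm.continuous.continuousOn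
    rwa [J.symm.image_eq_preimage_symm] at this
  · have hnot : (0 : Cn (d + 1)) ∉ J ⁻¹' graphDomain k d γ R := fun h => by
      have h1 := h.1
      rw [map_zero] at h1
      exact zero_notMem_planeSector hk h1
    rw [hopen.frontier_eq]
    refine ⟨?_, hnot⟩
    have := mem_closure_image J.symm.continuous.continuousAt
      (zero_mem_closure_graphDomain (d := d) hk hφ.γ_pos hR)
    rwa [J.symm.image_eq_preimage_symm, map_zero] at this
  · exact ((differentiableAt_graphParam hk hφ hX).comp X J.differentiableAt).differentiableWithinAt
  · rw [fderiv_comp _ (differentiableAt_graphParam hk hφ hX) J.differentiableAt, J.fderiv]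
    exact (injective_fderiv_graphParam hk hc hφ hX).comp J.injective
  · rw [image_comp, image_preimage_eq _ J.surjective]

theorem zero_mem_frontier_image_graphParam (hk : 1 ≤ k) (hc : c ≠ 0) (ha : 0 < a) (hak : 2 * a ≤ 1 / k)
    (hφ : IsDecayingGraph φ γ R D b) :
    (0 : Cn p) ∈ frontier (graphParam u₀ k c a L φ '' graphDomain k d γ R) := by
  have hR : 0 < R := by linarith [hφ.one_le]
  have hnot : (0 : Cn p) ∉ graphParam u₀ k c a L φ '' graphDomain k d γ R := by
    rintro ⟨q, hq, h⟩
    have h1 := graphParam_apply_self (u₀ := u₀) (k := k) (c := c) (a := a) (L := L) (φ := φ) q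
    rw [h] at h1
    exact mul_ne_zero hc (ne_zero_of_mem_planeSector hk hq.1) h1.symm
  refine ⟨?_, fun h => hnot (interior_subset h)⟩
  have : (𝓝[graphDomain k d γ R] (0 : ℂ × Cn d)).NeBot :=
    mem_closure_iff_nhdsWithin_neBot.1 (zero_mem_closure_graphDomain hk hφ.γ_pos hR)
  have hle : 𝓝[graphDomain k d γ R] (0 : ℂ × Cn d) ≤ domainZero k d γ R :=
    inf_le_inf_right _ (by rw [nhds_prod_eq]; exact inf_le_left)
  have ht : Tendsto (graphParam u₀ k c a L φ) (𝓝[graphDomain k d γ R] 0) (𝓝 0) :=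
    (tendsto_blowUp u₀).comp
      (((tendsto_paramCoords (L := L) hk hc ha hak hφ).mono_right inf_le_left).mono_left hle)
  exact mem_closure_of_tendsto ht (eventually_of_mem self_mem_nhdsWithin fun q hq => ⟨q, hq, rfl⟩)

/-! ### Invariance and orbits -/

variable {Φ : Cn p → Cn p}

theorem graphParam_eq_toBlowUp (hk : 1 ≤ k) (hγ : 0 < γ) {q : ℂ × Cn d} (hq : q ∈ graphDomain k d γ R) :
    graphParam u₀ k c a L φ q =
      blowUp u₀ (toBlowUp k c a L (invPow k q.1, (q.2, φ (invPow k q.1, q.2)))) := by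
  have := toBlowUp_eq (c := c) (a := a) (L := L) (φ := φ) (X := zeroSection d l q) hk hγ hq.1
  rw [graphParam_eq, paramSlope]
  refine congrArg (blowUp u₀) (this.symm.trans ?_)
  simp [zeroSection]

theorem mapsTo_image_graphParam (hk : 1 ≤ k) (hφ : IsDecayingGraph φ γ R D b)
    {F : ℂ × Cn d × Cn l → ℂ × Cn d × Cn l}
    (hconj : ∀ q ∈ wedge γ R ×ˢ Metric.ball (0 : Cn d) (1 / 16),
      blowUp u₀ (toBlowUp k c a L (F (q.1, q.2, φ q))) = Φ (blowUp u₀ (toBlowUp k c a L (q.1, q.2, φ q))))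
    (hmap : ∀ q ∈ wedge γ R ×ˢ Metric.ball (0 : Cn d) (1 / 16),
      ((F (q.1, q.2, φ q)).1, (F (q.1, q.2, φ q)).2.1) ∈ wedge γ R ×ˢ Metric.ball (0 : Cn d) (1 / 16))
    (hinv : ∀ q ∈ wedge γ R ×ˢ Metric.ball (0 : Cn d) (1 / 16),
      φ ((F (q.1, q.2, φ q)).1, (F (q.1, q.2, φ q)).2.1) = (F (q.1, q.2, φ q)).2.2) :
    MapsTo Φ (graphParam u₀ k c a L φ '' graphDomain k d γ R)
      (graphParam u₀ k c a L φ '' graphDomain k d γ R) := by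
  have hR : 0 < R := by linarith [hφ.one_le]
  rintro _ ⟨q, hq, rfl⟩
  have hq' : (invPow k q.1, q.2) ∈ wedge γ R ×ˢ Metric.ball (0 : Cn d) (1 / 16) :=
    ⟨invPow_mem_wedge hk hR hq.1, hq.2⟩
  have h1 := hconj _ hq'
  have h2 := hmap _ hq'
  have h3 := hinv _ hq'
  simp only at h1 h2 h3
  set y := F (invPow k q.1, q.2, φ (invPow k q.1, q.2)) with hy
  have hmem : (rootCoord k y.1, y.2.1) ∈ graphDomain k d γ R :=
    ⟨rootCoord_mem_planeSector hk hφ.γ_pos hR h2.1, h2.2⟩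
  refine ⟨_, hmem, ?_⟩
  rw [graphParam_eq_toBlowUp hk hφ.γ_pos hmem, graphParam_eq_toBlowUp hk hφ.γ_pos hq, ← h1]
  simp only
  rw [invPow_rootCoord hk, h3]

/-- The orbit is recorded in the blow-up coordinates, because their convergence yields both `Φ^n(z)
→ 0` and convergence of the direction. -/
theorem exists_orbit_image_graphParam (hk : 1 ≤ k) (hc : c ≠ 0) (ha : 0 < a) (hak : 2 * a ≤ 1 / k)
    (hφ : IsDecayingGraph φ γ R D b) {γ' R' : ℝ} {F : ℂ × Cn d × Cn l → ℂ × Cn d × Cn l}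
    (hconj : ∀ q ∈ wedge γ' R' ×ˢ Metric.ball (0 : Cn d × Cn l) 1,
      blowUp u₀ (toBlowUp k c a L (F q)) = Φ (blowUp u₀ (toBlowUp k c a L q)))
    (horb : ∀ q ∈ wedge γ R ×ˢ Metric.ball (0 : Cn d) (1 / 16), ∃ x : ℕ → ℂ × Cn d × Cn l,
      x 0 = (q.1, q.2, φ q) ∧ (∀ n, x (n + 1) = F (x n)) ∧
      (∀ n, x n ∈ wedge γ' R' ×ˢ Metric.ball (0 : Cn d × Cn l) 1) ∧
      Tendsto (fun n => ‖(x n).1‖) atTop atTop) :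
    ∀ z ∈ graphParam u₀ k c a L φ '' graphDomain k d γ R, ∃ y : ℕ → ℂ × (Others j → ℂ),
      Tendsto y atTop (puncturedZero j) ∧ ∀ n, Φ^[n] z = blowUp u₀ (y n) := by
  have hR : 0 < R := by linarith [hφ.one_le]
  rintro _ ⟨q, hq, rfl⟩
  obtain ⟨x, h0, hx, hmem, hlim⟩ := horb (invPow k q.1, q.2) ⟨invPow_mem_wedge hk hR hq.1, hq.2⟩
  have hinf : Tendsto x atTop (atInfinity (Cn d × Cn l)) :=
    tendsto_inf.2 ⟨tendsto_comap_iff.2 hlim,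
      tendsto_principal.2 (Eventually.of_forall fun n => mem_ball_zero_iff.1 (hmem n).2)⟩
  refine ⟨fun n => toBlowUp k c a L (x n), (tendsto_toBlowUp hc ha hak).comp hinf, fun n => ?_⟩
  change Φ^[n] _ = blowUp u₀ (toBlowUp k c a L (x n))
  induction n with
  | zero => rw [h0, Function.iterate_zero, id, graphParam_eq_toBlowUp hk hφ.γ_pos hq]
  | succ n ih => rw [Function.iterate_succ_apply', ih, hx, hconj _ (hmem n)]

end graphManifold

/-! ### Tangent spaces near the origin. -/

section tangency
variable {p : ℕ} {j : Fin p} {d l : ℕ} {u₀ : Others j → ℂ} {k : ℕ} {c : ℂ} {a γ R D b : ℝ}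
  {L : (Others j → ℂ) ≃L[ℂ] Cn d × Cn l} {φ : ℂ × Cn d → Cn l}

/-- The slope `t` along the graph of `φ`, as a function of `(w, u)`. -/
noncomputable def wedgeSlope (a : ℝ) (L : (Others j → ℂ) ≃L[ℂ] Cn d × Cn l) (φ : ℂ × Cn d → Cn l)
    (q : ℂ × Cn d) : Others j → ℂ := q.1 ^ ((-a : ℝ) : ℂ) • L.symm (q.2, φ q)

theorem paramSlope_eq : paramSlope k a L φ = fun q : ℂ × Cn d => wedgeSlope a L φ (invPow k q.1, q.2) := by
  ext1 q
  simp [paramSlope, graphSlope, zeroSection, wedgeSlope]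

theorem differentiableOn_wedgeSlope (hφ : IsDecayingGraph φ γ R D b) :
    DifferentiableOn ℂ (wedgeSlope a L φ) (wedge (2 * γ) (R / 2) ×ˢ Metric.ball 0 (1 / 8)) := by
  intro q hq
  have h1 : DifferentiableAt ℂ (fun q : ℂ × Cn d => q.1 ^ ((-a : ℝ) : ℂ)) q :=
    differentiableAt_fst.cpow (differentiableAt_const _)
      (mem_slitPlane_of_mem_wedge hq.1 (by linarith [hφ.γ_pos]))
  have h2 := hφ.differentiableOn.differentiableAt
    (((isOpen_wedge _ _).prod Metric.isOpen_ball).mem_nhds hq)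
  exact (h1.smul ((L.symm : (Cn d × Cn l) →L[ℂ] (Others j → ℂ)).differentiableAt.comp q
    (differentiableAt_snd.prodMk h2))).differentiableWithinAt

theorem norm_wedgeSlope_le (hφ : IsDecayingGraph φ γ R D b) {q : ℂ × Cn d}
    (hq : q ∈ wedge (2 * γ) (R / 2) ×ˢ Metric.ball (0 : Cn d) (1 / 8)) :
    ‖wedgeSlope a L φ q‖ ≤ ‖(L.symm : (Cn d × Cn l) →L[ℂ] (Others j → ℂ))‖ * ‖q.1‖ ^ (-a) := by
  have h1 := (L.symm : (Cn d × Cn l) →L[ℂ] (Others j → ℂ)).le_opNorm (q.2, φ q)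
  have h2 : ‖(q.2, φ q)‖ ≤ 1 := by
    rw [Prod.norm_mk]
    exact max_le ((mem_ball_zero_iff.1 hq.2).le.trans (by norm_num))
      ((hφ.norm_le_quarter q hq).trans (by norm_num))
  rw [wedgeSlope, norm_smul, norm_cpow_ofReal (ne_zero_of_mem_wedge hq.1 (by linarith [hφ.γ_pos])), mul_comm]
  gcongr
  exact h1.trans (mul_le_of_le_one_right (norm_nonneg _) h2)

/-- Cauchy's estimate on a disc of radius `γ |w| / 8`: as the radius grows with `|w|`, the
derivative `w ∂t/∂w` decays as fast as the slope itself. The disc needs the doubled wedge on which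
`φ` is defined. -/
theorem norm_fderiv_wedgeSlope_le (ha : 0 < a) (hφ : IsDecayingGraph φ γ R D b) {w : ℂ} {u : Cn d}
    (hw : w ∈ wedge γ R) (hu : ‖u‖ < 1 / 16) :
    ‖fderiv ℂ (wedgeSlope a L φ) (w, u) (w, 0)‖ ≤
      16 / γ * ‖(L.symm : (Cn d × Cn l) →L[ℂ] (Others j → ℂ))‖ * (‖w‖ / 2) ^ (-a) := by
  have hγ := hφ.γ_pos
  have hw0 : 0 < ‖w‖ := norm_pos_iff.2 (ne_zero_of_mem_wedge hw hγ)
  have hmem : ∀ z ∈ Metric.ball w (γ / 8 * ‖w‖),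
      (z, u) ∈ wedge (2 * γ) (R / 2) ×ˢ Metric.ball (0 : Cn d) (1 / 8) := fun z hz =>
    ⟨mem_wedge_of_norm_sub_le hw hγ hφ.γ_le_one (mem_ball_iff_norm.1 hz).le,
      mem_ball_zero_iff.2 (hu.trans (by norm_num))⟩
  have hdiff : DifferentiableOn ℂ (fun z => wedgeSlope a L φ (z, u)) (Metric.ball w (γ / 8 * ‖w‖)) :=
    (differentiableOn_wedgeSlope hφ).comp (by fun_prop) hmem
  have hB : ∀ z ∈ Metric.ball w (γ / 8 * ‖w‖), ‖wedgeSlope a L φ (z, u)‖ ≤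
      ‖(L.symm : (Cn d × Cn l) →L[ℂ] (Others j → ℂ))‖ * (‖w‖ / 2) ^ (-a) := fun z hz => by
    refine (norm_wedgeSlope_le hφ (hmem z hz)).trans ?_
    have h1 := mem_ball_iff_norm'.1 hz
    have h2 := norm_sub_norm_le w z
    have h3 : γ / 8 * ‖w‖ ≤ 1 / 2 * ‖w‖ := 
      mul_le_mul_of_nonneg_right (by linarith [hφ.γ_le_one]) hw0.le
    gcongr ?_ * ?_
    exact Real.rpow_le_rpow_of_nonpos (by positivity) (by simp only; linarith) (by linarith)
  have h := norm_fderiv_le_of_norm_le_ball (by positivity) hdiff hB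
  have hd : HasFDerivAt (fun z => wedgeSlope a L φ (z, u))
      ((fderiv ℂ (wedgeSlope a L φ) (w, u)).comp (ContinuousLinearMap.inl ℂ ℂ (Cn d))) w :=
    HasFDerivAt.comp w (g := wedgeSlope a L φ) ((differentiableOn_wedgeSlope hφ).differentiableAt
      (((isOpen_wedge _ _).prod Metric.isOpen_ball).mem_nhds (hφ.mem hw hu))).hasFDerivAt
      (hasFDerivAt_prodMk_left (𝕜 := ℂ) w u)
  have h4 := (fderiv ℂ (fun z => wedgeSlope a L φ (z, u)) w).le_of_opNorm_le h w
  rw [hd.fderiv] at h4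
  refine h4.trans (le_of_eq ?_)
  field_simp
  ring

/-- Cauchy's estimate on a ball of radius `1/16` in `u`, which fits because `φ` lives on the ball of
radius `1/8`. -/
theorem norm_fderiv_graph_le (hφ : IsDecayingGraph φ γ R D b) {w : ℂ} {u : Cn d}
    (hw : w ∈ wedge γ R) (hu : ‖u‖ < 1 / 16) (h : Cn d) :
    ‖fderiv ℂ φ (w, u) (0, h)‖ ≤ 32 * D * ‖w‖ ^ (-b) * ‖h‖ := by
  have hmem : ∀ v ∈ Metric.ball u (1 / 16),
      (w, v) ∈ wedge (2 * γ) (R / 2) ×ˢ Metric.ball (0 : Cn d) (1 / 8) := fun v hv => by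
    refine ⟨(hφ.mem hw hu).1, mem_ball_zero_iff.2 ?_⟩
    have h1 := mem_ball_iff_norm.1 hv
    have h2 := norm_sub_norm_le v u
    linarith
  have hdiff : DifferentiableOn ℂ (fun v => φ (w, v)) (Metric.ball u (1 / 16)) :=
    hφ.differentiableOn.comp (by fun_prop) hmem
  have h1 := norm_fderiv_le_of_norm_le_ball (by norm_num) hdiff (B := D * ‖w‖ ^ (-b))
    (fun v hv => hφ.norm_le _ (hmem v hv))
  have hd : HasFDerivAt (fun v => φ (w, v))
      ((fderiv ℂ φ (w, u)).comp (ContinuousLinearMap.inr ℂ ℂ (Cn d))) u :=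
    (hφ.differentiableAt hw hu).hasFDerivAt.comp u (hasFDerivAt_prodMk_right w u)
  have h4 := (fderiv ℂ (fun v => φ (w, v)) u).le_of_opNorm_le h1 h
  rw [hd.fderiv] at h4
  refine h4.trans (le_of_eq ?_)
  ring

theorem fderiv_wedgeSlope_snd (hφ : IsDecayingGraph φ γ R D b) {w : ℂ} {u : Cn d}
    (hw : w ∈ wedge γ R) (hu : ‖u‖ < 1 / 16) (h : Cn d) :
    fderiv ℂ (wedgeSlope a L φ) (w, u) (0, h) =
      w ^ ((-a : ℝ) : ℂ) • L.symm (h, fderiv ℂ φ (w, u) (0, h)) := by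
  have h1 : HasFDerivAt (fun v => wedgeSlope a L φ (w, v))
      ((fderiv ℂ (wedgeSlope a L φ) (w, u)).comp (ContinuousLinearMap.inr ℂ ℂ (Cn d))) u :=
    ((differentiableOn_wedgeSlope hφ).differentiableAt (((isOpen_wedge _ _).prod
      Metric.isOpen_ball).mem_nhds (hφ.mem hw hu))).hasFDerivAt.comp u (hasFDerivAt_prodMk_right w u)
  have hd : HasFDerivAt (fun v => φ (w, v))
      ((fderiv ℂ φ (w, u)).comp (ContinuousLinearMap.inr ℂ ℂ (Cn d))) u :=
    (hφ.differentiableAt hw hu).hasFDerivAt.comp u (hasFDerivAt_prodMk_right w u)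
  have h2 : HasFDerivAt (fun v => wedgeSlope a L φ (w, v)) _ u :=
    (((L.symm : (Cn d × Cn l) →L[ℂ] (Others j → ℂ)).hasFDerivAt.comp u
      ((hasFDerivAt_id u).prodMk hd)).const_smul (w ^ ((-a : ℝ) : ℂ)))
  exact congrArg (fun T => T h) (h1.unique h2)

theorem hasFDerivAt_blowUp (u₀ : Others j → ℂ) (q : ℂ × (Others j → ℂ)) :
    HasFDerivAt (blowUp u₀)
      (q.1 • ((includeOthers j).toContinuousLinearMap.comp (ContinuousLinearMap.snd ℂ ℂ (Others j → ℂ))) +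
        (ContinuousLinearMap.fst ℂ ℂ (Others j → ℂ)).smulRight (affinePoint j (u₀ + q.2))) q := by
  have h : blowUp u₀ = fun q : ℂ × (Others j → ℂ) =>
      q.1 • (affinePoint j u₀ + ((includeOthers j).toContinuousLinearMap.comp
        (ContinuousLinearMap.snd ℂ ℂ (Others j → ℂ))) q) := by
    ext1 q
    rw [blowUp, affinePoint_add]
    rfl
  have h1 := hasFDerivAt_fst.fun_smul (((includeOthers j).toContinuousLinearMap.comp
    (ContinuousLinearMap.snd ℂ ℂ (Others j → ℂ))).hasFDerivAt.const_add (affinePoint j u₀) (x := q))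
  rw [h, affinePoint_add]
  exact h1

theorem fderiv_graphParam (hk : 1 ≤ k) (hφ : IsDecayingGraph φ γ R D b) {q : ℂ × Cn d}
    (hq : q ∈ graphDomain k d γ R) (h : ℂ × Cn d) :
    fderiv ℂ (graphParam u₀ k c a L φ) q h = (c * q.1) • includeOthers j
      (fderiv ℂ (wedgeSlope a L φ) (invPow k q.1, q.2) (h.1 * -(k * q.1⁻¹ * invPow k q.1), h.2)) +
      (c * h.1) • affinePoint j (u₀ + paramSlope k a L φ q) := by
  have hR : 0 < R := by linarith [hφ.one_le]
  have hx := ne_zero_of_mem_planeSector hk hq.1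
  have hw := invPow_mem_wedge hk hR hq.1
  have hu := mem_ball_zero_iff.1 hq.2
  have h1 := ((differentiableOn_wedgeSlope (a := a) (L := L) hφ).differentiableAt (((isOpen_wedge _ _).prod
    Metric.isOpen_ball).mem_nhds (hφ.mem hw hu))).hasFDerivAt
  have h2 := (HasFDerivAt.comp q (g := invPow k) (f := Prod.fst) (hasDerivAt_invPow k hx).hasFDerivAt
    hasFDerivAt_fst).prodMk (hasFDerivAt_snd (𝕜 := ℂ) (E := ℂ) (F := Cn d) (p := q))
  have h3 := HasFDerivAt.comp q (g := wedgeSlope a L φ) (f := fun q : ℂ × Cn d => (invPow k q.1, q.2)) h1 h2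
  have h4 : HasFDerivAt (graphParam u₀ k c a L φ) _ q :=
    HasFDerivAt.comp q (f := fun q : ℂ × Cn d => (c * q.1, paramSlope k a L φ q)) (hasFDerivAt_blowUp u₀ _)
      (((hasFDerivAt_fst (𝕜 := ℂ) (E := ℂ) (F := Cn d) (p := q)).const_mul c).prodMk
        (h3.congr_of_eventuallyEq (Eventually.of_forall fun q => congrFun paramSlope_eq q)))
  rw [h4.fderiv]
  simp

theorem tendsto_norm_invPow_domainZero (hk : 1 ≤ k) :
    Tendsto (fun q : ℂ × Cn d => ‖invPow k q.1‖) (domainZero k d γ R) atTop :=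
  (tendsto_norm_invPow hk).comp (tendsto_nhdsWithin_iff.2 ⟨tendsto_comap.mono_left inf_le_left,
    mem_inf_of_right fun _ hq => ne_zero_of_mem_planeSector hk hq.1⟩)

/-- Since `dw/dx = -k w / x`, the slope contributes `-c k w ∂t/∂w`, free of negative powers of `x`.
It tends to zero and leaves the derivative of `c x (1, u₀ + t)` in the explicit `x`. -/
theorem tendsto_fderiv_graphParam_fst (hk : 1 ≤ k) (hc : c ≠ 0) (ha : 0 < a) (hak : 2 * a ≤ 1 / k)
    (hφ : IsDecayingGraph φ γ R D b) :
    Tendsto (fun q => fderiv ℂ (graphParam u₀ k c a L φ) q (1, 0)) (domainZero k d γ R)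
      (𝓝 (c • affinePoint j u₀)) := by
  have hR : 0 < R := by linarith [hφ.one_le]
  have hS : ∀ᶠ q in domainZero k d γ R, q ∈ graphDomain k d γ R := mem_inf_of_right (mem_principal_self _)
  have h1 : Tendsto (fun q => c • affinePoint j (u₀ + paramSlope k a L φ q)) (domainZero k d γ R)
      (𝓝 (c • affinePoint j u₀)) := by
    have := ((tendsto_paramCoords (L := L) hk hc ha hak hφ).mono_right inf_le_left).snd_nhds
    have := (((continuous_affinePoint j).tendsto _).comp (this.const_add u₀)).const_smul c
    rwa [Prod.snd_zero, add_zero] at this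
  have h2 : Tendsto (fun q : ℂ × Cn d => fderiv ℂ (wedgeSlope a L φ) (invPow k q.1, q.2) (invPow k q.1, 0))
      (domainZero k d γ R) (𝓝 0) := by
    have := ((tendsto_rpow_neg_atTop ha).comp ((tendsto_norm_invPow_domainZero (d := d) (γ := γ)
      (R := R) hk).atTop_div_const two_pos)).const_mul
        (16 / γ * ‖(L.symm : (Cn d × Cn l) →L[ℂ] (Others j → ℂ))‖)
    rw [mul_zero] at this
    exact squeeze_zero_norm' (hS.mono fun q hq => norm_fderiv_wedgeSlope_le ha hφ
      (invPow_mem_wedge hk hR hq.1) (mem_ball_zero_iff.1 hq.2)) this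
  have h3 := (((includeOthers j).toContinuousLinearMap.continuous.tendsto 0).comp h2).const_smul (-(c * k))
  rw [map_zero, smul_zero] at h3
  have h4 := h3.add h1
  rw [zero_add] at h4
  refine h4.congr' (hS.mono fun q hq => ?_)
  have hx := ne_zero_of_mem_planeSector hk hq.1
  have e : ((1 : ℂ) * -(k * q.1⁻¹ * invPow k q.1), (0 : Cn d)) =
      (-(k * q.1⁻¹) : ℂ) • (invPow k q.1, (0 : Cn d)) := by
    ext1 <;> simp
  simp only [Function.comp]
  rw [fderiv_graphParam hk hφ hq]
  simp only [e, map_smul, smul_smul, mul_one]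
  congr 2
  field_simp

/-- The tangent vectors in the `u`-directions shrink like `x w^(-a)`. Rescaled by the inverse factor
they become `L⁻¹ (h, ∂φ/∂u h)`, and `∂φ/∂u` tends to zero. -/
theorem tendsto_fderiv_graphParam_snd (hk : 1 ≤ k) (hc : c ≠ 0) (hφ : IsDecayingGraph φ γ R D b)
    (h : Cn d) :
    Tendsto (fun q => fderiv ℂ (graphParam u₀ k c a L φ) q
      (0, (invPow k q.1 ^ (a : ℂ) * (c * q.1)⁻¹) • h)) (domainZero k d γ R)
      (𝓝 (includeOthers j (L.symm (h, 0)))) := by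
  have hR : 0 < R := by linarith [hφ.one_le]
  have hS : ∀ᶠ q in domainZero k d γ R, q ∈ graphDomain k d γ R := mem_inf_of_right (mem_principal_self _)
  have h1 : Tendsto (fun q : ℂ × Cn d => fderiv ℂ φ (invPow k q.1, q.2) (0, h)) (domainZero k d γ R)
      (𝓝 0) := by
    have := (((tendsto_rpow_neg_atTop hφ.b_pos).comp (tendsto_norm_invPow_domainZero (d := d) (γ := γ)
      (R := R) hk)).const_mul (32 * D)).mul_const ‖h‖
    rw [mul_zero, zero_mul] at this
    exact squeeze_zero_norm' (hS.mono fun q hq => norm_fderiv_graph_le hφ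
      (invPow_mem_wedge hk hR hq.1) (mem_ball_zero_iff.1 hq.2) h) this
  have h2 := ((includeOthers j).toContinuousLinearMap.continuous.tendsto _).comp
    ((L.symm.continuous.tendsto _).comp ((tendsto_const_nhds (x := h)).prodMk_nhds h1))
  refine h2.congr' (hS.mono fun q hq => ?_)
  have hx := ne_zero_of_mem_planeSector hk hq.1
  have e : ((0 : ℂ) * -(k * q.1⁻¹ * invPow k q.1), (invPow k q.1 ^ (a : ℂ) * (c * q.1)⁻¹) • h) =
      (invPow k q.1 ^ (a : ℂ) * (c * q.1)⁻¹) • ((0 : ℂ), h) := by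
    ext1 <;> simp
  simp only [Function.comp]
  rw [fderiv_graphParam hk hφ hq]
  simp only [e, map_smul, smul_smul, mul_zero, zero_smul, add_zero]
  rw [fderiv_wedgeSlope_snd hφ (invPow_mem_wedge hk hR hq.1) (mem_ball_zero_iff.1 hq.2), map_smul,
    smul_smul, mul_left_comm, mul_inv_cancel₀ (mul_ne_zero hc hx), mul_one,
    cpow_mul_cpow_neg (invPow_ne_zero hx), one_smul]
  rfl

theorem includeOthers_injective (j : Fin p) : Function.Injective (includeOthers j) := by
  intro u v h
  ext i
  have := congrArg (fun z : Cn p => z i.1) h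
  simpa [includeOthers, i.2] using this

theorem finrank_linePlus {V : Cn p} (hV : V j ≠ 0) (E : Submodule ℂ (Others j → ℂ)) :
    Module.finrank ℂ (linePlus j V E) = Module.finrank ℂ E + 1 := by
  have hdisj : Submodule.span ℂ {V} ⊓ E.map (includeOthers j) = ⊥ := by
    rw [Submodule.eq_bot_iff]
    rintro x ⟨h1, h2⟩
    obtain ⟨α, rfl⟩ := Submodule.mem_span_singleton.1 h1
    obtain ⟨e, -, he⟩ := h2
    have := congrArg (fun z : Cn p => z j) he
    simp only [includeOthers, LinearMap.coe_mk, AddHom.coe_mk, PiLp.smul_apply, smul_eq_mul] at this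
    have hα : α = 0 := by simpa [hV] using this.symm
    rw [hα, zero_smul]
  have h := Submodule.finrank_sup_add_finrank_inf_eq (Submodule.span ℂ {V}) (E.map (includeOthers j))
  rw [hdisj, finrank_bot, add_zero, finrank_span_singleton (fun h => hV (by simp [h])),
    ← (Submodule.equivMapOfInjective _ (includeOthers_injective j) E).finrank_eq] at h
  rw [linePlus, h, add_comm]

theorem isTangentToSubspace_graphParam (hk : 1 ≤ k) (hc : c ≠ 0) (ha : 0 < a) (hak : 2 * a ≤ 1 / k)
    (hφ : IsDecayingGraph φ γ R D b) {V : Cn p} (hV : V j ≠ 0) {E : Submodule ℂ (Others j → ℂ)}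
    (hE : ∀ e ∈ E, (L e).2 = 0) (hd : Module.finrank ℂ E = d) (J : Cn (d + 1) ≃L[ℂ] ℂ × Cn d) :
    IsTangentToSubspace (J ⁻¹' graphDomain k d γ R) (graphParam (affineCoord j V) k c a L φ ∘ J)
      (linePlus j V E) := by
  refine ⟨by rw [finrank_linePlus hV, hd], fun w hw => ?_⟩
  set ψ := graphParam (affineCoord j V) k c a L φ
  obtain ⟨y, hy, z, ⟨e, he, rfl⟩, rfl⟩ := Submodule.mem_sup.1 hw
  obtain ⟨α, rfl⟩ := Submodule.mem_span_singleton.1 hy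
  have h1 := (tendsto_fderiv_graphParam_fst (u₀ := affineCoord j V) (L := L) hk hc ha hak hφ).const_smul
    (α * V j * c⁻¹)
  have h2 := tendsto_fderiv_graphParam_snd (u₀ := affineCoord j V) (a := a) (L := L) hk hc hφ (L e).1
  have e1 : (α * V j * c⁻¹) • c • affinePoint j (affineCoord j V) = α • V := by
    rw [affinePoint_affineCoord hV, smul_smul, smul_smul]
    congr 1
    field_simp
  have e2 : L.symm ((L e).1, 0) = e := by
    rw [← hE e he]
    exact L.symm_apply_apply e
  rw [e1] at h1
  rw [e2] at h2
  have h3 := h1.add h2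
  -- Convergence of the point to `0` yields `x → 0`, since its `j`-th coordinate is `c x`; nothing
  -- is claimed about `u`.
  have hJ : Tendsto J (comap (ψ ∘ J) (𝓝 0) ⊓ 𝓟 (J ⁻¹' graphDomain k d γ R)) (domainZero k d γ R) := by
    refine tendsto_inf.2 ⟨tendsto_comap_iff.2 ?_, tendsto_principal.2 (mem_inf_of_right (mem_principal_self _))⟩
    have h4 : Tendsto (ψ ∘ J) (comap (ψ ∘ J) (𝓝 0) ⊓ 𝓟 (J ⁻¹' graphDomain k d γ R)) (𝓝 0) :=
      tendsto_comap.mono_left inf_le_left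
    have h5 := (((EuclideanSpace.proj (𝕜 := ℂ) j : Cn p →L[ℂ] ℂ).continuous.tendsto 0).comp h4).const_mul c⁻¹
    rw [map_zero, mul_zero] at h5
    refine h5.congr fun X => ?_
    have : ψ (J X) j = c * (J X).1 := graphParam_apply_self _
    change c⁻¹ * ψ (J X) j = (J X).1
    rw [this, inv_mul_cancel_left₀ hc]
  have h6 := tendsto_iff_dist_tendsto_zero.1 (h3.comp hJ)
  refine squeeze_zero' (Eventually.of_forall fun X => Metric.infDist_nonneg) ?_ h6
  have hS : ∀ᶠ X in comap (ψ ∘ J) (𝓝 0) ⊓ 𝓟 (J ⁻¹' graphDomain k d γ R), X ∈ J ⁻¹' graphDomain k d γ R :=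
    mem_inf_of_right (mem_principal_self _)
  filter_upwards [hS] with X hX
  rw [dist_comm]
  refine Metric.infDist_le_dist_of_mem ?_
  rw [fderiv_comp _ (differentiableAt_graphParam hk hφ hX) J.differentiableAt, J.fderiv]
  simp only [Function.comp]
  rw [← map_smul, ← map_add]
  exact ⟨J.symm _, congrArg _ (J.apply_symm_apply _)⟩

end tangency

/-! ### The director matrix in the chart and the proof of the theorem. -/

section director
variable {p : ℕ} {j : Fin p} {Φ : Cn p → Cn p} {n : ℕ} {V : Cn p}

theorem exists_homPart_affinePoint (hV : IsNondegenerateCharacteristic (homPart Φ n) V) (hj : V j ≠ 0) :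
    ∃ c : ℂ, c ≠ 0 ∧ homPart Φ n (affinePoint j (affineCoord j V)) = c • affinePoint j (affineCoord j V) := by
  obtain ⟨c, hc⟩ := hV.eigen
  have hc0 : c ≠ 0 := by
    rintro rfl
    exact hV.nondegenerate (by rw [hc, zero_smul])
  refine ⟨(V j)⁻¹ ^ n * c * V j, by positivity, ?_⟩
  rw [affinePoint_affineCoord hj, homPart_smul, hc, smul_smul, smul_smul, mul_assoc _ (V j),
    mul_inv_cancel₀ hj, mul_one]

theorem homPart_affinePoint_ne_zero (hV : IsNondegenerateCharacteristic (homPart Φ n) V) (hj : V j ≠ 0) :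
    homPart Φ n (affinePoint j (affineCoord j V)) j ≠ 0 := by
  obtain ⟨c, hc, h⟩ := exists_homPart_affinePoint hV hj
  rw [h]
  simpa using hc

theorem charMap_affineCoord (hV : IsNondegenerateCharacteristic (homPart Φ n) V) (hj : V j ≠ 0) :
    charMap (homPart Φ n) j (affineCoord j V) = 0 := by
  obtain ⟨c, hc, h⟩ := exists_homPart_affinePoint hV hj
  ext i
  simp [charMap, h]

theorem smul_toLin'_directorMatrix {P : Cn p → Cn p} {k : ℕ} (hk : 1 ≤ k)
    (hP : P (affinePoint j (affineCoord j V)) j ≠ 0) (t : Others j → ℂ) :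
    (k * P (affinePoint j (affineCoord j V)) j) • Matrix.toLin' (directorMatrix P k j V) t =
      fderiv ℂ (charMap P j) (affineCoord j V) t := by
  have hk' : (k : ℂ) ≠ 0 := by exact_mod_cast (by omega : k ≠ 0)
  rw [directorMatrix, map_smul, Matrix.toLin'_toMatrix', LinearMap.smul_apply,
    smul_inv_smul₀ (mul_ne_zero hk' hP)]
  rfl

theorem card_filter_roots_charpoly_toLin' {ι : Type} [Fintype ι] [DecidableEq ι] (A : Matrix ι ι ℂ)
    [DecidablePred (· ∈ {μ : ℂ | 0 < μ.re})] :
    ((Matrix.toLin' A).charpoly.roots.filter (· ∈ {μ : ℂ | 0 < μ.re})).card = attractingCount A := by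
  rw [Matrix.charpoly_toLin', attractingCount]
  congr 1
  exact Multiset.filter_congr fun μ _ => Iff.rfl

end director

theorem re_inner_sub_smul {U : Type*} [NormedAddCommGroup U] [InnerProductSpace ℂ U] {A : Module.End ℂ U}
    {c : ℝ} (a : ℝ) (h : ∀ u, c * ‖u‖ ^ 2 ≤ (inner ℂ u (A u)).re) (u : U) :
    (c - a) * ‖u‖ ^ 2 ≤ (inner ℂ u (A u - (a : ℂ) • u)).re := by
  rw [inner_sub_right, inner_smul_right, Complex.sub_re, Complex.re_ofReal_mul, inner_self_eq_norm_sq_to_K]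
  have e : ((‖u‖ : ℂ) ^ 2).re = ‖u‖ ^ 2 := by rw [← Complex.ofReal_pow, Complex.ofReal_re]
  have := h u
  simp only [Complex.coe_algebraMap]
  rw [e]
  linarith

/-- The stable graph is restricted to half the aperture, at most half the radius in `u`, and a
radius `R₁ ≥ 2 R₀`. The smaller region is mapped into itself, and the margin is what the Cauchy
estimates for the tangency require. -/
theorem exists_isDecayingGraph {U V : Type} [NormedAddCommGroup U] [InnerProductSpace ℂ U]
    [NormedAddCommGroup V] [InnerProductSpace ℂ V] [CompleteSpace U] [CompleteSpace V]
    {F : ℂ × U × V → ℂ × U × V} {P : U →L[ℂ] U} {Q : V →L[ℂ] V} {a R C c : ℝ} (ha : 0 < a) (ha1 : a ≤ 1)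
    (hC : 0 ≤ C) (hc : 0 < c) (hP : ∀ u, c * ‖u‖ ^ 2 ≤ (inner ℂ u (P u)).re)
    (hQ : ∀ v, c * ‖v‖ ^ 2 ≤ (inner ℂ v (Q v)).re) (hF : IsHyperbolicOnWedge F P Q a 1 R C) :
    ∃ (φ : ℂ × U → V) (γ₁ R₁ D : ℝ), IsDecayingGraph φ γ₁ R₁ D (a / 4) ∧
      ∀ q ∈ wedge γ₁ R₁ ×ˢ Metric.ball (0 : U) (1 / 16),
        (q.1, q.2, φ q) ∈ wedge 1 R ×ˢ Metric.ball (0 : U × V) 1 ∧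
        ((F (q.1, q.2, φ q)).1, (F (q.1, q.2, φ q)).2.1) ∈ wedge γ₁ R₁ ×ˢ Metric.ball (0 : U) (1 / 16) ∧
        φ ((F (q.1, q.2, φ q)).1, (F (q.1, q.2, φ q)).2.1) = (F (q.1, q.2, φ q)).2.2 ∧
        ∃ x : ℕ → ℂ × U × V, x 0 = (q.1, q.2, φ q) ∧ (∀ n, x (n + 1) = F (x n)) ∧
          (∀ n, x n ∈ wedge 1 R ×ˢ Metric.ball (0 : U × V) 1) ∧
          Tendsto (fun n => ‖(x n).1‖) atTop atTop := by
  obtain ⟨γ₀, R₀, hr⟩ := exists_isPerronRegion (R := R) ha ha1 one_pos hC hc hP hQ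
  obtain ⟨φ, D, hφ, h⟩ := exists_stable_graph hF hr
  obtain ⟨R₁, hR₁, hinv⟩ := exists_invariant_wedge hF hr (by norm_num : (0 : ℝ) < 1 / 16)
  have hγ₀ := hr.γ₀_pos
  have hR₀ := hr.one_le
  have hsub : wedge (2 * (γ₀ / 2)) (R₁ / 2) ×ˢ Metric.ball (0 : U) (1 / 8) ⊆
      wedge γ₀ R₀ ×ˢ Metric.ball (0 : U) (1 / 8) :=
    prod_mono (wedge_mono (by linarith) (by linarith) (by linarith)) subset_rfl
  have hgraph : IsDecayingGraph φ (γ₀ / 2) R₁ D (a / 4) :=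
    { γ_pos := by linarith
      γ_le_one := by linarith [hr.γ₀_le_one]
      one_le := by linarith
      b_pos := by linarith
      differentiableOn := hφ.mono hsub
      norm_le := fun q hq => (h q (hsub hq)).1
      norm_le_quarter := fun q hq => (h q (hsub hq)).2.1 }
  refine ⟨φ, γ₀ / 2, R₁, D, hgraph, fun q hq => ?_⟩
  have hmem := fun q (hq : q ∈ wedge (γ₀ / 2) R₁ ×ˢ Metric.ball (0 : U) (1 / 16)) =>
    hsub (hgraph.mem hq.1 (mem_ball_zero_iff.1 hq.2))
  obtain ⟨-, -, ⟨x, hx0, hx⟩, hφF⟩ := h q (hmem q hq)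
  have h1 : (q.1, q.2, φ q) ∈ wedge 1 R ×ˢ Metric.ball (0 : U × V) 1 := hx0 ▸ hx.2.1 0
  have h2 := hinv q.1 hq.1 q.2 hq.2 (φ q) h1.2
  exact ⟨h1, h2, hφF (hmem (_, _) h2), x, hx0, hx⟩

theorem theorem8p3 {p : ℕ} (hp : 2 ≤ p) (k d : ℕ) (Φ : Cn p → Cn p)
    (hΦ : IsTangentToIdentityOfOrder Φ k)
    (V : Cn p) (hV : IsNondegenerateCharacteristic (homPart Φ (k + 1)) V)
    (j : Fin p) (hj : V j ≠ 0)
    (A : Matrix (Others j) (Others j) ℂ)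
    (hA : A = directorMatrix (homPart Φ (k + 1)) k j V)
    (hd : attractingCount A = d) :
    ∃ (M : Set (Cn p)) (S : Set (Cn (d + 1))) (ψ : Cn (d + 1) → Cn p),
      IsParabolicManifold Φ V (d + 1) M S ψ ∧
      (0 : Cn p) ∈ frontier M ∧
      IsTangentToSubspace S ψ (linePlus j V (attractingEigenspace A)) ∧
      (∀ z ∈ M, TendstoDirection (fun m : ℕ => Φ^[m] z) atTop V) ∧
      ∃ e : OpenPartialHomeomorph (Cn p) (ℂ × Cn d × Cn (p - d - 1)),
        IsSectorialCoordinates k V e ∧ M = {z ∈ e.source | (e z).2.2 = 0} := by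
  classical
  have hk := hΦ.one_le
  have hk0 : (k : ℂ) ≠ 0 := by exact_mod_cast (by omega : k ≠ 0)
  have hp0 := homPart_affinePoint_ne_zero hV hj
  set T : Module.End ℂ (Others j → ℂ) := Matrix.toLin' A with hTdef
  have hcard : (T.charpoly.roots.filter (· ∈ {μ : ℂ | 0 < μ.re})).card = d := by
    rw [card_filter_roots_charpoly_toLin', hd]
  have hE : attractingEigenspace A = spectralSubspace T {μ : ℂ | 0 < μ.re} := rfl
  have hEd : Module.finrank ℂ (attractingEigenspace A) = d := by
    rw [hE, finrank_spectralSubspace, hcard]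
  have hfin : Module.finrank ℂ (Others j → ℂ) = p - 1 := by
    rw [Module.finrank_fintype_fun_eq_card, Fintype.card_subtype_compl, Fintype.card_fin,
      Fintype.card_subtype_eq]
  -- As `E` is a subspace of dimension `d` in a space of dimension `p - 1`, the truncated
  -- subtraction is exact.
  have hdl : d + (p - d - 1) = Module.finrank ℂ (Others j → ℂ) := by
    have := (attractingEigenspace A).finrank_le
    omega
  obtain ⟨c₀, hc₀, hsplit⟩ := exists_hyperbolic_splitting T d (p - d - 1) hcard hdl
  have hkr : (1 : ℝ) ≤ k := by exact_mod_cast hk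
  -- The first bound gives `x = O(|w|^(-2a))`; the second keeps `A₁ - a` accretive with constant `c₀
  -- / 2`.
  set a : ℝ := min (1 / (2 * k)) (c₀ / 2) with hadef
  have ha : 0 < a := lt_min (by positivity) (by positivity)
  have ha1 : a ≤ 1 / (2 * k) := min_le_left _ _
  have hac : a ≤ c₀ / 2 := min_le_right _ _
  have hak : 2 * a ≤ 1 / k := by
    have : 2 * (1 / (2 * k : ℝ)) = 1 / k := by field_simp
    linarith
  have ha1' : a ≤ 1 := by
    have : 1 / (k : ℝ) ≤ 1 := (div_le_one (by linarith)).2 hkr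
    linarith
  obtain ⟨L₀, A₁, A₂, hL, hLE, hA₁, c₁, hc₁, hA₂⟩ := hsplit a ha
  let L : (Others j → ℂ) ≃L[ℂ] Cn d × Cn (p - d - 1) := L₀.toContinuousLinearEquiv
  let P : Cn d →L[ℂ] Cn d := LinearMap.toContinuousLinearMap A₁ - (a : ℂ) • ContinuousLinearMap.id ℂ (Cn d)
  let Q : Cn (p - d - 1) →L[ℂ] Cn (p - d - 1) :=
    (a : ℂ) • ContinuousLinearMap.id ℂ (Cn (p - d - 1)) - LinearMap.toContinuousLinearMap A₂
  have hPQ : ∀ s, L (T (L.symm s)) = (P s.1 + (a : ℂ) • s.1, (a : ℂ) • s.2 - Q s.2) := by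
    intro s
    have h1 : L (T (L.symm s)) = (A₁ (L (L.symm s)).1, A₂ (L (L.symm s)).2) := hL _
    rw [h1, L.apply_symm_apply]
    simp [P, Q]
  have hP : ∀ u, min (c₀ / 2) c₁ * ‖u‖ ^ 2 ≤ (inner ℂ u (P u)).re := fun u => by
    refine le_trans ?_ (re_inner_sub_smul a hA₁ u)
    gcongr
    exact (min_le_left _ _).trans (by linarith)
  have hQ : ∀ v, min (c₀ / 2) c₁ * ‖v‖ ^ 2 ≤ (inner ℂ v (Q v)).re := fun v => by
    refine le_trans ?_ (hA₂ v)
    gcongr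
    exact min_le_right _ _
  -- With this `k`-th root the variable `w` moves by `+1`, so that the positive real axis of the
  -- `x`-plane becomes an attracting direction.
  obtain ⟨c, hck⟩ := IsAlgClosed.exists_pow_nat_eq
    (-(k * homPart Φ (k + 1) (affinePoint j (affineCoord j V)) j)⁻¹) hk
  have hck' : c ^ k * (k * homPart Φ (k + 1) (affinePoint j (affineCoord j V)) j) = -1 := by
    rw [hck, neg_mul, inv_mul_cancel₀ (mul_ne_zero hk0 hp0)]
  have hc : c ≠ 0 := by
    rintro rfl
    rw [zero_pow (by omega), zero_mul] at hck'
    norm_num at hck'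
  obtain ⟨R, C, hC, hF, hconj⟩ := exists_isHyperbolicOnWedge (L := L) hΦ hc ha hak hck'
    (charMap_affineCoord hV hj) T (fun t => by rw [hTdef, hA, smul_toLin'_directorMatrix hk hp0]) P Q hPQ
  obtain ⟨φ, γ, R₁, D, hφ, hgraph⟩ := exists_isDecayingGraph ha ha1' hC (lt_min (by linarith) hc₁) hP hQ hF
  have hinv := mapsTo_image_graphParam hk hφ (fun q hq => hconj _ (hgraph q hq).1)
    (fun q hq => (hgraph q hq).2.1) (fun q hq => (hgraph q hq).2.2.1)
  have horb := exists_orbit_image_graphParam hk hc ha hak hφ hconj (fun q hq => (hgraph q hq).2.2.2)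
  let J : Cn (d + 1) ≃L[ℂ] ℂ × Cn d := ContinuousLinearEquiv.ofFinrankEq (by simp [add_comm])
  refine ⟨_, _, _, isParabolicManifold_graphParam hk hc ha hak hφ hj hinv (fun z hz => ?_) J,
    zero_mem_frontier_image_graphParam hk hc ha hak hφ,
    isTangentToSubspace_graphParam hk hc ha hak hφ hj (fun e he => (hLE e).1 he) hEd J, fun z hz => ?_,
    graphHomeomorph (affineCoord j V) a L hk hc hφ,
    isSectorialCoordinates_graphHomeomorph hk hc ha hak hφ hj, image_graphParam hk hc hφ⟩
  · obtain ⟨y, hy, h⟩ := horb z hz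
    exact ((tendsto_blowUp _).comp (hy.mono_right inf_le_left)).congr fun n => (h n).symm
  · obtain ⟨y, hy, h⟩ := horb z hz
    rw [funext h]
    exact tendstoDirection_blowUp hj hy
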